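/- **Theorem (Semi-group properties in geometric homogenization).** Let $\Omega\subset\mathbb{R}^2$ be a nonempty, bounded, open, convex set. *Conductivities.* $\mathcal M$ is the set of measurable, a.e. symmetric, uniformly elliptic and bounded $2\times2$ matrix fields on $\Omega$. For $\sigma\in\mathcal M$, its harmonic coordinates $F=(F_1,F_2)$ are the weak solutions $F_i\in H^1(\Omega)$ of $\operatorname{div}(\sigma\nabla F_i)=0$ in $\Omega$, $F_i-x_i\in H^1_0(\Omega)$; $\nabla F$ is the matrix with columns $\nabla F_1,\nabla F_2$. $\mathcal M_{\rm div}$ is the set of fields $Q=\frac{(\nabla F)^T\sigma\nabla F}{\det\nabla F}\circ F^{-1}$ (a.e. in $\Omega$), where $\sigma\in\mathcal M$ and (so that the formula makes sense) the harmonic coordinates $F$ of $\sigma$ are a homeomorphism of $\overline\Omega$ with $\det\nabla F>0$ a.e. $\mathcal S$ is the set of convex functions $s\in W^{2,1}(\Omega)$, continuous on $\overline\Omega$, with $\det \operatorname{Hess} s$ bounded away from $0$ and $\infty$ a.e. (functions that differ by an affine function being identified). *Triangulations.* A triangulation $\Omega_h$ of $\Omega$ is a finite simplicial complex with underlying set $\overline\Omega$.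 Let $x_i$ be its nodes (boundary nodes included), $\varphi_i$ the piecewise linear nodal basis functions on $\overline\Omega$, and $\mathcal E_h$ the set of interior edges, i.e. edges $(i,j)$ shared by two triangles. Put $$(T_{q^h,\sigma}[\sigma])_{ij}=-\int_\Omega\nabla(\varphi_i\circ F)^T\sigma\,\nabla(\varphi_j\circ F),\qquad (T_{q^h,Q}[Q])_{ij}=-\int_\Omega(\nabla\varphi_i)^TQ\,\nabla\varphi_j,\qquad (i,j)\in\mathcal E_h,$$ $\mathcal Q_h=T_{q^h,\sigma}[\mathcal M]$, $T_{s^h,s}[s]=\sum_i s(x_i)\varphi_i$ (sum over all nodes) and $\mathcal S_h=T_{s^h,s}[\mathcal S]$. For $q:\mathcal E_h\to\mathbb R$ put $q_{ii}=-\sum_{j:(i,j)\in\mathcal E_h}q_{ij}$ and $q_{ij}=0$ if $i\ne j$ and $(i,j)\notin\mathcal E_h$. For a piecewise linear function $s^h$ with nodal values $s_i$ and an interior edge $(i,j)$ with adjacent triangles $ijk$ and $ijl$, put $$(T_{q^h,s^h}[s^h])_{ij}=\sum_{m\in\{k,l\}}\Big(-\tfrac{1}{|e_{ij}|^2}\big(\cot\theta_{ijm}\,s_i+\cot\theta_{jim}\,s_j\big)+\tfrac{1}{2|t_{ijm}|}s_m\Big),$$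 where $|e_{ij}|$ is the length of the edge, $|t_{ijm}|$ the area of the triangle $ijm$ and $\theta_{ijm}$ its angle at $j$. *Coarse graining.* Let $\Omega_{h_F}$ be a sub-triangulation of $\Omega_{h_C}$ (every simplex of $\Omega_{h_F}$ lies in a simplex of $\Omega_{h_C}$), and $\phi_{ik}=\varphi_i^C(x_k)$ for the fine nodes $x_k$. Define linear operators $$(T_{q^{h_C},q^{h_F}}[q])_{ij}=\sum_{k,l}\phi_{ik}\phi_{jl}\,q_{kl}\quad((i,j)\in\mathcal E_{h_C}),\qquad T_{s^{h_C},s^{h_F}}[s^{h_F}]=\sum_{i}s^{h_F}(x_i)\varphi_i^C,$$ the first sum over all fine nodes $k,l$ ($k=l$ included), the second over all coarse nodes; the first acts on all functions $\mathcal E_{h_F}\to\mathbb R$, the second on all piecewise linear functions on $\Omega_{h_F}$. Then $\varphi^C_i=\sum_k\phi_{ik}\varphi^F_k$, the operators map $\mathcal Q_{h_F}$ into $\mathcal Q_{h_C}$ and $\mathcal S_{h_F}$ into $\mathcal S_{h_C}$, and: 1. $T_{s^{h_C},s^{h_F}}[s^{h_F}]=T_{s^{h_C},s}[s^{h_F}]$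 for every piecewise linear $s^{h_F}$ on $\Omega_{h_F}$ (in particular for $s^{h_F}\in\mathcal S_{h_F}$). 2. $T_{q^{h_C},Q}[Q]=T_{q^{h_C},q^{h_F}}\circ T_{q^{h_F},Q}[Q]$ for $Q\in\mathcal M_{\rm div}$. 3. $T_{s^{h_C},s}[s]=T_{s^{h_C},s^{h_F}}\circ T_{s^{h_F},s}[s]$ for $s\in\mathcal S$. 4. $T_{q^{h_C},\sigma}[\sigma]=T_{q^{h_C},q^{h_F}}\circ T_{q^{h_F},\sigma}[\sigma]$ for $\sigma\in\mathcal M$. 5. $T_{q^{h_C},q^{h_F}}\circ T_{q^{h_F},s^{h_F}}=T_{q^{h_C},s^{h_C}}\circ T_{s^{h_C},s^{h_F}}$ on all piecewise linear functions on $\Omega_{h_F}$. Moreover, every $q\in\mathcal Q_{h_F}$ has a preimage under $T_{q^{h_F},s^{h_F}}$ among the piecewise linear functions, its preimages are exactly the functions that differ from it by an affine function, and $T_{q^{h_C},q^{h_F}}[q]=T_{q^{h_C},s^{h_C}}\circ T_{s^{h_C},s^{h_F}}\circ T_{q^{h_F},s^{h_F}}^{-1}[q]$. 6. For nested triangulations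 $\Omega_{h_1},\Omega_{h_2},\Omega_{h_3}$ (each a sub-triangulation of the next), $T_{s^{h_3},s^{h_1}}=T_{s^{h_3},s^{h_2}}\circ T_{s^{h_2},s^{h_1}}$. 7. For the same triangulations, $T_{q^{h_3},q^{h_1}}=T_{q^{h_3},q^{h_2}}\circ T_{q^{h_2},q^{h_1}}$. -/

import Mathlib

open MeasureTheory Set Filter Topology
open scoped Gradient ContDiff ENNReal

noncomputable section

namespace GeomHom

/-- The Euclidean plane. -/
abbrev Plane : Type := EuclideanSpace ℝ (Fin 2)

/-- The bilinear form `vᵀ A w`. -/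
def form (A : Matrix (Fin 2) (Fin 2) ℝ) (v w : Plane) : ℝ :=
  ∑ a, ∑ b, v a * A a b * w b

/-! ### Weak derivatives and Sobolev spaces on a planar domain -/

/-- Smooth functions with compact support in `Ω`. -/
def IsTest (Ω : Set Plane) (φ : Plane → ℝ) : Prop :=
  ContDiff ℝ ∞ φ ∧ HasCompactSupport φ ∧ tsupport φ ⊆ Ω

/-- `g` is the weak (distributional) gradient of `u` on the open set `Ω`. -/
def IsWeakGrad (Ω : Set Plane) (u : Plane → ℝ) (g : Plane → Plane) : Prop :=
  LocallyIntegrableOn u Ω ∧ LocallyIntegrableOn g Ω ∧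
    ∀ φ, IsTest Ω φ → ∫ x in Ω, u x • (∇ φ) x = - ∫ x in Ω, φ x • g x

open Classical in
/-- The weak gradient of `u` on `Ω` (unique almost everywhere), and `0` if there is none. -/
def weakGrad (Ω : Set Plane) (u : Plane → ℝ) : Plane → Plane :=
  if h : ∃ g, IsWeakGrad Ω u g then h.choose else 0

/-- `u ∈ H¹(Ω)`. -/
def InH1 (Ω : Set Plane) (u : Plane → ℝ) : Prop :=
  MemLp u 2 (volume.restrict Ω) ∧
    ∃ g, IsWeakGrad Ω u g ∧ MemLp g 2 (volume.restrict Ω)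

/-- `u ∈ H¹₀(Ω)`: `u` belongs to the closure of the test functions in `H¹(Ω)`. -/
def InH10 (Ω : Set Plane) (u : Plane → ℝ) : Prop :=
  MemLp u 2 (volume.restrict Ω) ∧
    ∃ g, IsWeakGrad Ω u g ∧ MemLp g 2 (volume.restrict Ω) ∧
      ∃ φ : ℕ → Plane → ℝ, (∀ n, IsTest Ω (φ n)) ∧
        Tendsto (fun n => eLpNorm (fun x => u x - φ n x) 2 (volume.restrict Ω)) atTop (𝓝 0) ∧
        Tendsto (fun n => eLpNorm (fun x => g x - (∇ (φ n)) x) 2 (volume.restrict Ω)) atTop (𝓝 0)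

/-! ### Conductivities, harmonic coordinates, divergence-free matrix fields, convex functions -/

/-- The space `𝓜` of uniformly elliptic, bounded, symmetric (measurable) matrix fields on `Ω`. -/
def conductivities (Ω : Set Plane) : Set (Plane → Matrix (Fin 2) (Fin 2) ℝ) :=
  {σ | (∀ a b, AEMeasurable (fun x => σ x a b) (volume.restrict Ω)) ∧
    (∀ᵐ x ∂volume.restrict Ω, (σ x).IsSymm) ∧
    ∃ m M : ℝ, 0 < m ∧ ∀ᵐ x ∂volume.restrict Ω, ∀ v : Plane,
      m * ‖v‖ ^ 2 ≤ form (σ x) v v ∧ form (σ x) v v ≤ M * ‖v‖ ^ 2}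

/-- `F` is a version of the harmonic coordinates of `σ`: each component is the weak solution in
`H¹(Ω)` of `div (σ ∇ Fᵢ) = 0` in `Ω`, `Fᵢ(x) = xᵢ` on `∂Ω`. -/
def IsHarmonicCoord (Ω : Set Plane) (σ : Plane → Matrix (Fin 2) (Fin 2) ℝ)
    (F : Plane → Plane) : Prop :=
  ∀ i : Fin 2, InH1 Ω (fun x => F x i) ∧ InH10 Ω (fun x => F x i - x i) ∧
    ∀ φ, IsTest Ω φ → ∫ x in Ω, form (σ x) ((∇ φ) x) (weakGrad Ω (fun y => F y i) x) = 0

open Classical in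
/-- The harmonic coordinates of `σ` (unique almost everywhere). -/
def harmonicCoord (Ω : Set Plane) (σ : Plane → Matrix (Fin 2) (Fin 2) ℝ) : Plane → Plane :=
  if h : ∃ F, IsHarmonicCoord Ω σ F then h.choose else id

/-- The matrix `∇F = (∂ₐ F_b)_{a b}`, whose columns are the weak gradients of the components. -/
def gradMatrix (Ω : Set Plane) (F : Plane → Plane) (x : Plane) : Matrix (Fin 2) (Fin 2) ℝ :=
  Matrix.of fun a b => weakGrad Ω (fun y => F y b) x a

/-- The space `𝓜_div` of the matrix fields
`Q = ((∇F)ᵀ σ ∇F / det ∇F) ∘ F⁻¹`, where `σ ∈ 𝓜` and `F` are the harmonic coordinates of `σ`, in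
their continuous version. As needed for the formula to make sense, `F` is a homeomorphism of the
compact set `closure Ω` onto itself and `det ∇F > 0` almost everywhere. -/
def divFreeFields (Ω : Set Plane) : Set (Plane → Matrix (Fin 2) (Fin 2) ℝ) :=
  {Q | ∃ σ ∈ conductivities Ω, ∃ F : Plane → Plane, IsHarmonicCoord Ω σ F ∧
    ContinuousOn F (closure Ω) ∧ BijOn F (closure Ω) (closure Ω) ∧
    (∀ᵐ x ∂volume.restrict Ω, 0 < (gradMatrix Ω F x).det) ∧
    ∀ᵐ y ∂volume.restrict Ω,
      let x := Function.invFunOn F (closure Ω) y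
      Q y = ((gradMatrix Ω F x).det)⁻¹ •
        ((gradMatrix Ω F x).transpose * σ x * gradMatrix Ω F x)}

/-- The functions whose classes modulo affine functions form the space `𝓢`: the convex functions
in `W^{2,1}(Ω)` (in their version that is continuous up to the boundary) whose Hessian has a
determinant uniformly bounded away from zero and infinity. -/
def convexFunctions (Ω : Set Plane) : Set (Plane → ℝ) :=
  {s | ContinuousOn s (closure Ω) ∧ ConvexOn ℝ (closure Ω) s ∧
    ∃ (g : Plane → Plane) (h : Fin 2 → Plane → Plane),
      IntegrableOn s Ω ∧ IntegrableOn g Ω ∧ (∀ a, IntegrableOn (h a) Ω) ∧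
      IsWeakGrad Ω s g ∧ (∀ a, IsWeakGrad Ω (fun x => g x a) (h a)) ∧
      ∃ m M : ℝ, 0 < m ∧ ∀ᵐ x ∂volume.restrict Ω,
        m ≤ h 0 x 0 * h 1 x 1 - h 0 x 1 * h 1 x 0 ∧
          h 0 x 0 * h 1 x 1 - h 0 x 1 * h 1 x 0 ≤ M}

/-! ### Triangulations -/

/-- A (conforming) triangulation of `Ω`: a finite simplicial complex with underlying space
`closure Ω`. Nodes are identified with their locations. -/
structure Triangulation (Ω : Set Plane) extends Geometry.SimplicialComplex ℝ Plane where
  finite_faces : faces.Finite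
  space_eq : toSimplicialComplex.space = closure Ω

namespace Triangulation

variable {Ω : Set Plane}

/-- `T.Refines S`: `T` is a sub-triangulation of `S`, that is, every simplex of `T` lies in a
simplex of `S`. -/
def Refines (T S : Triangulation Ω) : Prop :=
  ∀ t ∈ T.faces, ∃ s ∈ S.faces, convexHull ℝ (t : Set Plane) ⊆ convexHull ℝ (s : Set Plane)

lemma finite_vertices (T : Triangulation Ω) : T.vertices.Finite :=
  Finite.preimage (fun _ _ _ _ h => by simpa using h) T.finite_faces

/-- The set of all nodes (interior and boundary ones). -/
def nodes (T : Triangulation Ω) : Finset Plane := T.finite_vertices.toFinset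

open Classical in
/-- The nodes `k` such that `i, j, k` are the three vertices of a triangle. -/
def opposite (T : Triangulation Ω) (i j : Plane) : Finset Plane :=
  T.nodes.filter fun k => i ≠ k ∧ j ≠ k ∧ ({i, j, k} : Finset Plane) ∈ T.faces

/-- `(i, j)` is an interior edge: an edge shared by two triangles. -/
def IsInteriorEdge (T : Triangulation Ω) (i j : Plane) : Prop :=
  i ≠ j ∧ (T.opposite i j).card = 2

/-- The set `𝓔_h` of the interior edges `(i, j)`. -/
abbrev Edge (T : Triangulation Ω) : Type := {e : Plane × Plane // T.IsInteriorEdge e.1 e.2}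

/-- `w` are barycentric coordinates of the point `x` in the smallest face that contains `x`. -/
def IsBary (T : Triangulation Ω) (x : Plane) (w : Plane →₀ ℝ) : Prop :=
  w.support ∈ T.faces ∧ (∀ v, 0 ≤ w v) ∧ (w.sum fun _ c => c) = 1 ∧ (w.sum fun v c => c • v) = x

open Classical in
/-- The piecewise linear nodal basis function `φ_i`, as a function on `closure Ω` (extended
by zero): `φ_i(x)` is the barycentric coordinate of `x` with respect to the node `i`. -/
def hat (T : Triangulation Ω) (i : Plane) (x : Plane) : ℝ :=
  if h : ∃ w, T.IsBary x w then h.choose i else 0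

lemma exists_isBary (T : Triangulation Ω) {t : Finset Plane} (ht : t ∈ T.faces) {w : Plane → ℝ}
    (h0 : ∀ v ∈ t, 0 ≤ w v) (h1 : ∑ v ∈ t, w v = 1) :
    ∃ w' : Plane →₀ ℝ, T.IsBary (∑ v ∈ t, w v • v) w' ∧ w'.support ⊆ t ∧
      ∀ v ∈ t, w' v = w v := by
  classical
  let w' : Plane →₀ ℝ := Finsupp.onFinset t (fun v => if v ∈ t then w v else 0)
    (fun v hv => by by_contra h; simp [h] at hv)
  have hs : w'.support ⊆ t := Finsupp.support_onFinset_subset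
  have hw : ∀ v ∈ t, w' v = w v := fun v hv => by simp [w', hv]
  have hsum : (w'.sum fun _ c => c) = 1 := by
    rw [Finsupp.sum_of_support_subset _ hs _ (by simp), ← h1]
    exact Finset.sum_congr rfl hw
  refine ⟨w', ⟨T.down_closed ht hs ?_, ?_, hsum, ?_⟩, hs, hw⟩
  · rw [Finset.nonempty_iff_ne_empty]
    intro h
    rw [Finsupp.support_eq_empty] at h
    simp [h] at hsum
  · intro v
    by_cases hv : v ∈ t
    · rw [hw v hv]; exact h0 v hv
    · simp [w', hv]
  · rw [Finsupp.sum_of_support_subset _ hs _ (by simp)]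
    exact Finset.sum_congr rfl fun v hv => by rw [hw v hv]

lemma eq_of_face (T : Triangulation Ω) {t : Finset Plane} (ht : t ∈ T.faces) {w w' : Plane →₀ ℝ}
    (hs : w.support ⊆ t) (hs' : w'.support ⊆ t)
    (h1 : (w.sum fun _ c => c) = 1) (h1' : (w'.sum fun _ c => c) = 1)
    (h : (w.sum fun v c => c • v) = (w'.sum fun v c => c • v)) : w = w' := by
  classical
  have hind := T.indep ht
  rw [Finsupp.sum_of_support_subset _ hs _ (by simp)] at h1 h
  rw [Finsupp.sum_of_support_subset _ hs' _ (by simp)] at h1' h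
  rw [affineIndependent_iff] at hind
  have key := hind Finset.univ (fun v => w v - w' v)
    (by
      rw [Finset.sum_sub_distrib, Finset.univ_eq_attach,
        Finset.sum_attach t (fun v => w v), Finset.sum_attach t (fun v => w' v), h1, h1', sub_self])
    (by
      simp only [sub_smul]
      rw [Finset.sum_sub_distrib, Finset.univ_eq_attach,
        Finset.sum_attach t (fun v => w v • v), Finset.sum_attach t (fun v => w' v • v), h,
        sub_self])
  ext v
  by_cases hv : v ∈ t
  · exact sub_eq_zero.1 (key ⟨v, hv⟩ (Finset.mem_univ _))
  · rw [Finsupp.notMem_support_iff.1 fun hh => hv (hs hh),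
      Finsupp.notMem_support_iff.1 fun hh => hv (hs' hh)]

lemma IsBary.mem_convexHull {T : Triangulation Ω} {x : Plane} {w : Plane →₀ ℝ}
    (h : T.IsBary x w) : x ∈ convexHull ℝ (w.support : Set Plane) := by
  obtain ⟨-, h0, h1, rfl⟩ := h
  exact (convex_convexHull ℝ _).sum_mem (fun v _ => h0 v) h1
    (fun v hv => subset_convexHull ℝ _ hv)

lemma IsBary.unique {T : Triangulation Ω} {x : Plane} {w w' : Plane →₀ ℝ}
    (h : T.IsBary x w) (h' : T.IsBary x w') : w = w' := by
  classical
  have hx := T.inter_subset_convexHull h.1 h'.1 ⟨h.mem_convexHull, h'.mem_convexHull⟩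
  rw [← Finset.coe_inter, Finset.convexHull_eq] at hx
  obtain ⟨u, hu0, hu1, hux⟩ := hx
  rw [Finset.centerMass_eq_of_sum_1 _ _ hu1] at hux
  have hne : (w.support ∩ w'.support).Nonempty := by
    rw [Finset.nonempty_iff_ne_empty]; intro he; simp [he] at hu1
  obtain ⟨w'', hw'', hs, -⟩ := T.exists_isBary
    (T.down_closed h.1 Finset.inter_subset_left hne) hu0 hu1
  have hx'' : (w''.sum fun v c => c • v) = x := by simpa using hw''.2.2.2.trans hux
  have e1 : w = w'' := T.eq_of_face h.1 subset_rfl (hs.trans Finset.inter_subset_left)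
    h.2.2.1 hw''.2.2.1 (h.2.2.2.trans hx''.symm)
  have e2 : w' = w'' := T.eq_of_face h'.1 subset_rfl (hs.trans Finset.inter_subset_right)
    h'.2.2.1 hw''.2.2.1 (h'.2.2.2.trans hx''.symm)
  rw [e1, e2]

lemma IsBary.hat_eq {T : Triangulation Ω} {x : Plane} {w : Plane →₀ ℝ}
    (h : T.IsBary x w) (i : Plane) : T.hat i x = w i := by
  have hex : ∃ w, T.IsBary x w := ⟨w, h⟩
  rw [hat, dif_pos hex, h.unique hex.choose_spec]

lemma hat_sum (T : Triangulation Ω) {t : Finset Plane} (ht : t ∈ T.faces) {w : Plane → ℝ}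
    (h0 : ∀ v ∈ t, 0 ≤ w v) (h1 : ∑ v ∈ t, w v = 1) (i : Plane) [Decidable (i ∈ t)] :
    T.hat i (∑ v ∈ t, w v • v) = if i ∈ t then w i else 0 := by
  obtain ⟨w', hw', hs, hw⟩ := T.exists_isBary ht h0 h1
  rw [hw'.hat_eq i]
  split_ifs with hi
  · exact hw i hi
  · exact Finsupp.notMem_support_iff.1 fun hh => hi (hs hh)

lemma hat_node (T : Triangulation Ω) {t : Finset Plane} (ht : t ∈ T.faces) {v : Plane}
    (hv : v ∈ t) (i : Plane) [Decidable (i = v)] : T.hat i v = if i = v then 1 else 0 := by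
  classical
  have h := T.hat_sum (w := fun u => if u = v then 1 else 0) ht
    (fun u _ => by split_ifs <;> norm_num) (by simp [hv]) i
  have e : (∑ u ∈ t, (if u = v then (1 : ℝ) else 0) • u) = v := by simp [ite_smul, hv]
  rw [e] at h
  rw [h]
  by_cases hi : i = v
  · simp [hi, hv]
  · simp [hi]

lemma hat_eq_zero (T : Triangulation Ω) (i : Plane) {x : Plane} (hx : x ∉ closure Ω) :
    T.hat i x = 0 := by
  rw [hat, dif_neg]
  rintro ⟨w, hw⟩
  rw [← T.space_eq] at hx
  exact hx (Geometry.SimplicialComplex.convexHull_subset_space hw.1 hw.mem_convexHull)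

/-- The piecewise linear functions on the triangulation: functions on `closure Ω` (extended by
zero to the plane) that are affine on every simplex. -/
def piecewiseLinear (T : Triangulation Ω) : Submodule ℝ (Plane → ℝ) where
  carrier := {f | (∀ x, x ∉ closure Ω → f x = 0) ∧
    ∀ t ∈ T.faces, ∀ w : Plane → ℝ, (∀ v ∈ t, 0 ≤ w v) → ∑ v ∈ t, w v = 1 →
      f (∑ v ∈ t, w v • v) = ∑ v ∈ t, w v * f v}
  zero_mem' := by simp
  add_mem' := by
    rintro f g ⟨hf, hf'⟩ ⟨hg, hg'⟩
    refine ⟨fun x hx => by simp [hf x hx, hg x hx], fun t ht w h0 h1 => ?_⟩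
    simp only [Pi.add_apply, hf' t ht w h0 h1, hg' t ht w h0 h1, mul_add, Finset.sum_add_distrib]
  smul_mem' := by
    rintro c f ⟨hf, hf'⟩
    refine ⟨fun x hx => by simp [hf x hx], fun t ht w h0 h1 => ?_⟩
    simp only [Pi.smul_apply, smul_eq_mul, hf' t ht w h0 h1, Finset.mul_sum]
    exact Finset.sum_congr rfl fun v _ => by ring

lemma hat_mem (T : Triangulation Ω) (i : Plane) : T.hat i ∈ T.piecewiseLinear := by
  classical
  refine ⟨fun x hx => T.hat_eq_zero i hx, fun t ht w h0 h1 => ?_⟩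
  rw [T.hat_sum ht h0 h1]
  rw [Finset.sum_congr rfl fun v hv => by rw [T.hat_node ht hv i]]
  simp

/-- The linear interpolation operator `T_{s^h,s}`: `s ↦ ∑ᵢ s(xᵢ) φᵢ`, the sum over all nodes. -/
def interp (T : Triangulation Ω) : (Plane → ℝ) →ₗ[ℝ] T.piecewiseLinear where
  toFun s := ⟨∑ i ∈ T.nodes, s i • T.hat i,
    Submodule.sum_mem _ fun i _ => Submodule.smul_mem _ _ (T.hat_mem i)⟩
  map_add' s s' := by
    ext x
    simp [add_mul, Finset.sum_add_distrib]
  map_smul' c s := by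
    ext x
    simp [Finset.mul_sum, mul_assoc]

/-- The space `𝓢_h` of the linear interpolations of elements of `𝓢`. -/
def interpolants (T : Triangulation Ω) : Set T.piecewiseLinear := T.interp '' convexFunctions Ω

/-! ### Effective edge conductivities -/

/-- `T_{q^h,σ}`: the effective edge conductivities
`q_ij = - ∫_Ω ∇(φ_i ∘ F)ᵀ σ ∇(φ_j ∘ F)`, where `F` are the harmonic coordinates of `σ`. -/
def condOfSigma (T : Triangulation Ω) (σ : Plane → Matrix (Fin 2) (Fin 2) ℝ) : T.Edge → ℝ :=
  fun e => - ∫ x in Ω, form (σ x)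
    (weakGrad Ω (T.hat e.1.1 ∘ harmonicCoord Ω σ) x)
    (weakGrad Ω (T.hat e.1.2 ∘ harmonicCoord Ω σ) x)

/-- The space `𝓠_h` of effective edge conductivities, the image of `T_{q^h,σ}`. -/
def effectiveConductivities (T : Triangulation Ω) : Set (T.Edge → ℝ) :=
  T.condOfSigma '' conductivities Ω

/-- `T_{q^h,Q}`: volume averaging, `q_ij = - ∫_Ω ∇φ_iᵀ Q ∇φ_j`. -/
def condOfQ (T : Triangulation Ω) (Q : Plane → Matrix (Fin 2) (Fin 2) ℝ) : T.Edge → ℝ :=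
  fun e => - ∫ x in Ω, form (Q x) ((∇ (T.hat e.1.1)) x) ((∇ (T.hat e.1.2)) x)

/-- Area of the triangle with vertices `i, j, k`. -/
def area (i j k : Plane) : ℝ :=
  |(j 0 - i 0) * (k 1 - i 1) - (j 1 - i 1) * (k 0 - i 0)| / 2

/-- The operator `T_{q^h,s^h}`, given by the hinge formula: for an interior edge `(i, j)` with the
two adjacent triangles `ijk` and `ijl`, `q_ij` is the sum of the contributions
`-|e_ij|⁻² (cot θ_ijk s_i + cot θ_jik s_j) + s_k / (2 |t_ijk|)` of both triangles, where `θ_ijk` is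
the angle at `j`. -/
def hinge (T : Triangulation Ω) : T.piecewiseLinear →ₗ[ℝ] (T.Edge → ℝ) where
  toFun s e := ∑ k ∈ T.opposite e.1.1 e.1.2,
    (-(1 / dist e.1.1 e.1.2 ^ 2) *
        (Real.cot (EuclideanGeometry.angle e.1.1 e.1.2 k) * s.1 e.1.1 +
          Real.cot (EuclideanGeometry.angle e.1.2 e.1.1 k) * s.1 e.1.2) +
      1 / (2 * area e.1.1 e.1.2 k) * s.1 k)
  map_add' s s' := by
    ext e
    simp only [Submodule.coe_add, Pi.add_apply, ← Finset.sum_add_distrib]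
    exact Finset.sum_congr rfl fun k _ => by ring
  map_smul' c s := by
    ext e
    simp only [Submodule.coe_smul, Pi.smul_apply, smul_eq_mul, Finset.mul_sum, RingHom.id_apply]
    exact Finset.sum_congr rfl fun k _ => by ring

open Classical in
/-- The value of `q` on a pair of distinct nodes, zero if the pair is not an interior edge. -/
def offDiag (T : Triangulation Ω) (i j : Plane) : (T.Edge → ℝ) →ₗ[ℝ] ℝ :=
  if h : T.IsInteriorEdge i j then LinearMap.proj (⟨(i, j), h⟩ : T.Edge) else 0

open Classical in
/-- The entries `q_ij` of the matrix of edge conductivities; the diagonal ones are determined by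
`q_ii = - ∑_{j ∼ i} q_ij`. -/
def entry (T : Triangulation Ω) (i j : Plane) : (T.Edge → ℝ) →ₗ[ℝ] ℝ :=
  if i = j then - ∑ m ∈ T.nodes, T.offDiag i m else T.offDiag i j

end Triangulation

/-! ### Coarse graining -/

variable {Ω : Set Plane}

/-- The operator `T_{q^{h_C},q^{h_F}}` : `q_ij = ∑_{k, l} φ_ik φ_jl q_kl`, where `φ_ik = φ_i^C(x_k)`
are the coefficients of the coarse basis function `φ_i^C` in the fine basis `φ_k^F`. -/
def coarsenCond (F C : Triangulation Ω) : (F.Edge → ℝ) →ₗ[ℝ] (C.Edge → ℝ) :=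
  LinearMap.pi fun e => ∑ k ∈ F.nodes, ∑ l ∈ F.nodes,
    (C.hat e.1.1 k * C.hat e.1.2 l) • F.entry k l

/-- The operator `T_{s^{h_C},s^{h_F}}` : `s ↦ ∑ᵢ s(xᵢ) φᵢ^C`, the sum over all coarse nodes, from
piecewise linear functions on `F` to piecewise linear functions on `C`. -/
def coarsenInterp (F C : Triangulation Ω) : F.piecewiseLinear →ₗ[ℝ] C.piecewiseLinear where
  toFun s := ⟨∑ i ∈ C.nodes, s.1 i • C.hat i,
    Submodule.sum_mem _ fun i _ => Submodule.smul_mem _ _ (C.hat_mem i)⟩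
  map_add' s s' := by
    ext x
    simp [add_mul, Finset.sum_add_distrib]
  map_smul' c s := by
    ext x
    simp [Finset.mul_sum, mul_assoc]

end GeomHom

end

noncomputable section

namespace GeomHom

/-- The determinant of two plane vectors. -/
def wedge (X Y : Plane) : ℝ := X 0 * Y 1 - X 1 * Y 0

/-- The barycentric coordinate of `x` belonging to the vertex `a` of the triangle `a, b, c`. -/
def baryCoord (a b c x : Plane) : ℝ := wedge (b - x) (c - x) / wedge (b - a) (c - a)

lemma plane_ext {x y : Plane} (h0 : x 0 = y 0) (h1 : x 1 = y 1) : x = y := by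
  ext i; fin_cases i <;> assumption

lemma wedge_cycle (a b c : Plane) : wedge (c - b) (a - b) = wedge (b - a) (c - a) := by
  simp [wedge]; ring

lemma baryCoord_sum {a b c : Plane} (h : wedge (b - a) (c - a) ≠ 0) (x : Plane) :
    baryCoord a b c x + baryCoord b c a x + baryCoord c a b x = 1 := by
  rw [baryCoord, baryCoord, baryCoord, wedge_cycle a b c, wedge_cycle b c a, wedge_cycle a b c]
  field_simp
  simp [wedge]; ring

lemma baryCoord_comb {a b c : Plane} (h : wedge (b - a) (c - a) ≠ 0) (x : Plane) :
    baryCoord a b c x • a + baryCoord b c a x • b + baryCoord c a b x • c = x := by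
  rw [baryCoord, baryCoord, baryCoord, wedge_cycle a b c, wedge_cycle b c a, wedge_cycle a b c]
  apply plane_ext <;> simp <;> field_simp <;> simp [wedge] <;> ring

lemma baryCoord_eq {a b c : Plane} (h : wedge (b - a) (c - a) ≠ 0) {α β γ : ℝ}
    (hs : α + β + γ = 1) : baryCoord a b c (α • a + β • b + γ • c) = α := by
  rw [baryCoord, div_eq_iff h]
  obtain rfl : α = 1 - β - γ := by linarith
  simp [wedge]; ring

lemma continuous_wedge {X : Type*} [TopologicalSpace X] {f g : X → Plane} (hf : Continuous f)
    (hg : Continuous g) : Continuous fun x => wedge (f x) (g x) := by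
  unfold wedge; fun_prop

lemma continuous_baryCoord (a b c : Plane) : Continuous (baryCoord a b c) :=
  (continuous_wedge (by fun_prop) (by fun_prop)).div_const _

/-- The barycentric coordinates as affine maps. -/
def baryMap (a b c : Plane) : Plane →ᵃ[ℝ] ℝ where
  toFun := baryCoord a b c
  linear :=
    { toFun := fun v => (wedge v (b - c)) / wedge (b - a) (c - a)
      map_add' := fun u v => by simp [wedge]; ring
      map_smul' := fun r v => by simp [wedge]; ring }
  map_vadd' := fun p v => by simp [baryCoord, wedge]; ring

@[simp] lemma baryMap_apply (a b c x : Plane) : baryMap a b c x = baryCoord a b c x := rfl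

namespace Triangulation

variable {Ω : Set Plane} (T : Triangulation Ω)

lemma weights_unique {t : Finset Plane} (ht : t ∈ T.faces) {w w' : Plane → ℝ}
    (h1 : ∑ v ∈ t, w v = ∑ v ∈ t, w' v) (h : ∑ v ∈ t, w v • v = ∑ v ∈ t, w' v • v) :
    ∀ v ∈ t, w v = w' v := by
  classical
  have hind := T.indep ht
  rw [affineIndependent_iff] at hind
  have key := hind Finset.univ (fun v => w v - w' v)
    (by
      rw [Finset.sum_sub_distrib, Finset.univ_eq_attach,
        Finset.sum_attach t (fun v => w v), Finset.sum_attach t (fun v => w' v), h1, sub_self])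
    (by
      simp only [sub_smul]
      rw [Finset.sum_sub_distrib, Finset.univ_eq_attach,
        Finset.sum_attach t (fun v => w v • v), Finset.sum_attach t (fun v => w' v • v), h,
        sub_self])
  exact fun v hv => sub_eq_zero.1 (key ⟨v, hv⟩ (Finset.mem_univ _))

/-- `a, b, c` are the three vertices of a triangle of `T`. -/
def IsTriangle (a b c : Plane) : Prop :=
  a ≠ b ∧ a ≠ c ∧ b ≠ c ∧ ({a, b, c} : Finset Plane) ∈ T.faces

variable {T}

lemma IsTriangle.rotate {a b c : Plane} (h : T.IsTriangle a b c) : T.IsTriangle b c a := by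
  obtain ⟨h1, h2, h3, h4⟩ := h
  refine ⟨h3, h1.symm, h2.symm, ?_⟩
  convert h4 using 1
  ext; simp; tauto

lemma IsTriangle.sum {a b c : Plane} (h : T.IsTriangle a b c) {M : Type*} [AddCommMonoid M]
    (f : Plane → M) : ∑ v ∈ ({a, b, c} : Finset Plane), f v = f a + f b + f c := by
  obtain ⟨h1, h2, h3, -⟩ := h
  rw [Finset.sum_insert (by simp [h1, h2]), Finset.sum_pair h3, add_assoc]

lemma IsTriangle.exists_weight {a b c : Plane} (h : T.IsTriangle a b c) (α β γ : ℝ) :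
    ∃ w : Plane → ℝ, w a = α ∧ w b = β ∧ w c = γ := by
  classical
  obtain ⟨h1, h2, h3, -⟩ := h
  refine ⟨fun v => if v = a then α else if v = b then β else γ, by simp, by simp [h1.symm], ?_⟩
  simp [h2.symm, h3.symm]

lemma IsTriangle.wedge_ne {a b c : Plane} (h : T.IsTriangle a b c) :
    wedge (b - a) (c - a) ≠ 0 := by
  intro hD
  have key : ∀ α β : ℝ, α • (b - a) + β • (c - a) = 0 → α = 0 ∧ β = 0 := by
    intro α β he
    obtain ⟨w, wa, wb, wc⟩ := h.exists_weight (-(α + β)) α β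
    have := T.weights_unique h.2.2.2 (w := w) (w' := 0)
      (by rw [h.sum, h.sum, wa, wb, wc]; simp)
      (by
        rw [h.sum, h.sum, wa, wb, wc]
        simp only [Pi.zero_apply, zero_smul, add_zero]
        rw [← he]; module)
    exact ⟨by rw [← wb]; exact this b (by simp), by rw [← wc]; exact this c (by simp)⟩
  simp only [wedge] at hD
  have h1 := key ((c - a) 0) (-((b - a) 0)) (plane_ext (by simp; ring) (by simp at hD ⊢; linarith))
  have h2 := key ((c - a) 1) (-((b - a) 1)) (plane_ext (by simp at hD ⊢; linarith) (by simp; ring))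
  apply h.1
  apply plane_ext
  · have := h1.2; simp at this; linarith
  · have := h2.2; simp at this; linarith

lemma apply_triangle {f : Plane → ℝ} (hf : f ∈ T.piecewiseLinear) {a b c : Plane}
    (h : T.IsTriangle a b c) {α β γ : ℝ} (hα : 0 ≤ α) (hβ : 0 ≤ β) (hγ : 0 ≤ γ)
    (hs : α + β + γ = 1) :
    f (α • a + β • b + γ • c) = α * f a + β * f b + γ * f c := by
  obtain ⟨w, wa, wb, wc⟩ := h.exists_weight α β γ
  have := hf.2 _ h.2.2.2 w (by simp [wa, wb, wc, hα, hβ, hγ]) (by rw [h.sum, wa, wb, wc, hs])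
  rwa [h.sum, h.sum, wa, wb, wc] at this

lemma apply_edge {f : Plane → ℝ} (hf : f ∈ T.piecewiseLinear) {a b : Plane} (hab : a ≠ b)
    (h : ({a, b} : Finset Plane) ∈ T.faces) {α β : ℝ} (hα : 0 ≤ α) (hβ : 0 ≤ β)
    (hs : α + β = 1) : f (α • a + β • b) = α * f a + β * f b := by
  classical
  have := hf.2 _ h (fun v => if v = a then α else β)
    (by intro v _; by_cases hv : v = a <;> simp [hv, hα, hβ]) (by rw [Finset.sum_pair hab]; simp [hab.symm, hs])
  rw [Finset.sum_pair hab, Finset.sum_pair hab] at this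
  simpa [hab.symm] using this

lemma exists_isBary_of_mem {t : Finset Plane} (ht : t ∈ T.faces) {x : Plane}
    (hx : x ∈ convexHull ℝ (t : Set Plane)) : ∃ w, T.IsBary x w ∧ w.support ⊆ t := by
  rw [Finset.convexHull_eq] at hx
  obtain ⟨u, hu0, hu1, hux⟩ := hx
  rw [Finset.centerMass_eq_of_sum_1 _ _ hu1] at hux
  obtain ⟨w, hw, hs, -⟩ := T.exists_isBary ht hu0 hu1
  simp only [id] at hux
  rw [hux] at hw
  exact ⟨w, hw, hs⟩

lemma exists_isBary_of_closure {x : Plane} (hx : x ∈ closure Ω) : ∃ w, T.IsBary x w := by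
  rw [← T.space_eq, Geometry.SimplicialComplex.mem_space_iff] at hx
  obtain ⟨t, ht, hx⟩ := hx
  obtain ⟨w, hw, -⟩ := exists_isBary_of_mem ht hx
  exact ⟨w, hw⟩

lemma IsBary.mem_closure {x : Plane} {w : Plane →₀ ℝ} (h : T.IsBary x w) : x ∈ closure Ω := by
  rw [← T.space_eq]
  exact Geometry.SimplicialComplex.convexHull_subset_space h.1 h.mem_convexHull

lemma mem_nodes {i : Plane} : i ∈ T.nodes ↔ ({i} : Finset Plane) ∈ T.faces := by
  simp [nodes, Geometry.SimplicialComplex.mem_vertices]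

lemma mem_nodes_of_face {t : Finset Plane} (ht : t ∈ T.faces) {i : Plane} (hi : i ∈ t) :
    i ∈ T.nodes :=
  mem_nodes.2 (T.down_closed ht (by simpa using hi) (by simp))

lemma node_mem_closure {i : Plane} (hi : i ∈ T.nodes) : i ∈ closure Ω := by
  rw [← T.space_eq]
  exact Geometry.SimplicialComplex.convexHull_subset_space (mem_nodes.1 hi) (by simp)

lemma IsBary.support_subset {x : Plane} {w : Plane →₀ ℝ} (h : T.IsBary x w) :
    w.support ⊆ T.nodes := fun _ hi => mem_nodes_of_face h.1 hi

lemma isBary_hat {x : Plane} (hx : x ∈ closure Ω) :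
    ∃ w, T.IsBary x w ∧ ∀ i, T.hat i x = w i := by
  obtain ⟨w, hw⟩ := exists_isBary_of_closure (T := T) hx
  exact ⟨w, hw, hw.hat_eq⟩

lemma IsBary.support_subset_of_mem {x : Plane} {w : Plane →₀ ℝ} (h : T.IsBary x w)
    {t : Finset Plane} (ht : t ∈ T.faces) (hx : x ∈ convexHull ℝ (t : Set Plane)) :
    w.support ⊆ t := by
  obtain ⟨w', hw', hs⟩ := exists_isBary_of_mem ht hx
  rwa [h.unique hw']

lemma hat_nonneg (i x : Plane) : 0 ≤ T.hat i x := by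
  by_cases hx : x ∈ closure Ω
  · obtain ⟨w, hw, h⟩ := isBary_hat (T := T) hx
    rw [h]; exact hw.2.1 i
  · rw [T.hat_eq_zero i hx]

lemma sum_hat {x : Plane} (hx : x ∈ closure Ω) : ∑ i ∈ T.nodes, T.hat i x = 1 := by
  obtain ⟨w, hw, h⟩ := isBary_hat (T := T) hx
  rw [Finset.sum_congr rfl fun i _ => h i, ← hw.2.2.1,
    Finsupp.sum_of_support_subset _ hw.support_subset _ (by simp)]

lemma sum_hat_smul {x : Plane} (hx : x ∈ closure Ω) : ∑ i ∈ T.nodes, T.hat i x • i = x := by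
  obtain ⟨w, hw, h⟩ := isBary_hat (T := T) hx
  rw [Finset.sum_congr rfl fun i _ => by rw [h i]]
  conv_rhs => rw [← hw.2.2.2]
  rw [Finsupp.sum_of_support_subset _ hw.support_subset _ (by simp)]

lemma hat_le_one (i x : Plane) : T.hat i x ≤ 1 := by
  by_cases hx : x ∈ closure Ω
  · obtain ⟨w, hw, h⟩ := isBary_hat (T := T) hx
    rw [h, ← hw.2.2.1]
    by_cases hi : i ∈ w.support
    · exact Finset.single_le_sum (f := fun i => w i) (fun j _ => hw.2.1 j) hi
    · rw [Finsupp.notMem_support_iff.1 hi]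
      exact Finset.sum_nonneg fun j _ => hw.2.1 j
  · rw [T.hat_eq_zero i hx]; exact zero_le_one

lemma hat_apply_node {k : Plane} (hk : k ∈ T.nodes) (i : Plane) [Decidable (i = k)] :
    T.hat i k = if i = k then 1 else 0 :=
  T.hat_node (mem_nodes.1 hk) (by simp) i

lemma eq_sum_hat {f : Plane → ℝ} (hf : f ∈ T.piecewiseLinear) (x : Plane) :
    f x = ∑ k ∈ T.nodes, f k * T.hat k x := by
  by_cases hx : x ∈ closure Ω
  · obtain ⟨w, hw, h⟩ := isBary_hat (T := T) hx
    rw [Finset.sum_congr rfl fun i _ => by rw [h i]]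
    have := hf.2 _ hw.1 w (fun v _ => hw.2.1 v) hw.2.2.1
    have e : ∑ v ∈ w.support, w v • v = x := hw.2.2.2
    rw [e] at this
    rw [this, Finset.sum_subset hw.support_subset (fun v _ hv => by
      rw [Finsupp.notMem_support_iff.1 hv, zero_mul])]
    exact Finset.sum_congr rfl fun v _ => mul_comm _ _
  · rw [hf.1 x hx, Finset.sum_eq_zero fun k _ => by rw [T.hat_eq_zero k hx, mul_zero]]

lemma ext_nodes {f g : Plane → ℝ} (hf : f ∈ T.piecewiseLinear) (hg : g ∈ T.piecewiseLinear)
    (h : ∀ k ∈ T.nodes, f k = g k) : f = g := by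
  ext x
  rw [eq_sum_hat hf, eq_sum_hat hg]
  exact Finset.sum_congr rfl fun k hk => by rw [h k hk]

lemma sum_mul_hat_node (s : Plane → ℝ) {k : Plane} (hk : k ∈ T.nodes) :
    ∑ i ∈ T.nodes, s i * T.hat i k = s k := by
  classical
  rw [Finset.sum_congr rfl fun i _ => by rw [hat_apply_node hk i]]
  simp [hk]

lemma interp_apply_node (s : Plane → ℝ) {k : Plane} (hk : k ∈ T.nodes) :
    (T.interp s).1 k = s k := by
  have : (T.interp s).1 k = ∑ i ∈ T.nodes, s i * T.hat i k := by simp [interp]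
  rw [this, sum_mul_hat_node s hk]

/-! ### Refinement -/

variable {F C : Triangulation Ω}

lemma coarsenInterp_eq (s : F.piecewiseLinear) :
    coarsenInterp F C s = C.interp (s : Plane → ℝ) := rfl

/-- Functions that are piecewise linear on the coarse triangulation are so on the fine one. -/
lemma Refines.mem_piecewiseLinear (h : F.Refines C) {f : Plane → ℝ}
    (hf : f ∈ C.piecewiseLinear) : f ∈ F.piecewiseLinear := by
  classical
  refine ⟨hf.1, fun t ht w h0 h1 => ?_⟩
  obtain ⟨s, hs, hts⟩ := h t ht
  have hv : ∀ v ∈ t, ∃ u : Plane →₀ ℝ, C.IsBary v u ∧ u.support ⊆ s := fun v hv =>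
    exists_isBary_of_mem hs (hts (subset_convexHull ℝ _ hv))
  choose! u hu hus using hv
  have e : ∀ v ∈ t, f v = ∑ k ∈ s, u v k * f k := fun v hv => by
    have := hf.2 s hs (u v) (fun k _ => (hu v hv).2.1 k)
      (by rw [← (hu v hv).2.2.1, Finsupp.sum_of_support_subset _ (hus v hv) _ (by simp)])
    rwa [show ∑ k ∈ s, u v k • k = v by
      conv_rhs => rw [← (hu v hv).2.2.2]
      rw [Finsupp.sum_of_support_subset _ (hus v hv) _ (by simp)]] at this
  have ev : ∀ v ∈ t, v = ∑ k ∈ s, u v k • k := fun v hv => by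
    conv_lhs => rw [← (hu v hv).2.2.2]
    rw [Finsupp.sum_of_support_subset _ (hus v hv) _ (by simp)]
  have e1 : ∀ v ∈ t, ∑ k ∈ s, u v k = 1 := fun v hv => by
    rw [← (hu v hv).2.2.1, Finsupp.sum_of_support_subset _ (hus v hv) _ (by simp)]
  have hx : ∑ v ∈ t, w v • v = ∑ k ∈ s, (∑ v ∈ t, w v * u v k) • k := by
    calc ∑ v ∈ t, w v • v = ∑ v ∈ t, w v • ∑ k ∈ s, u v k • k :=
          Finset.sum_congr rfl fun v hv => by rw [← ev v hv]
      _ = _ := by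
          simp only [Finset.smul_sum, Finset.sum_smul, smul_smul]
          rw [Finset.sum_comm]
  rw [hx, hf.2 s hs _ (fun k _ => Finset.sum_nonneg fun v hv =>
    mul_nonneg (h0 v hv) ((hu v hv).2.1 k))]
  · calc _ = ∑ v ∈ t, w v * ∑ k ∈ s, u v k * f k := by
          simp only [Finset.sum_mul, Finset.mul_sum, mul_assoc]
          rw [Finset.sum_comm]
      _ = _ := Finset.sum_congr rfl fun v hv => by rw [← e v hv]
  · rw [Finset.sum_comm, ← h1]
    exact Finset.sum_congr rfl fun v hv => by rw [← Finset.mul_sum, e1 v hv, mul_one]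

lemma hat_eq_one_iff {i x : Plane} (hx : T.hat i x = 1) : x = i := by
  have hxc : x ∈ closure Ω := by
    by_contra h
    rw [T.hat_eq_zero i h] at hx; norm_num at hx
  obtain ⟨w, hw, h⟩ := isBary_hat (T := T) hxc
  rw [h] at hx
  have h1 : ∑ k ∈ w.support, w k = 1 := hw.2.2.1
  have hi : i ∈ w.support := by simp [hx]
  rw [← Finset.add_sum_erase _ _ hi, hx] at h1
  have h2 : ∑ k ∈ w.support.erase i, w k = 0 := by linarith
  rw [Finset.sum_eq_zero_iff_of_nonneg (fun k _ => hw.2.1 k)] at h2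
  have h3 : ∑ k ∈ w.support, w k • k = x := hw.2.2.2
  rw [← Finset.add_sum_erase _ _ hi, hx,
    Finset.sum_eq_zero fun k hk => by rw [h2 k hk, zero_smul]] at h3
  simpa using h3.symm

lemma Refines.nodes_subset (h : F.Refines C) : C.nodes ⊆ F.nodes := by
  classical
  intro i hi
  obtain ⟨w, hw⟩ := exists_isBary_of_closure (T := F) (node_mem_closure hi)
  have hm := h.mem_piecewiseLinear (C.hat_mem i)
  have e := hm.2 _ hw.1 w (fun v _ => hw.2.1 v) hw.2.2.1
  have e' : ∑ v ∈ w.support, w v • v = i := hw.2.2.2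
  rw [e', hat_apply_node hi] at e
  simp only [if_true] at e
  have h1 : ∑ v ∈ w.support, w v * (1 - C.hat i v) = 0 := by
    simp only [mul_sub, mul_one, Finset.sum_sub_distrib, ← e]
    rw [show ∑ v ∈ w.support, w v = 1 from hw.2.2.1, sub_self]
  rw [Finset.sum_eq_zero_iff_of_nonneg (fun v _ =>
    mul_nonneg (hw.2.1 v) (by linarith [C.hat_le_one i v]))] at h1
  obtain ⟨v, hv⟩ : w.support.Nonempty := F.nonempty_of_mem_faces hw.1
  have h2 := h1 v hv
  have h3 : C.hat i v = 1 := by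
    rcases mul_eq_zero.1 h2 with h | h
    · exact absurd h (by simpa using hv)
    · linarith
  rw [← hat_eq_one_iff h3]
  exact hw.support_subset hv

lemma Refines.hat_eq (h : F.Refines C) (i : Plane) :
    C.hat i = ∑ k ∈ F.nodes, C.hat i k • F.hat k := by
  ext x
  rw [eq_sum_hat (h.mem_piecewiseLinear (C.hat_mem i)) x]
  simp

lemma Refines.interp_comp (h : F.Refines C) (s : Plane → ℝ) :
    coarsenInterp F C (F.interp s) = C.interp s := by
  rw [coarsenInterp_eq]
  refine Subtype.ext <| ext_nodes (C.interp _).2 (C.interp _).2 fun k hk => ?_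
  rw [interp_apply_node _ hk, interp_apply_node _ hk, interp_apply_node _ (h.nodes_subset hk)]

end Triangulation

end GeomHom

end

noncomputable section

namespace GeomHom

/-- The closed triangle with vertices `a, b, c`. -/
def closedTri (a b c : Plane) : Set Plane :=
  {x | 0 ≤ baryCoord a b c x ∧ 0 ≤ baryCoord b c a x ∧ 0 ≤ baryCoord c a b x}

/-- The open triangle with vertices `a, b, c`. -/
def openTri (a b c : Plane) : Set Plane :=
  {x | 0 < baryCoord a b c x ∧ 0 < baryCoord b c a x ∧ 0 < baryCoord c a b x}

lemma isClosed_closedTri (a b c : Plane) : IsClosed (closedTri a b c) :=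
  (isClosed_le continuous_const (continuous_baryCoord a b c)).inter <|
    (isClosed_le continuous_const (continuous_baryCoord b c a)).inter <|
      isClosed_le continuous_const (continuous_baryCoord c a b)

lemma isOpen_openTri (a b c : Plane) : IsOpen (openTri a b c) :=
  (isOpen_lt continuous_const (continuous_baryCoord a b c)).inter <|
    (isOpen_lt continuous_const (continuous_baryCoord b c a)).inter <|
      isOpen_lt continuous_const (continuous_baryCoord c a b)

lemma openTri_subset_closedTri (a b c : Plane) : openTri a b c ⊆ closedTri a b c :=
  fun _ h => ⟨h.1.le, h.2.1.le, h.2.2.le⟩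

lemma convex_closedTri (a b c : Plane) : Convex ℝ (closedTri a b c) := by
  refine Convex.inter ?_ (Convex.inter ?_ ?_)
  · exact (convex_Ici (0 : ℝ)).affine_preimage (baryMap a b c)
  · exact (convex_Ici (0 : ℝ)).affine_preimage (baryMap b c a)
  · exact (convex_Ici (0 : ℝ)).affine_preimage (baryMap c a b)

lemma convex_openTri (a b c : Plane) : Convex ℝ (openTri a b c) := by
  refine Convex.inter ?_ (Convex.inter ?_ ?_)
  · exact (convex_Ioi (0 : ℝ)).affine_preimage (baryMap a b c)
  · exact (convex_Ioi (0 : ℝ)).affine_preimage (baryMap b c a)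
  · exact (convex_Ioi (0 : ℝ)).affine_preimage (baryMap c a b)

/-- The affine function with given values at the vertices of a triangle. -/
def triAffine (a b c : Plane) (f : Plane → ℝ) : Plane →ᵃ[ℝ] ℝ :=
  f a • baryMap a b c + f b • baryMap b c a + f c • baryMap c a b

lemma triAffine_apply (a b c : Plane) (f : Plane → ℝ) (x : Plane) : triAffine a b c f x =
    f a * baryCoord a b c x + f b * baryCoord b c a x + f c * baryCoord c a b x := by
  simp [triAffine]

lemma affine_add_smul (A : Plane →ᵃ[ℝ] ℝ) (x v : Plane) (ε : ℝ) :
    A (x + ε • v) = A x + ε * A.linear v := by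
  have := A.map_vadd x (ε • v)
  simp only [vadd_eq_add] at this
  rw [add_comm, this, map_smul, smul_eq_mul, add_comm]

lemma affine_sub (A : Plane →ᵃ[ℝ] ℝ) (x y : Plane) : A x - A y = A.linear (x - y) := by
  have := A.linearMap_vsub x y
  simpa using this.symm

namespace Triangulation

variable {Ω : Set Plane} {T : Triangulation Ω}

lemma IsTriangle.baryCoord_sum {a b c : Plane} (h : T.IsTriangle a b c) (x : Plane) :
    baryCoord a b c x + baryCoord b c a x + baryCoord c a b x = 1 :=
  GeomHom.baryCoord_sum h.wedge_ne x

lemma IsTriangle.baryCoord_comb {a b c : Plane} (h : T.IsTriangle a b c) (x : Plane) :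
    baryCoord a b c x • a + baryCoord b c a x • b + baryCoord c a b x • c = x :=
  GeomHom.baryCoord_comb h.wedge_ne x

lemma IsTriangle.baryCoord_left {a b c : Plane} (h : T.IsTriangle a b c) :
    baryCoord a b c a = 1 := div_self h.wedge_ne

lemma baryCoord_mid (a b c : Plane) : baryCoord a b c b = 0 := by simp [baryCoord, wedge]

lemma baryCoord_right (a b c : Plane) : baryCoord a b c c = 0 := by simp [baryCoord, wedge]

lemma IsTriangle.triAffine_left {a b c : Plane} (h : T.IsTriangle a b c) (f : Plane → ℝ) :
    triAffine a b c f a = f a := by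
  rw [triAffine_apply, h.baryCoord_left, baryCoord_right, baryCoord_mid]; ring

lemma IsTriangle.triAffine_mid {a b c : Plane} (h : T.IsTriangle a b c) (f : Plane → ℝ) :
    triAffine a b c f b = f b := by
  rw [triAffine_apply, h.rotate.baryCoord_left, baryCoord_right, baryCoord_mid]; ring

lemma IsTriangle.triAffine_right {a b c : Plane} (h : T.IsTriangle a b c) (f : Plane → ℝ) :
    triAffine a b c f c = f c := by
  rw [triAffine_apply, h.rotate.rotate.baryCoord_left, baryCoord_right, baryCoord_mid]; ring

lemma IsTriangle.closedTri_eq {a b c : Plane} (h : T.IsTriangle a b c) :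
    closedTri a b c = convexHull ℝ (({a, b, c} : Finset Plane) : Set Plane) := by
  ext x
  rw [Finset.convexHull_eq]
  constructor
  · intro hx
    obtain ⟨w, wa, wb, wc⟩ := h.exists_weight (baryCoord a b c x) (baryCoord b c a x)
      (baryCoord c a b x)
    have h1 : ∑ v ∈ ({a, b, c} : Finset Plane), w v = 1 := by
      rw [h.sum, wa, wb, wc, h.baryCoord_sum]
    refine ⟨w, by simp [wa, wb, wc, hx.1, hx.2.1, hx.2.2], h1, ?_⟩
    rw [Finset.centerMass_eq_of_sum_1 _ _ h1, h.sum]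
    simp [wa, wb, wc, h.baryCoord_comb]
  · rintro ⟨w, h0, h1, hx⟩
    rw [Finset.centerMass_eq_of_sum_1 _ _ h1, h.sum] at hx
    rw [h.sum] at h1
    simp only [id] at hx
    simp only [Finset.mem_insert, Finset.mem_singleton, forall_eq_or_imp, forall_eq] at h0
    subst hx
    refine ⟨?_, ?_, ?_⟩
    · rw [baryCoord_eq h.wedge_ne h1]; exact h0.1
    · rw [show w a • a + w b • b + w c • c = w b • b + w c • c + w a • a by abel,
        baryCoord_eq h.rotate.wedge_ne (by linarith)]; exact h0.2.1
    · rw [show w a • a + w b • b + w c • c = w c • c + w a • a + w b • b by abel,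
        baryCoord_eq h.rotate.rotate.wedge_ne (by linarith)]; exact h0.2.2

lemma IsTriangle.apply {a b c : Plane} (h : T.IsTriangle a b c) {f : Plane → ℝ}
    (hf : f ∈ T.piecewiseLinear) {x : Plane} (hx : x ∈ closedTri a b c) :
    f x = triAffine a b c f x := by
  have := apply_triangle hf h hx.1 hx.2.1 hx.2.2 (h.baryCoord_sum x)
  rw [h.baryCoord_comb] at this
  rw [this, triAffine_apply]; ring

lemma IsTriangle.closedTri_subset {a b c : Plane} (h : T.IsTriangle a b c) :
    closedTri a b c ⊆ closure Ω := by
  rw [h.closedTri_eq, ← T.space_eq]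
  exact Geometry.SimplicialComplex.convexHull_subset_space h.2.2.2

/-- A point of an open triangle has barycentric coordinates supported on that triangle. -/
lemma IsTriangle.isBary {a b c : Plane} (h : T.IsTriangle a b c) {x : Plane}
    (hx : x ∈ openTri a b c) : ∃ w, T.IsBary x w ∧ w.support = {a, b, c} := by
  obtain ⟨w, wa, wb, wc⟩ := h.exists_weight (baryCoord a b c x) (baryCoord b c a x)
    (baryCoord c a b x)
  obtain ⟨w', hw', hs, hw⟩ := T.exists_isBary h.2.2.2 (w := w)
    (by simp [wa, wb, wc, hx.1.le, hx.2.1.le, hx.2.2.le])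
    (by rw [h.sum, wa, wb, wc, h.baryCoord_sum])
  rw [h.sum, wa, wb, wc, h.baryCoord_comb] at hw'
  refine ⟨w', hw', hs.antisymm fun v hv => ?_⟩
  rw [Finsupp.mem_support_iff, hw v hv]
  simp only [Finset.mem_insert, Finset.mem_singleton] at hv
  rcases hv with rfl | rfl | rfl
  · rw [wa]; exact hx.1.ne'
  · rw [wb]; exact hx.2.1.ne'
  · rw [wc]; exact hx.2.2.ne'

lemma IsTriangle.mem_openTri {a b c : Plane} (h : T.IsTriangle a b c) {x : Plane} {w : Plane →₀ ℝ}
    (hw : T.IsBary x w) (hs : w.support = {a, b, c}) : x ∈ openTri a b c := by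
  have h1 := hw.2.2.1
  have h2 := hw.2.2.2
  rw [Finsupp.sum, hs, h.sum] at h1 h2
  have hp : ∀ v ∈ ({a, b, c} : Finset Plane), 0 < w v := fun v hv =>
    lt_of_le_of_ne (hw.2.1 v) (Ne.symm (by rw [← hs] at hv; exact Finsupp.mem_support_iff.1 hv))
  subst h2
  refine ⟨?_, ?_, ?_⟩
  · rw [baryCoord_eq h.wedge_ne h1]; exact hp a (by simp)
  · rw [show w a • a + w b • b + w c • c = w b • b + w c • c + w a • a by abel,
      baryCoord_eq h.rotate.wedge_ne (by linarith)]; exact hp b (by simp)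
  · rw [show w a • a + w b • b + w c • c = w c • c + w a • a + w b • b by abel,
      baryCoord_eq h.rotate.rotate.wedge_ne (by linarith)]; exact hp c (by simp)

lemma face_cases {t : Finset Plane} (ht : t ∈ T.faces) : (∃ a, t = {a}) ∨
    (∃ a b, a ≠ b ∧ t = {a, b}) ∨ ∃ a b c, T.IsTriangle a b c ∧ t = {a, b, c} := by
  have h := (T.indep ht).card_le_finrank_succ
  have h2 : Module.finrank ℝ (vectorSpan ℝ (Set.range ((↑) : t → Plane))) ≤ 2 :=
    (Submodule.finrank_le _).trans (by simp)
  have h3 : t.card ≤ 3 := by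
    simp only [Fintype.card_coe] at h; omega
  have h4 : 0 < t.card := Finset.card_pos.2 (T.nonempty_of_mem_faces ht)
  have : t.card = 1 ∨ t.card = 2 ∨ t.card = 3 := by omega
  rcases this with h | h | h
  · exact Or.inl (Finset.card_eq_one.1 h)
  · exact Or.inr (Or.inl (Finset.card_eq_two.1 h))
  · obtain ⟨a, b, c, e1, e2, e3, rfl⟩ := Finset.card_eq_three.1 h
    exact Or.inr (Or.inr ⟨a, b, c, ⟨e1, e2, e3, ht⟩, rfl⟩)

lemma volume_segment_zero (a b : Plane) : volume (convexHull ℝ ({a, b} : Set Plane)) = 0 := by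
  have h : affineSpan ℝ ({a, b} : Set Plane) ≠ ⊤ := by
    intro h
    have h1 : vectorSpan ℝ ({a, b} : Set Plane) = ⊤ := by
      rw [← direction_affineSpan, h, AffineSubspace.direction_top]
    have h2 := (collinear_iff_finrank_le_one (k := ℝ)).1 (collinear_pair ℝ a b)
    rw [h1, finrank_top] at h2
    simp at h2
  exact measure_mono_null (convexHull_subset_affineSpan _)
    (Measure.addHaar_affineSubspace volume _ h)

lemma finite_triangles (T : Triangulation Ω) :
    {p : Plane × Plane × Plane | T.IsTriangle p.1 p.2.1 p.2.2}.Finite := by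
  refine ((T.nodes.finite_toSet.prod (T.nodes.finite_toSet.prod T.nodes.finite_toSet))).subset ?_
  rintro ⟨a, b, c⟩ h
  refine ⟨mem_nodes_of_face h.2.2.2 (by simp), mem_nodes_of_face h.2.2.2 (by simp),
    mem_nodes_of_face h.2.2.2 (by simp)⟩

/-- The union of the closed triangles. -/
lemma isClosed_iUnion_triangles (T : Triangulation Ω) :
    IsClosed (⋃ p ∈ {p : Plane × Plane × Plane | T.IsTriangle p.1 p.2.1 p.2.2},
      closedTri p.1 p.2.1 p.2.2) :=
  T.finite_triangles.isClosed_biUnion fun _ _ => isClosed_closedTri _ _ _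

lemma volume_thin_faces (T : Triangulation Ω) :
    volume (⋃ p ∈ (T.nodes : Set Plane) ×ˢ (T.nodes : Set Plane),
      convexHull ℝ ({p.1, p.2} : Set Plane)) = 0 := by
  rw [measure_biUnion_null_iff
    ((T.nodes.finite_toSet.prod T.nodes.finite_toSet).countable)]
  exact fun p _ => volume_segment_zero _ _

lemma openTri_or_thin {x : Plane} (hx : x ∈ closure Ω) :
    (∃ a b c, T.IsTriangle a b c ∧ x ∈ openTri a b c) ∨
      x ∈ ⋃ p ∈ (T.nodes : Set Plane) ×ˢ (T.nodes : Set Plane),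
        convexHull ℝ ({p.1, p.2} : Set Plane) := by
  obtain ⟨w, hw⟩ := exists_isBary_of_closure (T := T) hx
  have hm := hw.mem_convexHull
  rcases face_cases hw.1 with ⟨a, ha⟩ | ⟨a, b, -, hab⟩ | ⟨a, b, c, h, habc⟩
  · right
    simp only [mem_iUnion]
    refine ⟨(a, a), ⟨mem_nodes_of_face hw.1 (by simp [ha]), mem_nodes_of_face hw.1 (by simp [ha])⟩, ?_⟩
    rw [ha] at hm; simpa using hm
  · right
    simp only [mem_iUnion]
    refine ⟨(a, b), ⟨mem_nodes_of_face hw.1 (by simp [hab]),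
      mem_nodes_of_face hw.1 (by simp [hab])⟩, ?_⟩
    rw [hab] at hm; simpa using hm
  · exact Or.inl ⟨a, b, c, h, h.mem_openTri hw habc⟩

lemma ae_openTri (T : Triangulation Ω) : ∀ᵐ x ∂volume.restrict Ω,
    ∃ a b c, T.IsTriangle a b c ∧ x ∈ openTri a b c := by
  have h : ∀ᵐ x : Plane, x ∉ ⋃ p ∈ (T.nodes : Set Plane) ×ˢ (T.nodes : Set Plane),
      convexHull ℝ ({p.1, p.2} : Set Plane) := by
    rw [← measure_eq_zero_iff_ae_notMem]; exact T.volume_thin_faces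
  have h2 : ∀ᵐ x : Plane, x ∈ Ω → ∃ a b c, T.IsTriangle a b c ∧ x ∈ openTri a b c := by
    filter_upwards [h] with x hx hxΩ
    exact (openTri_or_thin (subset_closure hxΩ)).resolve_right hx
  by_cases hm : NullMeasurableSet Ω
  · exact (ae_restrict_iff'₀ hm).2 h2
  · rw [ae_iff]
    refine le_antisymm ?_ zero_le
    refine (measure_mono (t := (⋃ p ∈ (T.nodes : Set Plane) ×ˢ (T.nodes : Set Plane),
      convexHull ℝ ({p.1, p.2} : Set Plane)) ∪ (closure Ω)ᶜ) ?_).trans ?_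
    · intro x hx
      by_cases hc : x ∈ closure Ω
      · exact Or.inl ((openTri_or_thin hc).resolve_left hx)
      · exact Or.inr hc
    · refine (measure_union_le _ _).trans ?_
      rw [Measure.restrict_apply (isClosed_closure.measurableSet.compl),
        show (closure Ω)ᶜ ∩ Ω = ∅ by
          ext x; simp only [mem_inter_iff, mem_compl_iff, mem_empty_iff_false, iff_false]
          exact fun hh => hh.1 (subset_closure hh.2)]
      simp only [measure_empty, add_zero]
      exact (Measure.restrict_apply_le _ _).trans T.volume_thin_faces.le

lemma closure_subset_iUnion (hΩ : IsOpen Ω) (T : Triangulation Ω) :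
    closure Ω ⊆ ⋃ p ∈ {p : Plane × Plane × Plane | T.IsTriangle p.1 p.2.1 p.2.2},
      closedTri p.1 p.2.1 p.2.2 := by
  refine closure_minimal ?_ T.isClosed_iUnion_triangles
  rw [← sdiff_eq_empty]
  have ho : IsOpen (Ω \ ⋃ p ∈ {p : Plane × Plane × Plane | T.IsTriangle p.1 p.2.1 p.2.2},
      closedTri p.1 p.2.1 p.2.2) := hΩ.sdiff T.isClosed_iUnion_triangles
  rw [← ho.measure_eq_zero_iff (μ := volume)]
  refine measure_mono_null ?_ T.volume_thin_faces
  rintro x ⟨hx, hn⟩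
  refine (openTri_or_thin (subset_closure hx)).resolve_left ?_
  rintro ⟨a, b, c, h, hx⟩
  refine hn ?_
  simp only [mem_iUnion]
  exact ⟨(a, b, c), h, openTri_subset_closedTri _ _ _ hx⟩

lemma exists_triangle (hΩ : IsOpen Ω) (T : Triangulation Ω) {x : Plane} (hx : x ∈ closure Ω) :
    ∃ a b c, T.IsTriangle a b c ∧ x ∈ closedTri a b c := by
  have := T.closure_subset_iUnion hΩ hx
  simp only [mem_iUnion] at this
  obtain ⟨p, hp, hx⟩ := this
  exact ⟨_, _, _, hp, hx⟩

/-- A segment starting at a point of the domain begins inside one triangle. -/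
lemma exists_triangle_germ (hΩ : IsOpen Ω) (hΩc : Convex ℝ Ω) (T : Triangulation Ω) {x v : Plane}
    (hx : x ∈ closure Ω) {ε : ℝ} (hε : 0 < ε) (hv : x + ε • v ∈ closure Ω) :
    ∃ a b c, T.IsTriangle a b c ∧ ∃ δ, 0 < δ ∧ δ ≤ ε ∧
      ∀ η ∈ Icc 0 δ, x + η • v ∈ closedTri a b c := by
  have hmem : ∀ η ∈ Icc 0 ε, x + η • v ∈ closure Ω := fun η hη => by
    have h1 := hΩc.closure.add_smul_sub_mem hx hv (t := η / ε)
      ⟨div_nonneg hη.1 hε.le, (div_le_one hε).2 hη.2⟩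
    rwa [add_sub_cancel_left, smul_smul, div_mul_cancel₀ _ hε.ne'] at h1
  have h1 : ∃ᶠ η in 𝓝[>] (0 : ℝ), ∃ p ∈ {p : Plane × Plane × Plane | T.IsTriangle p.1 p.2.1 p.2.2},
      x + η • v ∈ closedTri p.1 p.2.1 p.2.2 := by
    refine Eventually.frequently ?_
    filter_upwards [Ioc_mem_nhdsGT hε] with η hη
    obtain ⟨a, b, c, h, h'⟩ := T.exists_triangle hΩ (hmem η ⟨hη.1.le, hη.2⟩)
    exact ⟨(a, b, c), h, h'⟩
  rw [frequently_exists_finite T.finite_triangles] at h1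
  obtain ⟨⟨a, b, c⟩, h, hf⟩ := h1
  have hc : Continuous fun η : ℝ => x + η • v := by fun_prop
  have hx0 : x ∈ closedTri a b c := by
    have h2 : (0 : ℝ) ∈ closure {η | x + η • v ∈ closedTri a b c} :=
      mem_closure_iff_frequently.2 (hf.filter_mono nhdsWithin_le_nhds)
    have h3 := ((isClosed_closedTri a b c).preimage hc).closure_subset h2
    simpa using h3
  obtain ⟨δ, hδ, hδ'⟩ := (hf.and_eventually (Ioc_mem_nhdsGT hε)).exists
  refine ⟨a, b, c, h, δ, hδ'.1, hδ'.2, fun η hη => ?_⟩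
  have h1 := (convex_closedTri a b c).add_smul_sub_mem hx0 hδ (t := η / δ)
      ⟨div_nonneg hη.1 hδ'.1.le, (div_le_one hδ'.1).2 hη.2⟩
  rwa [add_sub_cancel_left, smul_smul, div_mul_cancel₀ _ hδ'.1.ne'] at h1

lemma continuousOn_of_mem (hΩ : IsOpen Ω) {f : Plane → ℝ} (hf : f ∈ T.piecewiseLinear) :
    ContinuousOn f (closure Ω) := by
  have := T.finite_triangles.to_subtype
  have h := (locallyFinite_of_finite (fun p : {p : Plane × Plane × Plane |
    T.IsTriangle p.1 p.2.1 p.2.2} => closedTri p.1.1 p.1.2.1 p.1.2.2)).continuousOn_iUnion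
    (g := f) (fun p => isClosed_closedTri _ _ _) (fun p => by
      refine ContinuousOn.congr ?_ fun x hx => p.2.apply hf hx
      exact (AffineMap.continuous_of_finiteDimensional _).continuousOn)
  refine h.mono ((T.closure_subset_iUnion hΩ).trans ?_)
  rw [biUnion_eq_iUnion]

lemma lipschitzOn_of_mem (hΩ : IsOpen Ω) (hΩc : Convex ℝ Ω) {f : Plane → ℝ}
    (hf : f ∈ T.piecewiseLinear) : ∃ L : NNReal, LipschitzOnWith L f (closure Ω) := by
  have hL : ∃ L : ℝ, ∀ p ∈ {p : Plane × Plane × Plane | T.IsTriangle p.1 p.2.1 p.2.2},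
      ‖(triAffine p.1 p.2.1 p.2.2 f).linear.toContinuousLinearMap‖ ≤ L := by
    obtain ⟨L, hL⟩ := (T.finite_triangles.image
      fun p => ‖(triAffine p.1 p.2.1 p.2.2 f).linear.toContinuousLinearMap‖).bddAbove
    exact ⟨L, fun p hp => hL (mem_image_of_mem _ hp)⟩
  obtain ⟨L, hL⟩ := hL
  refine ⟨L.toNNReal, LipschitzOnWith.of_dist_le_mul fun y hy x hx => ?_⟩
  have hcont := continuousOn_of_mem hΩ hf
  have hseg : ∀ t ∈ Icc (0 : ℝ) 1, x + t • (y - x) ∈ closure Ω := fun t ht =>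
    hΩc.closure.add_smul_sub_mem hx hy ht
  have hder : ∀ t ∈ Ico (0 : ℝ) 1, ∃ d, ‖d‖ ≤ L * ‖y - x‖ ∧
      HasDerivWithinAt (fun t : ℝ => f (x + t • (y - x))) d (Ici t) t := by
    intro t ht
    obtain ⟨a, b, c, h, δ, hδ, -, hm⟩ := T.exists_triangle_germ hΩ hΩc
      (hseg t ⟨ht.1, ht.2.le⟩) (ε := 1 - t) (v := y - x) (by linarith [ht.2])
      (by rw [add_assoc, ← add_smul, add_sub_cancel]; exact hseg 1 (by simp))
    refine ⟨(triAffine a b c f).linear (y - x), ?_, ?_⟩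
    · exact ((triAffine a b c f).linear.toContinuousLinearMap.le_opNorm (y - x)).trans
        (mul_le_mul_of_nonneg_right (hL (a, b, c) h) (norm_nonneg _))
    · have hd : HasDerivAt (fun s : ℝ => triAffine a b c f x +
          s * (triAffine a b c f).linear (y - x)) ((triAffine a b c f).linear (y - x)) t := by
        simpa using ((hasDerivAt_id t).mul_const ((triAffine a b c f).linear (y - x))).const_add
          (triAffine a b c f x)
      refine hd.hasDerivWithinAt.congr_of_eventuallyEq ?_ ?_
      · filter_upwards [Icc_mem_nhdsGE (show t < t + δ by linarith)] with s hs
        have := hm (s - t) ⟨by linarith [hs.1], by linarith [hs.2]⟩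
        rw [add_assoc, ← add_smul, add_sub_cancel] at this
        rw [h.apply hf this, affine_add_smul]
      · have := hm 0 ⟨le_rfl, hδ.le⟩
        rw [zero_smul, add_zero] at this
        rw [h.apply hf this, affine_add_smul]
  choose! d hd hd' using hder
  have := norm_image_sub_le_of_norm_deriv_right_le_segment (a := (0 : ℝ)) (b := 1)
    (f := fun t : ℝ => f (x + t • (y - x)))
    (hcont.comp (by fun_prop) hseg) hd' hd 1 (by simp)
  simp only [one_smul, add_sub_cancel, zero_smul, add_zero, sub_zero, mul_one] at this
  rw [dist_eq_norm, dist_eq_norm]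
  exact this.trans (mul_le_mul_of_nonneg_right (Real.le_coe_toNNReal L) (norm_nonneg _))

end Triangulation

end GeomHom

end

noncomputable section

namespace GeomHom

/-- The squared length of a vector. -/
def sqLen (v : Plane) : ℝ := v 0 ^ 2 + v 1 ^ 2

lemma sqLen_eq (v : Plane) : sqLen v = ‖v‖ ^ 2 := by
  rw [EuclideanSpace.norm_sq_eq, Fin.sum_univ_two]; simp [sqLen]

lemma sqLen_pos {v : Plane} (h : v ≠ 0) : 0 < sqLen v := by
  rw [sqLen_eq]; positivity

lemma inner_eq (v w : Plane) : inner ℝ v w = v 0 * w 0 + v 1 * w 1 := by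
  simp [PiLp.inner_apply, Fin.sum_univ_two, mul_comm]

/-- The normal vector of the edge `a, b`, scaled by the inverse of the length of the edge. -/
def normalVec (a b : Plane) : Plane := (sqLen (b - a))⁻¹ • !₂[-(b 1 - a 1), b 0 - a 0]

lemma wedge_normalVec {a b : Plane} (h : a ≠ b) : wedge (b - a) (normalVec a b) = 1 := by
  have h1 := (sqLen_pos (sub_ne_zero.2 h.symm)).ne'
  simp only [wedge, normalVec, PiLp.smul_apply, PiLp.sub_apply, smul_eq_mul]
  simp only [Matrix.cons_val_zero, Matrix.cons_val_one]
  field_simp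
  simp [sqLen]

/-- The contribution of the triangle `a, b, c` to the hinge formula for the edge `a, b`. -/
def hingeTerm (a b c : Plane) (s : Plane → ℝ) : ℝ :=
  (s c - s a - inner ℝ (c - a) (b - a) / sqLen (b - a) * (s b - s a)) / |wedge (b - a) (c - a)|

lemma normal_decomp {a b : Plane} (h : a ≠ b) (c : Plane) :
    c - a = (inner ℝ (c - a) (b - a) / sqLen (b - a)) • (b - a) +
      wedge (b - a) (c - a) • normalVec a b := by
  have h1 := (sqLen_pos (sub_ne_zero.2 h.symm)).ne'
  apply plane_ext <;>
  · simp only [wedge, normalVec, PiLp.smul_apply, PiLp.sub_apply, smul_eq_mul, PiLp.add_apply,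
      inner_eq, Matrix.cons_val_zero, Matrix.cons_val_one]
    field_simp
    simp [sqLen]; ring

lemma cot_angle {a b c : Plane} (h : wedge (a - b) (c - b) ≠ 0) :
    Real.cot (EuclideanGeometry.angle a b c) =
      inner ℝ (a - b) (c - b) / |wedge (a - b) (c - b)| := by
  have ha : a - b ≠ 0 := by rintro h0; simp [h0, wedge] at h
  have hc : c - b ≠ 0 := by rintro h0; simp [h0, wedge] at h
  have hn : ‖a - b‖ * ‖c - b‖ ≠ 0 := by simp [ha, hc]
  have h1 := InnerProductGeometry.sin_angle_mul_norm_mul_norm (a - b) (c - b)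
  have h2 := InnerProductGeometry.cos_angle_mul_norm_mul_norm (a - b) (c - b)
  have h3 : √(inner ℝ (a - b) (a - b) * inner ℝ (c - b) (c - b) -
      inner ℝ (a - b) (c - b) * inner ℝ (a - b) (c - b)) = |wedge (a - b) (c - b)| := by
    rw [← Real.sqrt_sq_eq_abs]; congr 1
    simp only [inner_eq, wedge]; ring
  rw [h3] at h1
  rw [Real.cot_eq_cos_div_sin, ← h1, ← h2, EuclideanGeometry.angle]
  simp only [vsub_eq_sub]
  rw [mul_div_mul_right _ _ hn]

/-- `d` is the one-sided derivative of `g` at `p` in the direction `v`, or zero if the ray leaves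
the domain at once. -/
def IsOneSidedDeriv (Ω : Set Plane) (g : Plane → ℝ) (p v : Plane) (d : ℝ) : Prop :=
  (∃ δ, 0 < δ ∧ ∀ ε ∈ Icc 0 δ, p + ε • v ∈ closure Ω ∧ g (p + ε • v) = g p + ε * d) ∨
    (d = 0 ∧ ∀ ε : ℝ, 0 < ε → p + ε • v ∉ closure Ω)

lemma IsOneSidedDeriv.unique {Ω : Set Plane} {g : Plane → ℝ} {p v : Plane} {d d' : ℝ}
    (h : IsOneSidedDeriv Ω g p v d) (h' : IsOneSidedDeriv Ω g p v d') : d = d' := by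
  rcases h with ⟨δ, hδ, h⟩ | ⟨rfl, h⟩ <;> rcases h' with ⟨δ', hδ', h'⟩ | ⟨rfl, h'⟩
  · have hm : 0 < min δ δ' := lt_min hδ hδ'
    have h1 := (h (min δ δ') ⟨hm.le, min_le_left _ _⟩).2
    rw [(h' (min δ δ') ⟨hm.le, min_le_right _ _⟩).2] at h1
    have := add_left_cancel h1
    exact (mul_left_cancel₀ hm.ne' this).symm
  · exact absurd (h δ ⟨hδ.le, le_rfl⟩).1 (h' δ hδ)
  · exact absurd (h' δ' ⟨hδ'.le, le_rfl⟩).1 (h δ' hδ')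
  · rfl

lemma IsOneSidedDeriv.smul {Ω : Set Plane} {g : Plane → ℝ} {p v : Plane} {d : ℝ}
    (h : IsOneSidedDeriv Ω g p v d) {l : ℝ} (hl : 0 < l) :
    IsOneSidedDeriv Ω g p (l • v) (l * d) := by
  rcases h with ⟨δ, hδ, h⟩ | ⟨rfl, h⟩
  · refine Or.inl ⟨δ / l, div_pos hδ hl, fun ε hε => ?_⟩
    have := h (ε * l) ⟨mul_nonneg hε.1 hl.le, (le_div_iff₀ hl).1 hε.2⟩
    rw [smul_smul, ← mul_assoc]; exact this
  · refine Or.inr ⟨mul_zero _, fun ε hε => ?_⟩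
    rw [smul_smul]; exact h _ (mul_pos hε hl)

namespace Triangulation

variable {Ω : Set Plane} {T : Triangulation Ω}

lemma mem_opposite {a b c : Plane} (h : a ≠ b) : c ∈ T.opposite a b ↔ T.IsTriangle a b c := by
  classical
  simp only [opposite, Finset.mem_filter, IsTriangle]
  constructor
  · rintro ⟨-, h1, h2, h3⟩; exact ⟨h, h1, h2, h3⟩
  · rintro ⟨-, h1, h2, h3⟩; exact ⟨mem_nodes_of_face h3 (by simp), h1, h2, h3⟩

lemma IsTriangle.edge {a b c : Plane} (h : T.IsTriangle a b c) :
    ({a, b} : Finset Plane) ∈ T.faces :=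
  T.down_closed h.2.2.2 (by intro x; simp; tauto) (by simp)

lemma wedge_cycle' (a b c : Plane) : wedge (a - c) (b - c) = wedge (b - a) (c - a) := by
  rw [← wedge_cycle a b c, ← wedge_cycle b c a]

lemma baryCoord_segment {a b c : Plane} {α β : ℝ} (hs : α + β = 1) (v : Plane) (ε : ℝ) :
    baryCoord c a b (α • a + β • b + ε • v) =
      ε * (wedge (b - a) v / wedge (b - a) (c - a)) := by
  rw [baryCoord, wedge_cycle' a b c, mul_div_assoc']
  congr 1
  obtain rfl : α = 1 - β := by linarith
  simp [wedge]; ring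

lemma IsTriangle.baryCoord_segment_left {a b c : Plane} (h : T.IsTriangle a b c) {α β : ℝ}
    (hs : α + β = 1) : baryCoord a b c (α • a + β • b) = α := by
  have := baryCoord_eq h.wedge_ne (α := α) (β := β) (γ := 0) (by linarith)
  simpa using this

lemma IsTriangle.baryCoord_segment_mid {a b c : Plane} (h : T.IsTriangle a b c) {α β : ℝ}
    (hs : α + β = 1) : baryCoord b c a (α • a + β • b) = β := by
  have := baryCoord_eq h.rotate.wedge_ne (α := β) (β := 0) (γ := α) (by linarith)
  rw [zero_smul, add_zero, add_comm] at this
  exact this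

/-- Moving from a point of an edge to the side of `c` one enters the triangle `a, b, c`. -/
lemma IsTriangle.eventually_mem {a b c : Plane} (h : T.IsTriangle a b c) {p v : Plane}
    (hp : p ∈ openSegment ℝ a b) (hv : 0 < wedge (b - a) v * wedge (b - a) (c - a)) :
    ∀ᶠ ε in 𝓝[>] (0 : ℝ), p + ε • v ∈ openTri a b c := by
  obtain ⟨α, β, hα, hβ, hs, rfl⟩ := hp
  have hc : Continuous fun ε : ℝ => α • a + β • b + ε • v := by fun_prop
  have h1 : ∀ᶠ ε in 𝓝[>] (0 : ℝ), 0 < baryCoord a b c (α • a + β • b + ε • v) := by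
    refine Eventually.filter_mono nhdsWithin_le_nhds ?_
    refine ((continuous_baryCoord a b c).comp hc).continuousAt.eventually_const_lt ?_
    simpa [h.baryCoord_segment_left hs] using hα
  have h2 : ∀ᶠ ε in 𝓝[>] (0 : ℝ), 0 < baryCoord b c a (α • a + β • b + ε • v) := by
    refine Eventually.filter_mono nhdsWithin_le_nhds ?_
    refine ((continuous_baryCoord b c a).comp hc).continuousAt.eventually_const_lt ?_
    simpa [h.baryCoord_segment_mid hs] using hβ
  filter_upwards [h1, h2, self_mem_nhdsWithin] with ε h1 h2 h3
  refine ⟨h1, h2, ?_⟩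
  rw [baryCoord_segment hs]
  refine mul_pos h3 ?_
  rcases mul_pos_iff.1 hv with h | h
  · exact div_pos h.1 h.2
  · exact div_pos_of_neg_of_neg h.1 h.2

lemma midpoint_mem (a b : Plane) : (1 / 2 : ℝ) • a + (1 / 2 : ℝ) • b ∈ openSegment ℝ a b :=
  ⟨1 / 2, 1 / 2, by norm_num, by norm_num, by norm_num, rfl⟩

/-- On each side of an edge there is at most one triangle. -/
lemma IsTriangle.unique_of_side {a b c c' : Plane} (h : T.IsTriangle a b c)
    (h' : T.IsTriangle a b c') (hs : 0 < wedge (b - a) (c - a) * wedge (b - a) (c' - a)) :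
    c = c' := by
  have h1 := h.eventually_mem (midpoint_mem a b) (v := c - a) (mul_self_pos.2 h.wedge_ne)
  have h2 := h'.eventually_mem (midpoint_mem a b) (v := c - a) hs
  obtain ⟨ε, e1, e2⟩ := (h1.and h2).exists
  obtain ⟨w, hw, hws⟩ := h.isBary e1
  obtain ⟨w', hw', hws'⟩ := h'.isBary e2
  rw [hw.unique hw', hws'] at hws
  have : c ∈ ({a, b, c'} : Finset Plane) := by rw [hws]; simp
  simp only [Finset.mem_insert, Finset.mem_singleton] at this
  rcases this with h3 | h3 | h3
  · exact absurd h3.symm h.2.1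
  · exact absurd h3.symm h.2.2.1
  · exact h3

lemma isBary_edge {a b : Plane} (hab : a ≠ b) (h : ({a, b} : Finset Plane) ∈ T.faces)
    {p : Plane} (hp : p ∈ openSegment ℝ a b) : ∃ w, T.IsBary p w ∧ w.support = {a, b} := by
  classical
  obtain ⟨α, β, hα, hβ, hs, rfl⟩ := hp
  obtain ⟨w, hw, hws, hwe⟩ := T.exists_isBary h (w := fun v => if v = a then α else β)
    (by intro v _; split_ifs <;> linarith) (by rw [Finset.sum_pair hab]; simp [hab.symm, hs])
  rw [Finset.sum_pair hab] at hw
  simp only [if_true, hab.symm, if_false] at hw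
  refine ⟨w, hw, hws.antisymm fun v hv => ?_⟩
  rw [Finsupp.mem_support_iff, hwe v hv]
  split_ifs
  · exact hα.ne'
  · exact hβ.ne'

lemma IsTriangle.exists_third {x y z a b : Plane} (h : T.IsTriangle x y z) (hab : a ≠ b)
    (hs : ({a, b} : Finset Plane) ⊆ {x, y, z}) :
    ∃ c, T.IsTriangle a b c ∧ ({a, b, c} : Finset Plane) = {x, y, z} := by
  classical
  have hc : ({x, y, z} \ {a, b} : Finset Plane).card = 1 := by
    rw [Finset.card_sdiff_of_subset hs, Finset.card_pair hab,
      Finset.card_eq_three.2 ⟨x, y, z, h.1, h.2.1, h.2.2.1, rfl⟩]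
  obtain ⟨c, hc⟩ := Finset.card_eq_one.1 hc
  have hcm : c ∈ ({x, y, z} \ {a, b} : Finset Plane) := by rw [hc]; simp
  have hu : ({a, b, c} : Finset Plane) = {x, y, z} := by
    rw [← Finset.sdiff_union_of_subset hs, hc]
    ext v; simp; tauto
  simp only [Finset.mem_sdiff, Finset.mem_insert, Finset.mem_singleton, not_or] at hcm
  have ht : T.IsTriangle a b c :=
    ⟨hab, Ne.symm hcm.2.1, Ne.symm hcm.2.2, by rw [hu]; exact h.2.2.2⟩
  exact ⟨c, ht, hu⟩

/-- A ray that starts on an edge and stays in the domain enters a triangle that contains the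
edge. -/
lemma exists_side (hΩ : IsOpen Ω) (hΩc : Convex ℝ Ω) {a b : Plane} (hab : a ≠ b)
    (h : ({a, b} : Finset Plane) ∈ T.faces) {p v : Plane} (hp : p ∈ openSegment ℝ a b)
    (hv : wedge (b - a) v ≠ 0) {ε : ℝ} (hε : 0 < ε) (hm : p + ε • v ∈ closure Ω) :
    ∃ c, T.IsTriangle a b c ∧ 0 < wedge (b - a) v * wedge (b - a) (c - a) := by
  obtain ⟨w, hw, hws⟩ := isBary_edge hab h hp
  obtain ⟨x, y, z, ht, δ, hδ, -, hd⟩ := T.exists_triangle_germ hΩ hΩc hw.mem_closure hε hm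
  have hpt : p ∈ closedTri x y z := by simpa using hd 0 ⟨le_rfl, hδ.le⟩
  rw [ht.closedTri_eq] at hpt
  have hs := hw.support_subset_of_mem ht.2.2.2 hpt
  rw [hws] at hs
  obtain ⟨c, hc, he⟩ := ht.exists_third hab hs
  refine ⟨c, hc, ?_⟩
  have h1 := hd δ ⟨hδ.le, le_rfl⟩
  rw [ht.closedTri_eq, ← he, ← hc.closedTri_eq] at h1
  obtain ⟨α, β, hα, hβ, hs, rfl⟩ := hp
  have h2 := h1.2.2
  rw [baryCoord_segment hs] at h2
  have h3 := nonneg_of_mul_nonneg_right h2 hδ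
  have h4 : wedge (b - a) v / wedge (b - a) (c - a) * wedge (b - a) (c - a) ^ 2 =
      wedge (b - a) v * wedge (b - a) (c - a) := by
    field_simp [hc.wedge_ne]
  refine lt_of_le_of_ne (by rw [← h4]; positivity) (mul_ne_zero hv hc.wedge_ne).symm

lemma IsTriangle.linear_normal {a b c : Plane} (h : T.IsTriangle a b c) (g : Plane → ℝ) :
    hingeTerm a b c g = (wedge (b - a) (c - a) / |wedge (b - a) (c - a)|) *
      (triAffine a b c g).linear (normalVec a b) := by
  have h1 : (triAffine a b c g).linear (c - a) = g c - g a := by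
    rw [← affine_sub, h.triAffine_right, h.triAffine_left]
  have h2 : (triAffine a b c g).linear (b - a) = g b - g a := by
    rw [← affine_sub, h.triAffine_mid, h.triAffine_left]
  have h3 := congrArg (triAffine a b c g).linear (normal_decomp h.1 c)
  rw [map_add, map_smul, map_smul, h1, h2, smul_eq_mul, smul_eq_mul] at h3
  rw [hingeTerm, h3]; ring

/-- The hinge contribution of a triangle is a directional derivative. -/
lemma IsTriangle.slope {a b c : Plane} (h : T.IsTriangle a b c) {g : Plane → ℝ}
    (hg : g ∈ T.piecewiseLinear) {p : Plane} (hp : p ∈ openSegment ℝ a b) {σ : ℝ}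
    (hσ : σ = 1 ∨ σ = -1) (hs : 0 < σ * wedge (b - a) (c - a)) :
    ∃ δ, 0 < δ ∧ ∀ ε ∈ Icc 0 δ, p + ε • (σ • normalVec a b) ∈ closedTri a b c ∧
      g (p + ε • (σ • normalVec a b)) = g p + ε * hingeTerm a b c g := by
  have hw : wedge (b - a) (σ • normalVec a b) = σ := by
    have := wedge_normalVec h.1
    simp only [wedge] at this ⊢
    simp only [PiLp.smul_apply, smul_eq_mul]
    linear_combination σ * this
  have hev := h.eventually_mem hp (v := σ • normalVec a b) (by rw [hw]; exact hs)
  obtain ⟨δ, h1, h2 : 0 < δ⟩ := (hev.and self_mem_nhdsWithin).exists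
  have hp0 : p ∈ closedTri a b c := by
    rw [h.closedTri_eq]
    refine convexHull_mono ?_ (openSegment_subset_segment ℝ _ _ hp |> fun hh => by
      rwa [← convexHull_pair] at hh)
    intro x; simp; tauto
  refine ⟨δ, h2, fun ε hε => ?_⟩
  have hm : p + ε • (σ • normalVec a b) ∈ closedTri a b c := by
    have h3 := (convex_closedTri a b c).add_smul_sub_mem hp0
      (openTri_subset_closedTri _ _ _ h1) (t := ε / δ)
      ⟨div_nonneg hε.1 h2.le, (div_le_one h2).2 hε.2⟩
    rwa [add_sub_cancel_left, smul_smul, div_mul_cancel₀ _ h2.ne'] at h3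
  refine ⟨hm, ?_⟩
  rw [h.apply hg hm, h.apply hg hp0, affine_add_smul, h.linear_normal, map_smul, smul_eq_mul]
  have : wedge (b - a) (c - a) / |wedge (b - a) (c - a)| = σ := by
    rw [div_eq_iff (abs_ne_zero.2 h.wedge_ne)]
    rcases hσ with rfl | rfl
    · rw [abs_of_pos (by linarith)]; ring
    · rw [abs_of_neg (by linarith)]; ring
  rw [this]

/-- The sum of the hinge contributions of all triangles that contain the edge. -/
def jump (T : Triangulation Ω) (g : Plane → ℝ) (a b : Plane) : ℝ :=
  ∑ c ∈ T.opposite a b, hingeTerm a b c g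

lemma isOneSidedDeriv_sum (hΩ : IsOpen Ω) (hΩc : Convex ℝ Ω) {g : Plane → ℝ}
    (hg : g ∈ T.piecewiseLinear) {a b : Plane} (hab : a ≠ b)
    (h : ({a, b} : Finset Plane) ∈ T.faces) {p : Plane} (hp : p ∈ openSegment ℝ a b) {σ : ℝ}
    (hσ : σ = 1 ∨ σ = -1) :
    IsOneSidedDeriv Ω g p (σ • normalVec a b)
      (∑ c ∈ (T.opposite a b).filter (fun c => 0 < σ * wedge (b - a) (c - a)),
        hingeTerm a b c g) := by
  by_cases hex : ∃ c, T.IsTriangle a b c ∧ 0 < σ * wedge (b - a) (c - a)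
  · obtain ⟨c, hc, hs⟩ := hex
    have he : (T.opposite a b).filter (fun c => 0 < σ * wedge (b - a) (c - a)) = {c} := by
      ext c'
      simp only [Finset.mem_filter, mem_opposite hab, Finset.mem_singleton]
      constructor
      · rintro ⟨h1, h2⟩
        refine h1.unique_of_side hc ?_
        have := mul_pos h2 hs
        rcases hσ with rfl | rfl <;> linarith
      · rintro rfl; exact ⟨hc, hs⟩
    rw [he, Finset.sum_singleton]
    obtain ⟨δ, hδ, hd⟩ := hc.slope hg hp hσ hs
    exact Or.inl ⟨δ, hδ, fun ε hε => ⟨hc.closedTri_subset (hd ε hε).1, (hd ε hε).2⟩⟩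
  · have he : (T.opposite a b).filter (fun c => 0 < σ * wedge (b - a) (c - a)) = ∅ := by
      ext c'
      simp only [Finset.mem_filter, mem_opposite hab, Finset.notMem_empty, iff_false]
      exact fun hh => hex ⟨c', hh⟩
    rw [he, Finset.sum_empty]
    refine Or.inr ⟨rfl, fun ε hε hm => hex ?_⟩
    have hw : wedge (b - a) (σ • normalVec a b) = σ := by
      have := wedge_normalVec hab
      simp only [wedge] at this ⊢
      simp only [PiLp.smul_apply, smul_eq_mul]
      linear_combination σ * this
    obtain ⟨c, hc, hs⟩ := exists_side hΩ hΩc hab h hp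
      (by rw [hw]; rcases hσ with rfl | rfl <;> norm_num) hε hm
    rw [hw] at hs
    exact ⟨c, hc, hs⟩

lemma jump_eq_add {T : Triangulation Ω} (g : Plane → ℝ) {a b : Plane} (hab : a ≠ b) :
    T.jump g a b =
      ∑ c ∈ (T.opposite a b).filter (fun c => 0 < (1 : ℝ) * wedge (b - a) (c - a)),
        hingeTerm a b c g +
      ∑ c ∈ (T.opposite a b).filter (fun c => 0 < (-1 : ℝ) * wedge (b - a) (c - a)),
        hingeTerm a b c g := by
  rw [jump, ← Finset.sum_filter_add_sum_filter_not (T.opposite a b)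
    (fun c => 0 < (1 : ℝ) * wedge (b - a) (c - a))]
  congr 1
  refine Finset.sum_congr (Finset.filter_congr fun c hc => ?_) fun _ _ => rfl
  have := ((mem_opposite hab).1 hc).wedge_ne
  rw [not_lt, one_mul, neg_one_mul, neg_pos]
  exact ⟨fun h => lt_of_le_of_ne h this, le_of_lt⟩

/-- The jump is the sum of the two one-sided normal derivatives at any point of the open edge. -/
lemma jump_unique (hΩ : IsOpen Ω) (hΩc : Convex ℝ Ω) {g : Plane → ℝ}
    (hg : g ∈ T.piecewiseLinear) {a b : Plane} (hab : a ≠ b)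
    (h : ({a, b} : Finset Plane) ∈ T.faces) {p : Plane} (hp : p ∈ openSegment ℝ a b) {d d' : ℝ}
    (hd : IsOneSidedDeriv Ω g p (normalVec a b) d)
    (hd' : IsOneSidedDeriv Ω g p (-normalVec a b) d') : T.jump g a b = d + d' := by
  have h1 := isOneSidedDeriv_sum hΩ hΩc hg hab h hp (Or.inl rfl)
  have h2 := isOneSidedDeriv_sum hΩ hΩc hg hab h hp (Or.inr rfl)
  rw [one_smul] at h1
  rw [neg_one_smul] at h2
  rw [jump_eq_add g hab, h1.unique hd, h2.unique hd']

lemma exists_jump (hΩ : IsOpen Ω) (hΩc : Convex ℝ Ω) {g : Plane → ℝ}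
    (hg : g ∈ T.piecewiseLinear) {a b : Plane} (hab : a ≠ b)
    (h : ({a, b} : Finset Plane) ∈ T.faces) {p : Plane} (hp : p ∈ openSegment ℝ a b) :
    ∃ d d', IsOneSidedDeriv Ω g p (normalVec a b) d ∧
      IsOneSidedDeriv Ω g p (-normalVec a b) d' ∧ T.jump g a b = d + d' := by
  have h1 := isOneSidedDeriv_sum hΩ hΩc hg hab h hp (Or.inl rfl)
  have h2 := isOneSidedDeriv_sum hΩ hΩc hg hab h hp (Or.inr rfl)
  rw [one_smul] at h1
  rw [neg_one_smul] at h2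
  exact ⟨_, _, h1, h2, jump_eq_add g hab⟩

/-! ### Interior edges -/

lemma openTri_subset (hΩ : IsOpen Ω) (hΩc : Convex ℝ Ω) {a b c : Plane}
    (h : T.IsTriangle a b c) : openTri a b c ⊆ Ω := by
  rcases Ω.eq_empty_or_nonempty with rfl | hne
  · have := (openTri_subset_closedTri a b c).trans h.closedTri_subset
    simpa using this
  have h1 : openTri a b c ⊆ interior (closure Ω) :=
    interior_maximal ((openTri_subset_closedTri a b c).trans h.closedTri_subset)
      (isOpen_openTri a b c)
  rwa [hΩc.interior_closure_eq_interior_of_nonempty_interior (by rwa [hΩ.interior_eq]),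
    hΩ.interior_eq] at h1

lemma IsInteriorEdge.exists_opposite {a b : Plane} (h : T.IsInteriorEdge a b) :
    ∃ c c', T.IsTriangle a b c ∧ T.IsTriangle a b c' ∧
      0 < wedge (b - a) (c - a) ∧ wedge (b - a) (c' - a) < 0 := by
  obtain ⟨hab, hc⟩ := h
  obtain ⟨c, c', hne, he⟩ := Finset.card_eq_two.1 hc
  have h1 : T.IsTriangle a b c := (mem_opposite hab).1 (by rw [he]; simp)
  have h2 : T.IsTriangle a b c' := (mem_opposite hab).1 (by rw [he]; simp)
  rcases lt_or_gt_of_ne h1.wedge_ne with h3 | h3 <;> rcases lt_or_gt_of_ne h2.wedge_ne with h4 | h4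
  · exact absurd (h1.unique_of_side h2 (mul_pos_of_neg_of_neg h3 h4)) hne
  · exact ⟨c', c, h2, h1, h4, h3⟩
  · exact ⟨c, c', h1, h2, h3, h4⟩
  · exact absurd (h1.unique_of_side h2 (mul_pos h3 h4)) hne

lemma IsInteriorEdge.edge {a b : Plane} (h : T.IsInteriorEdge a b) :
    ({a, b} : Finset Plane) ∈ T.faces := by
  obtain ⟨c, -, hc, -⟩ := h.exists_opposite
  exact hc.edge

lemma IsInteriorEdge.openSegment_subset (hΩ : IsOpen Ω) (hΩc : Convex ℝ Ω) {a b : Plane}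
    (h : T.IsInteriorEdge a b) : openSegment ℝ a b ⊆ Ω := by
  intro p hp
  obtain ⟨c, c', hc, hc', h1, h2⟩ := h.exists_opposite
  have hw := wedge_normalVec h.1
  have e1 := hc.eventually_mem hp (v := normalVec a b) (by rw [hw]; linarith)
  have e2 := hc'.eventually_mem hp (v := -normalVec a b) (by
    have : wedge (b - a) (-normalVec a b) = -1 := by
      rw [← hw]; simp [wedge]; ring
    rw [this]; linarith)
  obtain ⟨ε, ⟨e1, e2⟩, hε : 0 < ε⟩ := ((e1.and e2).and self_mem_nhdsWithin).exists
  have := hΩc (openTri_subset hΩ hΩc hc e1) (openTri_subset hΩ hΩc hc' e2)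
    (a := 1 / 2) (b := 1 / 2) (by norm_num) (by norm_num) (by norm_num)
  convert this using 1
  module

/-- Where both basis functions of an interior edge are positive, one is inside the domain. -/
lemma IsInteriorEdge.mem_of_hat_pos (hΩ : IsOpen Ω) (hΩc : Convex ℝ Ω) {a b : Plane}
    (h : T.IsInteriorEdge a b) {x : Plane} (ha : 0 < T.hat a x) (hb : 0 < T.hat b x) : x ∈ Ω := by
  have hx : x ∈ closure Ω := by
    by_contra hx; rw [T.hat_eq_zero a hx] at ha; exact lt_irrefl _ ha
  obtain ⟨w, hw, hwe⟩ := isBary_hat (T := T) hx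
  have h1 : a ∈ w.support := by rw [Finsupp.mem_support_iff, ← hwe]; exact ha.ne'
  have h2 : b ∈ w.support := by rw [Finsupp.mem_support_iff, ← hwe]; exact hb.ne'
  rcases face_cases hw.1 with ⟨c, hc⟩ | ⟨c, d, hcd, hc⟩ | ⟨c, d, e, ht, hc⟩
  · rw [hc, Finset.mem_singleton] at h1 h2
    exact absurd (h1.trans h2.symm) h.1
  · have hs : w.support = {a, b} := by
      refine (Finset.eq_of_subset_of_card_le (s := {a, b}) (t := w.support) ?_ ?_).symm
      · intro v; simp only [Finset.mem_insert, Finset.mem_singleton]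
        rintro (rfl | rfl) <;> assumption
      · rw [hc, Finset.card_pair hcd, Finset.card_pair h.1]
    refine h.openSegment_subset hΩ hΩc ⟨w a, w b, by rw [← hwe]; exact ha, by rw [← hwe]; exact hb, ?_, ?_⟩
    · have := hw.2.2.1; rwa [Finsupp.sum, hs, Finset.sum_pair h.1] at this
    · have := hw.2.2.2; rwa [Finsupp.sum, hs, Finset.sum_pair h.1] at this
  · exact openTri_subset hΩ hΩc ht (ht.mem_openTri hw hc)

lemma isInteriorEdge_of_mem (hΩ : IsOpen Ω) (hΩc : Convex ℝ Ω) {a b : Plane} (hab : a ≠ b)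
    (h : ({a, b} : Finset Plane) ∈ T.faces) {p : Plane} (hp : p ∈ openSegment ℝ a b)
    (hpΩ : p ∈ Ω) : T.IsInteriorEdge a b := by
  have hw := wedge_normalVec hab
  have hw' : wedge (b - a) (-normalVec a b) = -1 := by rw [← hw]; simp [wedge]; ring
  have key : ∀ v : Plane, ∃ ε : ℝ, 0 < ε ∧ p + ε • v ∈ closure Ω := fun v => by
    have hc : Continuous fun ε : ℝ => p + ε • v := by fun_prop
    have h0 : ∀ᶠ ε in 𝓝 (0 : ℝ), p + ε • v ∈ Ω :=
      hc.continuousAt.eventually (hΩ.mem_nhds (by simpa using hpΩ))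
    obtain ⟨ε, h1, h2⟩ := ((h0.filter_mono nhdsWithin_le_nhds).and
      (self_mem_nhdsWithin (a := (0 : ℝ)) (s := Ioi 0))).exists
    exact ⟨ε, h2, subset_closure h1⟩
  obtain ⟨ε, hε, hm⟩ := key (normalVec a b)
  obtain ⟨ε', hε', hm'⟩ := key (-normalVec a b)
  obtain ⟨c, hc, hs⟩ := exists_side hΩ hΩc hab h hp (by rw [hw]; norm_num) hε hm
  obtain ⟨c', hc', hs'⟩ := exists_side hΩ hΩc hab h hp (by rw [hw']; norm_num) hε' hm'
  rw [hw, one_mul] at hs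
  rw [hw', neg_one_mul, neg_pos] at hs'
  refine ⟨hab, Finset.card_eq_two.2 ⟨c, c', ?_, ?_⟩⟩
  · rintro rfl; linarith
  · ext d
    simp only [mem_opposite hab, Finset.mem_insert, Finset.mem_singleton]
    constructor
    · intro hd
      rcases lt_or_gt_of_ne hd.wedge_ne with h3 | h3
      · exact Or.inr (hd.unique_of_side hc' (mul_pos_of_neg_of_neg h3 hs'))
      · exact Or.inl (hd.unique_of_side hc (mul_pos h3 hs))
    · rintro (rfl | rfl) <;> assumption

end Triangulation

end GeomHom

end

noncomputable section

namespace GeomHom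

lemma hingeTerm_symm {a b : Plane} (h : a ≠ b) (c : Plane) (s : Plane → ℝ) :
    hingeTerm a b c s = hingeTerm b a c s := by
  have h1 := (sqLen_pos (sub_ne_zero.2 h.symm)).ne'
  have e1 : sqLen (a - b) = sqLen (b - a) := by simp [sqLen]; ring
  have e2 : wedge (a - b) (c - b) = -wedge (b - a) (c - a) := by simp [wedge]; ring
  have e3 : inner ℝ (c - b) (a - b) = sqLen (b - a) - inner ℝ (c - a) (b - a) := by
    simp [inner_eq, sqLen]; ring
  rw [hingeTerm, hingeTerm, e1, e2, e3, abs_neg]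
  congr 1
  field_simp
  ring

lemma normalVec_smul {A B a b : Plane} {l : ℝ} (hl : l ≠ 0) (h : b - a = l • (B - A)) :
    normalVec a b = l⁻¹ • normalVec A B := by
  have e0 : b 0 - a 0 = l * (B 0 - A 0) := by simpa using congrArg (fun v : Plane => v 0) h
  have e1 : b 1 - a 1 = l * (B 1 - A 1) := by simpa using congrArg (fun v : Plane => v 1) h
  have e2 : sqLen (b - a) = l ^ 2 * sqLen (B - A) := by rw [h]; simp [sqLen]; ring
  rw [normalVec, normalVec, e0, e1, e2, mul_inv]
  apply plane_ext <;>
  · simp only [PiLp.smul_apply, smul_eq_mul, Matrix.cons_val_zero, Matrix.cons_val_one]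
    field_simp

namespace Triangulation

variable {Ω : Set Plane} {T F C : Triangulation Ω}

lemma opposite_symm (a b : Plane) : T.opposite a b = T.opposite b a := by
  classical
  ext c
  simp only [opposite, Finset.mem_filter, Finset.insert_comm a b]
  tauto

lemma IsInteriorEdge.symm {a b : Plane} (h : T.IsInteriorEdge a b) : T.IsInteriorEdge b a :=
  ⟨h.1.symm, by rw [opposite_symm]; exact h.2⟩

lemma jump_symm {a b : Plane} (h : a ≠ b) (s : Plane → ℝ) : T.jump s a b = T.jump s b a := by
  rw [jump, jump, opposite_symm]
  exact Finset.sum_congr rfl fun c _ => hingeTerm_symm h c s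

lemma jump_eq_zero_of_notMem {a b : Plane} (hab : a ≠ b) (h : ({a, b} : Finset Plane) ∉ T.faces)
    (s : Plane → ℝ) : T.jump s a b = 0 :=
  Finset.sum_eq_zero fun _ hc => absurd ((mem_opposite hab).1 hc).edge h

lemma jump_congr {s s' : Plane → ℝ} (h : ∀ k ∈ T.nodes, s k = s' k) {a b : Plane} (hab : a ≠ b) :
    T.jump s a b = T.jump s' a b := by
  refine Finset.sum_congr rfl fun c hc => ?_
  have ht := (mem_opposite hab).1 hc
  rw [hingeTerm, hingeTerm, h c (mem_nodes_of_face ht.2.2.2 (by simp)),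
    h a (mem_nodes_of_face ht.2.2.2 (by simp)), h b (mem_nodes_of_face ht.2.2.2 (by simp))]

/-- The hinge formula in terms of jumps of normal derivatives. -/
lemma hinge_apply (s : T.piecewiseLinear) (e : T.Edge) :
    T.hinge s e = T.jump s.1 e.1.1 e.1.2 := by
  obtain ⟨⟨a, b⟩, he⟩ := e
  have hab : a ≠ b := he.1
  have hq := sqLen_pos (sub_ne_zero.2 hab.symm)
  change ∑ k ∈ T.opposite a b, _ = ∑ k ∈ T.opposite a b, _
  refine Finset.sum_congr rfl fun c hc => ?_
  have ht := (mem_opposite hab).1 hc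
  have e1 : wedge (a - b) (c - b) = -wedge (b - a) (c - a) := by simp [wedge]; ring
  have e2 : inner ℝ (a - b) (c - b) = sqLen (b - a) - inner ℝ (c - a) (b - a) := by
    simp [inner_eq, sqLen]; ring
  have e3 : inner ℝ (b - a) (c - a) = inner ℝ (c - a) (b - a) := real_inner_comm _ _
  have e4 : dist a b ^ 2 = sqLen (b - a) := by rw [dist_comm, dist_eq_norm, ← sqLen_eq]
  have e5 : area a b c = |wedge (b - a) (c - a)| / 2 := by simp [area, wedge]
  rw [cot_angle (by rw [e1]; exact neg_ne_zero.2 ht.wedge_ne), cot_angle ht.wedge_ne, e1, e2, e3,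
    e4, e5, abs_neg, hingeTerm]
  have := abs_ne_zero.2 ht.wedge_ne
  field_simp
  ring

/-! ### Matrices of edge conductivities -/

lemma offDiag_of_edge {a b : Plane} (h : T.IsInteriorEdge a b) (q : T.Edge → ℝ) :
    T.offDiag a b q = q ⟨(a, b), h⟩ := by
  rw [offDiag, dif_pos h]; rfl

lemma offDiag_of_not {a b : Plane} (h : ¬T.IsInteriorEdge a b) (q : T.Edge → ℝ) :
    T.offDiag a b q = 0 := by
  rw [offDiag, dif_neg h]; rfl

lemma sum_entry {k : Plane} (hk : k ∈ T.nodes) (q : T.Edge → ℝ) :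
    ∑ l ∈ T.nodes, T.entry k l q = 0 := by
  classical
  rw [← Finset.add_sum_erase _ _ hk]
  have h1 : T.entry k k q = -∑ m ∈ T.nodes, T.offDiag k m q := by
    rw [entry, if_pos rfl]; simp
  have h2 : ∑ l ∈ T.nodes.erase k, T.entry k l q = ∑ l ∈ T.nodes.erase k, T.offDiag k l q :=
    Finset.sum_congr rfl fun l hl => by
      rw [entry, if_neg (Finset.ne_of_mem_erase hl).symm]
  rw [h1, h2, ← Finset.add_sum_erase _ _ hk, offDiag_of_not (fun h => h.1 rfl)]
  simp

lemma coarsenCond_apply (F C : Triangulation Ω) (q : F.Edge → ℝ) (e : C.Edge) :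
    coarsenCond F C q e = ∑ k ∈ F.nodes, ∑ l ∈ F.nodes,
      C.hat e.1.1 k * C.hat e.1.2 l * F.entry k l q := by
  simp [coarsenCond, LinearMap.pi_apply, LinearMap.sum_apply]

lemma sum_mul_eq_of_row {N : Finset Plane} {M : Plane → Plane → ℝ}
    (h : ∀ k ∈ N, ∑ l ∈ N, M k l = 0) (f g : Plane → ℝ) :
    ∑ k ∈ N, ∑ l ∈ N, f k * g l * M k l = ∑ k ∈ N, ∑ l ∈ N, f k * (g l - g k) * M k l := by
  refine Finset.sum_congr rfl fun k hk => ?_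
  have : ∑ l ∈ N, f k * g k * M k l = 0 := by rw [← Finset.mul_sum, h k hk, mul_zero]
  rw [← sub_zero (∑ l ∈ N, f k * g l * M k l), ← this, ← Finset.sum_sub_distrib]
  exact Finset.sum_congr rfl fun l _ => by ring

lemma hat_midpoint (h : F.Refines C) {k l : Plane} (hkl : k ≠ l)
    (hf : ({k, l} : Finset Plane) ∈ F.faces) (i : Plane) :
    C.hat i ((1 / 2 : ℝ) • k + (1 / 2 : ℝ) • l) = 1 / 2 * C.hat i k + 1 / 2 * C.hat i l :=
  apply_edge (h.mem_piecewiseLinear (C.hat_mem i)) hkl hf (by norm_num) (by norm_num) (by norm_num)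

/-- Coarse graining of the edge conductivities given by a local matrix with vanishing row sums;
the entries of the matrix on boundary edges do not contribute. -/
lemma coarsenCond_eq_of_matrix (hΩ : IsOpen Ω) (hΩc : Convex ℝ Ω) (h : F.Refines C)
    {M : Plane → Plane → ℝ} (hrow : ∀ k ∈ F.nodes, ∑ l ∈ F.nodes, M k l = 0)
    (hloc : ∀ k ∈ F.nodes, ∀ l ∈ F.nodes, k ≠ l → ({k, l} : Finset Plane) ∉ F.faces → M k l = 0)
    {q : F.Edge → ℝ} (hq : ∀ e : F.Edge, q e = M e.1.1 e.1.2) (e : C.Edge) :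
    coarsenCond F C q e =
      ∑ k ∈ F.nodes, ∑ l ∈ F.nodes, C.hat e.1.1 k * C.hat e.1.2 l * M k l := by
  rw [coarsenCond_apply, sum_mul_eq_of_row (fun k hk => sum_entry hk q),
    sum_mul_eq_of_row hrow]
  refine Finset.sum_congr rfl fun k hk => Finset.sum_congr rfl fun l hl => ?_
  by_cases hkl : k = l
  · simp [hkl]
  have e1 : F.entry k l q = F.offDiag k l q := by rw [entry, if_neg hkl]
  by_cases hi : F.IsInteriorEdge k l
  · rw [e1, offDiag_of_edge hi, hq]
  rw [e1, offDiag_of_not hi]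
  by_cases hf : ({k, l} : Finset Plane) ∈ F.faces
  · suffices C.hat e.1.1 k * (C.hat e.1.2 l - C.hat e.1.2 k) = 0 by rw [this]; ring
    by_contra hne
    rw [mul_eq_zero, not_or] at hne
    refine hi (isInteriorEdge_of_mem hΩ hΩc hkl hf (midpoint_mem k l)
      (e.2.mem_of_hat_pos hΩ hΩc ?_ ?_))
    · rw [hat_midpoint h hkl hf]
      have h1 := lt_of_le_of_ne (hat_nonneg (T := C) e.1.1 k) (Ne.symm hne.1)
      have h2 := hat_nonneg (T := C) e.1.1 l
      linarith
    · rw [hat_midpoint h hkl hf]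
      have h1 := hat_nonneg (T := C) e.1.2 k
      have h2 := hat_nonneg (T := C) e.1.2 l
      rcases h1.lt_or_eq with h3 | h3
      · linarith
      · rcases h2.lt_or_eq with h4 | h4
        · linarith
        · exact absurd (by rw [← h3, ← h4, sub_self]) hne.2
  · rw [hloc k hk l hl hkl hf]

/-- Two nodes whose basis functions are both positive at a point form an edge. -/
lemma edge_of_hat_ne {i j x : Plane} (hi : T.hat i x ≠ 0) (hj : T.hat j x ≠ 0) :
    ({i, j} : Finset Plane) ∈ T.faces := by
  have hx : x ∈ closure Ω := by
    by_contra hx; exact hi (T.hat_eq_zero i hx)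
  obtain ⟨w, hw, hwe⟩ := isBary_hat (T := T) hx
  refine T.down_closed hw.1 ?_ (by simp)
  intro v
  simp only [Finset.mem_insert, Finset.mem_singleton]
  rintro (rfl | rfl)
  · rw [Finsupp.mem_support_iff, ← hwe]; exact hi
  · rw [Finsupp.mem_support_iff, ← hwe]; exact hj

lemma coarsenCond_comp (hΩ : IsOpen Ω) (hΩc : Convex ℝ Ω) {T₁ T₂ T₃ : Triangulation Ω}
    (h₁ : T₁.Refines T₂) (h₂ : T₂.Refines T₃) :
    coarsenCond T₁ T₃ = (coarsenCond T₂ T₃).comp (coarsenCond T₁ T₂) := by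
  ext1 q
  ext e
  rw [LinearMap.comp_apply, coarsenCond_eq_of_matrix hΩ hΩc h₂ (M := fun m n =>
      ∑ k ∈ T₁.nodes, ∑ l ∈ T₁.nodes, T₂.hat m k * T₂.hat n l * T₁.entry k l q) ?_ ?_
      (fun e => coarsenCond_apply T₁ T₂ q e), coarsenCond_apply]
  · have e3 : ∀ i, ∀ k ∈ T₁.nodes, T₃.hat i k = ∑ m ∈ T₂.nodes, T₃.hat i m * T₂.hat m k :=
      fun i k _ => eq_sum_hat (h₂.mem_piecewiseLinear (T₃.hat_mem i)) k
    calc _ = ∑ k ∈ T₁.nodes, ∑ l ∈ T₁.nodes, (∑ m ∈ T₂.nodes, T₃.hat e.1.1 m * T₂.hat m k) *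
          (∑ n ∈ T₂.nodes, T₃.hat e.1.2 n * T₂.hat n l) * T₁.entry k l q :=
          Finset.sum_congr rfl fun k hk => Finset.sum_congr rfl fun l hl => by
            rw [e3 _ k hk, e3 _ l hl]
      _ = ∑ k ∈ T₁.nodes, ∑ l ∈ T₁.nodes, ∑ m ∈ T₂.nodes, ∑ n ∈ T₂.nodes,
          T₃.hat e.1.1 m * T₃.hat e.1.2 n * (T₂.hat m k * T₂.hat n l * T₁.entry k l q) := by
          refine Finset.sum_congr rfl fun k _ => Finset.sum_congr rfl fun l _ => ?_
          rw [Finset.sum_mul_sum, Finset.sum_mul]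
          refine Finset.sum_congr rfl fun m _ => ?_
          rw [Finset.sum_mul]
          exact Finset.sum_congr rfl fun n _ => by ring
      _ = ∑ m ∈ T₂.nodes, ∑ n ∈ T₂.nodes, ∑ k ∈ T₁.nodes, ∑ l ∈ T₁.nodes,
          T₃.hat e.1.1 m * T₃.hat e.1.2 n * (T₂.hat m k * T₂.hat n l * T₁.entry k l q) := by
          rw [Finset.sum_congr rfl fun k _ => Finset.sum_comm, Finset.sum_comm]
          refine Finset.sum_congr rfl fun m _ => ?_
          rw [Finset.sum_congr rfl fun k _ => Finset.sum_comm, Finset.sum_comm]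
      _ = _ := by simp only [Finset.mul_sum]
  · intro m _
    calc _ = ∑ k ∈ T₁.nodes, ∑ l ∈ T₁.nodes, (∑ n ∈ T₂.nodes, T₂.hat n l) *
          (T₂.hat m k * T₁.entry k l q) := by
          rw [Finset.sum_comm]
          refine Finset.sum_congr rfl fun k _ => ?_
          rw [Finset.sum_comm]
          refine Finset.sum_congr rfl fun l _ => ?_
          rw [Finset.sum_mul]
          exact Finset.sum_congr rfl fun n _ => by ring
      _ = ∑ k ∈ T₁.nodes, T₂.hat m k * ∑ l ∈ T₁.nodes, T₁.entry k l q := by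
          refine Finset.sum_congr rfl fun k _ => ?_
          rw [Finset.mul_sum]
          exact Finset.sum_congr rfl fun l hl => by rw [sum_hat (node_mem_closure hl), one_mul]
      _ = 0 := Finset.sum_eq_zero fun k hk => by rw [sum_entry hk, mul_zero]
  · intro m _ n _ hmn hf
    refine Finset.sum_eq_zero fun k hk => Finset.sum_eq_zero fun l hl => ?_
    by_contra hne
    have h1 : T₂.hat m k ≠ 0 := fun h0 => hne (by rw [h0]; ring)
    have h2 : T₂.hat n l ≠ 0 := fun h0 => hne (by rw [h0]; ring)
    have h3 : T₁.entry k l q ≠ 0 := fun h0 => hne (by rw [h0]; ring)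
    by_cases hkl : k = l
    · subst hkl; exact hf (edge_of_hat_ne h1 h2)
    have hi : T₁.IsInteriorEdge k l := by
      by_contra hi
      rw [entry, if_neg hkl, offDiag_of_not hi] at h3
      exact h3 rfl
    have p1 := lt_of_le_of_ne (hat_nonneg (T := T₂) m k) (Ne.symm h1)
    have p2 := lt_of_le_of_ne (hat_nonneg (T := T₂) n l) (Ne.symm h2)
    have p3 := hat_nonneg (T := T₂) m l
    have p4 := hat_nonneg (T := T₂) n k
    refine hf (edge_of_hat_ne (x := (1 / 2 : ℝ) • k + (1 / 2 : ℝ) • l) ?_ ?_)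
    · rw [hat_midpoint h₁ hkl hi.edge]; linarith
    · rw [hat_midpoint h₁ hkl hi.edge]; linarith

end Triangulation

end GeomHom

end

noncomputable section

namespace GeomHom

namespace Triangulation

variable {Ω : Set Plane} {T F C : Triangulation Ω}

/-- The trilinear form `∑ [∂ₙ s] ∂ₜ f ∂ₜ g` over the edges, boundary edges included. -/
def edgeForm (T : Triangulation Ω) (s f g : Plane → ℝ) : ℝ :=
  ∑ a ∈ T.nodes, ∑ b ∈ T.nodes, T.jump s a b * ((f a - f b) * (g a - g b))

lemma sum_triangles (φ : Plane × Plane × Plane → ℝ) :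
    ∑ p ∈ T.finite_triangles.toFinset, φ p = ∑ a ∈ T.nodes, ∑ b ∈ T.nodes,
      ∑ c ∈ (T.opposite a b).filter fun _ => a ≠ b, φ (a, b, c) := by
  classical
  have h : T.finite_triangles.toFinset = (T.nodes ×ˢ T.nodes ×ˢ T.nodes).filter
      fun p => T.IsTriangle p.1 p.2.1 p.2.2 := by
    ext ⟨a, b, c⟩
    simp only [Finite.mem_toFinset, mem_ofPred_eq, Finset.mem_filter, Finset.mem_product]
    exact ⟨fun h => ⟨⟨mem_nodes_of_face h.2.2.2 (by simp), mem_nodes_of_face h.2.2.2 (by simp),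
      mem_nodes_of_face h.2.2.2 (by simp)⟩, h⟩, fun h => h.2⟩
  rw [h, Finset.sum_filter, Finset.sum_product]
  refine Finset.sum_congr rfl fun a _ => ?_
  rw [Finset.sum_product]
  refine Finset.sum_congr rfl fun b _ => ?_
  rw [← Finset.sum_filter]
  refine Finset.sum_congr ?_ fun _ _ => rfl
  ext c
  simp only [Finset.mem_filter]
  constructor
  · rintro ⟨-, h⟩; exact ⟨(mem_opposite h.1).2 h, h.1⟩
  · rintro ⟨h, hab⟩
    have := (mem_opposite hab).1 h
    exact ⟨mem_nodes_of_face this.2.2.2 (by simp), this⟩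

lemma edgeForm_eq (s f g : Plane → ℝ) : T.edgeForm s f g =
    ∑ p ∈ T.finite_triangles.toFinset, hingeTerm p.1 p.2.1 p.2.2 s *
      ((f p.1 - f p.2.1) * (g p.1 - g p.2.1)) := by
  rw [sum_triangles, edgeForm]
  refine Finset.sum_congr rfl fun a _ => Finset.sum_congr rfl fun b _ => ?_
  by_cases hab : a = b
  · simp [hab]
  · rw [Finset.filter_true_of_mem fun _ _ => hab, jump, Finset.sum_mul]

lemma sum_triangles_rotate (φ : Plane × Plane × Plane → ℝ) :
    ∑ p ∈ T.finite_triangles.toFinset, φ (p.2.1, p.2.2, p.1) =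
      ∑ p ∈ T.finite_triangles.toFinset, φ p := by
  refine Finset.sum_nbij' (fun p => (p.2.1, p.2.2, p.1)) (fun p => (p.2.2, p.1, p.2.1)) ?_ ?_ ?_ ?_ ?_
  · intro p hp; simp only [Finite.mem_toFinset, mem_ofPred_eq] at hp ⊢; exact hp.rotate
  · intro p hp; simp only [Finite.mem_toFinset, mem_ofPred_eq] at hp ⊢; exact hp.rotate.rotate
  · intro p _; rfl
  · intro p _; rfl
  · intro p _; rfl

lemma edgeForm_comm (s f g : Plane → ℝ) : T.edgeForm s f g = T.edgeForm g f s := by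
  rw [edgeForm_eq, edgeForm_eq, ← sub_eq_zero, ← Finset.sum_sub_distrib]
  set φ : Plane × Plane × Plane → ℝ := fun p => hingeTerm p.1 p.2.1 p.2.2 s *
      ((f p.1 - f p.2.1) * (g p.1 - g p.2.1)) - hingeTerm p.1 p.2.1 p.2.2 g *
      ((f p.1 - f p.2.1) * (s p.1 - s p.2.1)) with hφ
  have h : ∑ p ∈ T.finite_triangles.toFinset, (φ p + φ (p.2.1, p.2.2, p.1) +
      φ (p.2.2, p.1, p.2.1)) = 0 := by
    refine Finset.sum_eq_zero fun p hp => ?_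
    obtain ⟨a, b, c⟩ := p
    simp only [Finite.mem_toFinset, mem_ofPred_eq] at hp
    have hw := abs_ne_zero.2 hp.wedge_ne
    have key : ∀ a b c : Plane, φ (a, b, c) = (f a - f b) *
        ((g c - g a) * (s b - s a) - (s c - s a) * (g b - g a)) /
          |wedge (b - a) (c - a)| := fun a b c => by
      simp only [hφ, hingeTerm]
      ring
    simp only [key]
    rw [wedge_cycle a b c, wedge_cycle b c a, wedge_cycle a b c]
    field_simp
    ring
  rw [Finset.sum_add_distrib, Finset.sum_add_distrib, sum_triangles_rotate φ,
    ← sum_triangles_rotate (fun p => φ (p.2.2, p.1, p.2.1))] at h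
  linarith

/-- The fine edge `(a, b)` lies on the coarse edge `(A, B)` and has the same direction. -/
def SubEdge (F C : Triangulation Ω) (A B a b : Plane) : Prop :=
  A ≠ B ∧ ({A, B} : Finset Plane) ∈ C.faces ∧ a ≠ b ∧ ({a, b} : Finset Plane) ∈ F.faces ∧
    ∃ t u : ℝ, 0 ≤ t ∧ t < u ∧ u ≤ 1 ∧ a = A + t • (B - A) ∧ b = A + u • (B - A)

lemma SubEdge.symm {A B a b : Plane} (h : SubEdge F C A B a b) : SubEdge F C B A b a := by
  obtain ⟨h1, h2, h3, h4, t, u, ht, htu, hu, ha, hb⟩ := h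
  refine ⟨h1.symm, by rwa [Finset.pair_comm], h3.symm, by rwa [Finset.pair_comm], 1 - u, 1 - t,
    by linarith, by linarith, by linarith, ?_, ?_⟩
  · rw [hb]; module
  · rw [ha]; module

lemma SubEdge.openSegment_subset {A B a b : Plane} (h : SubEdge F C A B a b) :
    openSegment ℝ a b ⊆ openSegment ℝ A B := by
  obtain ⟨-, -, -, -, t, u, ht, htu, hu, rfl, rfl⟩ := h
  rintro _ ⟨α, β, hα, hβ, hs, rfl⟩
  obtain rfl : α = 1 - β := by linarith
  refine ⟨1 - ((1 - β) * t + β * u), (1 - β) * t + β * u, ?_, ?_, by ring, ?_⟩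
  · nlinarith
  · nlinarith
  · module

lemma SubEdge.unique {A B A' B' a b : Plane} (h : SubEdge F C A B a b)
    (h' : SubEdge F C A' B' a b) : A' = A ∧ B' = B := by
  have hp := midpoint_mem a b
  obtain ⟨w, hw, hws⟩ := isBary_edge h.1 h.2.1 (h.openSegment_subset hp)
  obtain ⟨w', hw', hws'⟩ := isBary_edge h'.1 h'.2.1 (h'.openSegment_subset hp)
  rw [hw.unique hw', hws'] at hws
  obtain ⟨h1, h2, h3, h4, t, u, ht, htu, hu, ha, hb⟩ := h
  obtain ⟨h1', h2', h3', h4', t', u', ht', htu', hu', ha', hb'⟩ := h'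
  have hA : A' ∈ ({A, B} : Finset Plane) := by rw [← hws]; simp
  have hB : B' ∈ ({A, B} : Finset Plane) := by rw [← hws]; simp
  simp only [Finset.mem_insert, Finset.mem_singleton] at hA hB
  rcases hA with rfl | rfl <;> rcases hB with rfl | rfl
  · exact absurd rfl h1'
  · exact ⟨rfl, rfl⟩
  · exfalso
    have e1 : b - a = (u - t) • (A' - B') := by rw [ha, hb]; module
    have e2 : b - a = (u' - t') • (B' - A') := by rw [ha', hb']; module
    have e3 : ((u - t) + (u' - t')) • (A' - B') = 0 := by
      rw [add_smul, ← e1, e2]; module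
    rcases smul_eq_zero.1 e3 with h | h
    · linarith
    · exact h1' (sub_eq_zero.1 h)
  · exact absurd rfl h1'

lemma SubEdge.apply_sub (h : F.Refines C) {A B a b : Plane} (hs : SubEdge F C A B a b)
    {f g : Plane → ℝ} (hΩ : IsOpen Ω) (hΩc : Convex ℝ Ω)
    (hf : f ∈ C.piecewiseLinear) (hg : g ∈ C.piecewiseLinear) :
    F.jump g a b * (f a - f b) = C.jump g A B * (f A - f B) := by
  have hp := midpoint_mem a b
  obtain ⟨d, d', hd, hd', hj⟩ := exists_jump hΩ hΩc hg hs.1 hs.2.1 (hs.openSegment_subset hp)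
  obtain ⟨h1, h2, h3, h4, t, u, ht, htu, hu, ha, hb⟩ := hs
  have hl : 0 < (u - t)⁻¹ := inv_pos.2 (by linarith)
  have hn := normalVec_smul (A := A) (B := B) (a := a) (b := b) (l := u - t) (by linarith)
    (by rw [ha, hb]; module)
  have hd1 := hd.smul hl
  have hd1' := hd'.smul hl
  rw [smul_neg, ← hn] at hd1'
  rw [← hn] at hd1
  rw [jump_unique hΩ hΩc (h.mem_piecewiseLinear hg) h3 h4 hp hd1 hd1', hj]
  have e : ∀ r : ℝ, 0 ≤ r → r ≤ 1 → f (A + r • (B - A)) = (1 - r) * f A + r * f B := fun r h0 h1' => by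
    rw [← apply_edge hf h1 h2 (α := 1 - r) (β := r) (by linarith) h0 (by ring)]
    congr 1; module
  rw [ha, hb, e t ht (by linarith), e u (by linarith) hu]
  have : u - t ≠ 0 := by linarith
  field_simp
  ring

lemma exists_mem_segment {A B v : Plane} (hv : v ∈ closure Ω) (hAB : A ≠ B)
    (h : ∀ X, X ≠ A → X ≠ B → C.hat X v = 0) :
    ∃ t : ℝ, 0 ≤ t ∧ t ≤ 1 ∧ v = A + t • (B - A) := by
  classical
  obtain ⟨w, hw, hwe⟩ := isBary_hat (T := C) hv
  have hs : w.support ⊆ {A, B} := fun X hX => by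
    by_contra hn
    simp only [Finset.mem_insert, Finset.mem_singleton, not_or] at hn
    rw [Finsupp.mem_support_iff, ← hwe] at hX
    exact hX (h X hn.1 hn.2)
  have h1 := hw.2.2.1
  have h2 := hw.2.2.2
  rw [Finsupp.sum_of_support_subset _ hs _ (by simp), Finset.sum_pair hAB] at h1 h2
  have h3 := hw.2.1 A
  refine ⟨w B, hw.2.1 B, by linarith, ?_⟩
  rw [← h2, show w A = 1 - w B by linarith]
  module

/-- The vertices of the smallest fine face at a point of a coarse edge lie on that edge. -/
lemma Refines.vertices_on_edge (h : F.Refines C) {A B p : Plane} (hAB : A ≠ B)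
    (hf : ({A, B} : Finset Plane) ∈ C.faces) (hp : p ∈ openSegment ℝ A B) {w : Plane →₀ ℝ}
    (hw : F.IsBary p w) {v : Plane} (hv : v ∈ w.support) :
    ∃ t : ℝ, 0 ≤ t ∧ t ≤ 1 ∧ v = A + t • (B - A) := by
  refine exists_mem_segment (C := C) (node_mem_closure (hw.support_subset hv)) hAB
    fun X hXA hXB => ?_
  obtain ⟨w', hw', hs⟩ := isBary_edge hAB hf hp
  have h1 := (h.mem_piecewiseLinear (C.hat_mem X)).2 _ hw.1 w (fun v _ => hw.2.1 v) hw.2.2.1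
  rw [show ∑ v ∈ w.support, w v • v = p from hw.2.2.2, hw'.hat_eq,
    Finsupp.notMem_support_iff.1 (by rw [hs]; simp [hXA, hXB])] at h1
  have h2 := (Finset.sum_eq_zero_iff_of_nonneg fun v _ =>
    mul_nonneg (hw.2.1 v) (hat_nonneg (T := C) X v)).1 h1.symm v hv
  exact (mul_eq_zero.1 h2).resolve_left (Finsupp.mem_support_iff.1 hv)

lemma not_collinear {A D : Plane} {a b c : Plane} (h : F.IsTriangle a b c) {t u r : ℝ}
    (ha : a = A + t • D) (hb : b = A + u • D) (hc : c = A + r • D) : False := by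
  refine h.wedge_ne ?_
  rw [ha, hb, hc]; simp [wedge]; ring

lemma smul_dir_injective {A B : Plane} (hAB : A ≠ B) {t u : ℝ}
    (h : A + t • (B - A) = A + u • (B - A)) : t = u := by
  have h1 := add_left_cancel h
  have : B - A ≠ 0 := sub_ne_zero.2 hAB.symm
  exact smul_left_injective ℝ this h1

lemma exists_successor (hΩ : IsOpen Ω) (hΩc : Convex ℝ Ω) (h : F.Refines C) {A B : Plane}
    (hAB : A ≠ B) (hf : ({A, B} : Finset Plane) ∈ C.faces) {a : Plane} (ha : a ∈ F.nodes) {t : ℝ}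
    (ht : 0 ≤ t) (ht1 : t < 1) (hat : a = A + t • (B - A)) : ∃ b, SubEdge F C A B a b := by
  classical
  have hB : a + (1 - t) • (B - A) = B := by rw [hat]; module
  have hBn : B ∈ C.nodes := mem_nodes_of_face hf (by simp)
  obtain ⟨x, y, z, htri, δ, hδ, hδ', hd⟩ := F.exists_triangle_germ hΩ hΩc (node_mem_closure ha)
    (v := B - A) (ε := 1 - t) (by linarith) (by rw [hB]; exact node_mem_closure hBn)
  obtain ⟨η, hη, hηn⟩ : ∃ η ∈ Ioo 0 δ, a + η • (B - A) ∉ F.nodes := by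
    by_contra hcon
    push Not at hcon
    refine (Ioo_infinite hδ) (Finite.of_finite_image (f := fun η : ℝ => a + η • (B - A))
      (F.nodes.finite_toSet.subset ?_) ?_)
    · rintro _ ⟨η, hη, rfl⟩; exact hcon η hη
    · intro η _ η' _ he
      have := add_left_cancel he
      exact smul_left_injective ℝ (sub_ne_zero.2 hAB.symm) this
  have hpm := hd η ⟨hη.1.le, hη.2.le⟩
  have hpe : a + η • (B - A) = A + (t + η) • (B - A) := by rw [hat]; module
  have hpo : a + η • (B - A) ∈ openSegment ℝ A B :=
    ⟨1 - (t + η), t + η, by linarith [hη.2], by linarith [hη.1], by ring, by rw [hpe]; module⟩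
  rw [htri.closedTri_eq] at hpm
  obtain ⟨w, hw, hws⟩ := exists_isBary_of_mem htri.2.2.2 hpm
  have hon := fun v hv => h.vertices_on_edge hAB hf hpo hw (v := v) hv
  have hax : a ∈ ({x, y, z} : Finset Plane) := by
    have h0 := hd 0 ⟨le_rfl, hδ.le⟩
    rw [zero_smul, add_zero, htri.closedTri_eq] at h0
    have hb : ∃ w, F.IsBary a w ∧ w.support = {a} := by
      obtain ⟨w, hw, hwe⟩ := isBary_hat (T := F) (node_mem_closure ha)
      refine ⟨w, hw, ?_⟩
      ext v
      rw [Finsupp.mem_support_iff, ← hwe, hat_apply_node ha]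
      simp
    obtain ⟨w, hw, hs⟩ := hb
    exact hw.support_subset_of_mem htri.2.2.2 h0 (by rw [hs]; simp)
  have key : ∀ d, a ≠ d → w.support = {a, d} → SubEdge F C A B a d := by
    intro d had hs
    obtain ⟨u, hu0, hu1, hu⟩ := hon d (by rw [hs]; simp)
    have e1 := hw.2.2.1
    have e2 := hw.2.2.2
    rw [Finsupp.sum, hs, Finset.sum_pair had] at e1 e2
    have hd0 : 0 ≤ w d := hw.2.1 d
    rw [hpe, show w a = 1 - w d by linarith] at e2
    have e3 : A + ((1 - w d) * t + w d * u) • (B - A) = A + (t + η) • (B - A) := by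
      rw [← e2]
      generalize w d = r
      rw [hat, hu]; module
    have e4 := smul_dir_injective hAB e3
    have e5 : t < u := by
      by_contra hcon
      nlinarith [hη.1, mul_nonneg hd0 (show 0 ≤ t - u by linarith)]
    exact ⟨hAB, hf, had, by rw [← hs]; exact hw.1, t, u, ht, e5, hu1, hat, hu⟩
  rcases face_cases hw.1 with ⟨c, hc⟩ | ⟨c, d, hcd, hc⟩ | ⟨c, d, e, htr, hc⟩
  · have e1 := hw.2.2.1
    have e2 := hw.2.2.2
    rw [Finsupp.sum, hc, Finset.sum_singleton] at e1 e2
    rw [e1, one_smul] at e2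
    exact absurd (hw.support_subset (by rw [hc]; simp [e2])) hηn
  · obtain ⟨r, -, -, hr⟩ := hon c (by rw [hc]; simp)
    obtain ⟨r', -, -, hr'⟩ := hon d (by rw [hc]; simp)
    rw [hc] at hws
    obtain ⟨e, he, hee⟩ := htri.exists_third hcd hws
    rw [← hee] at hax
    simp only [Finset.mem_insert, Finset.mem_singleton] at hax
    rcases hax with rfl | rfl | rfl
    · exact ⟨d, key d hcd hc⟩
    · exact ⟨c, key c hcd.symm (by rw [hc, Finset.pair_comm])⟩
    · exact (not_collinear he hr hr' hat).elim
  · obtain ⟨r, -, -, hr⟩ := hon c (by rw [hc]; simp)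
    obtain ⟨r', -, -, hr'⟩ := hon d (by rw [hc]; simp)
    obtain ⟨r'', -, -, hr''⟩ := hon e (by rw [hc]; simp)
    exact (not_collinear htr hr hr' hr'').elim

lemma SubEdge.successor_unique {A B a b b' : Plane} (h : SubEdge F C A B a b)
    (h' : SubEdge F C A B a b') : b = b' := by
  obtain ⟨h1, h2, h3, h4, t, u, ht, htu, hu, ha, hb⟩ := h
  obtain ⟨-, -, h3', h4', t', u', ht', htu', hu', ha', hb'⟩ := h'
  obtain rfl : t = t' := smul_dir_injective h1 (ha.symm.trans ha')
  obtain ⟨η, hη, hηu, hηu'⟩ : ∃ η, t < η ∧ η < u ∧ η < u' := by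
    obtain ⟨η, h1, h2⟩ := exists_between (lt_min htu htu')
    exact ⟨η, h1, h2.trans_le (min_le_left _ _), h2.trans_le (min_le_right _ _)⟩
  have key : ∀ c u, t < u → η < u → c = A + u • (B - A) →
      A + η • (B - A) ∈ openSegment ℝ a c := by
    intro c u htu hηu hc
    have hne : u - t ≠ 0 := by linarith
    refine ⟨(u - η) / (u - t), (η - t) / (u - t), div_pos (by linarith) (by linarith),
      div_pos (by linarith) (by linarith), by field_simp; ring, ?_⟩
    rw [ha, hc]
    have e : (u - η) / (u - t) = 1 - (η - t) / (u - t) := by field_simp; ring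
    have e' : (η - t) / (u - t) * (u - t) = η - t := by field_simp
    rw [e]
    have : η = t + (η - t) / (u - t) * (u - t) := by rw [e']; ring
    conv_rhs => rw [this]
    module
  obtain ⟨w, hw, hws⟩ := isBary_edge h3 h4 (key b u htu hηu hb)
  obtain ⟨w', hw', hws'⟩ := isBary_edge h3' h4' (key b' u' htu' hηu' hb')
  rw [hw.unique hw', hws'] at hws
  have : b ∈ ({a, b'} : Finset Plane) := by rw [hws]; simp
  simp only [Finset.mem_insert, Finset.mem_singleton] at this
  exact this.resolve_left h3.symm

open Classical in
lemma sum_subEdge_fst (hΩ : IsOpen Ω) (hΩc : Convex ℝ Ω) (h : F.Refines C) {A B : Plane}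
    (hAB : A ≠ B) (hf : ({A, B} : Finset Plane) ∈ C.faces) (s : Plane → ℝ) :
    (∑ a ∈ F.nodes, ∑ b ∈ F.nodes, if SubEdge F C A B a b then s a else 0) =
      ∑ a ∈ F.nodes.filter (fun a => ∃ t : ℝ, 0 ≤ t ∧ t < 1 ∧ a = A + t • (B - A)), s a := by
  rw [Finset.sum_filter]
  refine Finset.sum_congr rfl fun a ha => ?_
  split_ifs with hex
  · obtain ⟨t, ht, ht1, hat⟩ := hex
    obtain ⟨b, hb⟩ := exists_successor hΩ hΩc h hAB hf ha ht ht1 hat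
    rw [Finset.sum_eq_single b]
    · rw [if_pos hb]
    · intro b' _ hne
      rw [if_neg fun hb' => hne (hb'.successor_unique hb)]
    · intro hn; exact absurd (mem_nodes_of_face hb.2.2.2.1 (by simp)) hn
  · refine Finset.sum_eq_zero fun b _ => if_neg fun hs => hex ?_
    obtain ⟨-, -, -, -, t, u, ht, htu, hu, hat, -⟩ := hs
    exact ⟨t, ht, by linarith, hat⟩

open Classical in
/-- The differences along the fine edges of a coarse edge telescope. -/
lemma sum_subEdge (hΩ : IsOpen Ω) (hΩc : Convex ℝ Ω) (h : F.Refines C) {A B : Plane}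
    (hAB : A ≠ B) (hf : ({A, B} : Finset Plane) ∈ C.faces) (s : Plane → ℝ) :
    (∑ a ∈ F.nodes, ∑ b ∈ F.nodes, if SubEdge F C A B a b then s a - s b else 0) =
      s A - s B := by
  have e : ∀ a b, (if SubEdge F C A B a b then s a - s b else 0) =
      (if SubEdge F C A B a b then s a else 0) - (if SubEdge F C B A b a then s b else 0) := by
    intro a b
    have : SubEdge F C A B a b ↔ SubEdge F C B A b a := ⟨SubEdge.symm, SubEdge.symm⟩
    simp only [← this]
    split_ifs <;> ring
  simp only [e, Finset.sum_sub_distrib]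
  rw [sum_subEdge_fst hΩ hΩc h hAB hf s, Finset.sum_comm,
    sum_subEdge_fst hΩ hΩc h hAB.symm (by rwa [Finset.pair_comm]) s]
  set E := F.nodes.filter (fun a => ∃ t : ℝ, 0 ≤ t ∧ t ≤ 1 ∧ a = A + t • (B - A)) with hE
  have hA : A ∈ E := Finset.mem_filter.2
    ⟨h.nodes_subset (mem_nodes_of_face hf (by simp)), 0, le_rfl, zero_le_one, by simp⟩
  have hB : B ∈ E := Finset.mem_filter.2
    ⟨h.nodes_subset (mem_nodes_of_face hf (by simp)), 1, zero_le_one, le_rfl, by simp⟩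
  have e1 : F.nodes.filter (fun a => ∃ t : ℝ, 0 ≤ t ∧ t < 1 ∧ a = A + t • (B - A)) =
      E.erase B := by
    ext a
    simp only [Finset.mem_filter, Finset.mem_erase, hE]
    constructor
    · rintro ⟨ha, t, ht, ht1, hat⟩
      refine ⟨?_, ha, t, ht, ht1.le, hat⟩
      rintro rfl
      have : A + t • (a - A) = A + (1 : ℝ) • (a - A) := by rw [← hat]; simp
      exact ht1.ne (smul_dir_injective hAB this)
    · rintro ⟨hne, ha, t, ht, ht1, hat⟩
      refine ⟨ha, t, ht, lt_of_le_of_ne ht1 ?_, hat⟩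
      rintro rfl
      exact hne (by rw [hat]; simp)
  have e2 : F.nodes.filter (fun a => ∃ t : ℝ, 0 ≤ t ∧ t < 1 ∧ a = B + t • (A - B)) =
      E.erase A := by
    ext a
    simp only [Finset.mem_filter, Finset.mem_erase, hE]
    constructor
    · rintro ⟨ha, t, ht, ht1, hat⟩
      refine ⟨?_, ha, 1 - t, by linarith, by linarith, by rw [hat]; module⟩
      rintro rfl
      have : B + t • (a - B) = B + (1 : ℝ) • (a - B) := by rw [← hat]; simp
      exact ht1.ne (smul_dir_injective hAB.symm this)
    · rintro ⟨hne, ha, t, ht, ht1, hat⟩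
      refine ⟨ha, 1 - t, by linarith, ?_, by rw [hat]; module⟩
      have : t ≠ 0 := by rintro rfl; exact hne (by rw [hat]; simp)
      have := lt_of_le_of_ne ht (Ne.symm this)
      linarith
  rw [e1, e2]
  have s1 := Finset.add_sum_erase E s hA
  have s2 := Finset.add_sum_erase E s hB
  linarith

/-- A fine edge lies on a coarse edge, or coarse functions have no kink along it. -/
lemma subEdge_or_jump_eq_zero (hΩ : IsOpen Ω) (hΩc : Convex ℝ Ω) (h : F.Refines C) {a b : Plane}
    (hab : a ≠ b) {g : Plane → ℝ} (hg : g ∈ C.piecewiseLinear) :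
    (∃ A B, SubEdge F C A B a b) ∨ F.jump g a b = 0 := by
  by_cases hf : ({a, b} : Finset Plane) ∈ F.faces
  swap
  · exact Or.inr (jump_eq_zero_of_notMem hab hf g)
  have hp := midpoint_mem a b
  obtain ⟨v, hv, hvs⟩ := isBary_edge hab hf hp
  obtain ⟨w, hw, hwe⟩ := isBary_hat (T := C) hv.mem_closure
  have hz : ∀ X, X ∉ w.support → C.hat X a = 0 ∧ C.hat X b = 0 := fun X hX => by
    have h1 := hat_midpoint h hab hf X
    rw [hwe, Finsupp.notMem_support_iff.1 hX] at h1
    have h2 := hat_nonneg (T := C) X a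
    have h3 := hat_nonneg (T := C) X b
    constructor <;> linarith
  have hac : a ∈ closure Ω := node_mem_closure (mem_nodes_of_face hf (by simp))
  have hbc : b ∈ closure Ω := node_mem_closure (mem_nodes_of_face hf (by simp))
  rcases face_cases hw.1 with ⟨c, hc⟩ | ⟨A, B, hAB, hc⟩ | ⟨c, d, e, ht, hc⟩
  · exfalso
    have key : ∀ x ∈ closure Ω, (∀ X, X ∉ w.support → C.hat X x = 0) → x = c := fun x hx h0 => by
      refine hat_eq_one_iff (T := C) ?_
      have hcn : c ∈ C.nodes := mem_nodes_of_face hw.1 (by rw [hc]; simp)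
      rw [← sum_hat (T := C) hx, Finset.sum_eq_single c]
      · intro X _ hX; exact h0 X (by rw [hc]; simpa using hX)
      · intro hn; exact absurd hcn hn
    exact hab ((key a hac fun X hX => (hz X hX).1).trans (key b hbc fun X hX => (hz X hX).2).symm)
  · have hfC : ({A, B} : Finset Plane) ∈ C.faces := by rw [← hc]; exact hw.1
    obtain ⟨t, ht0, ht1, hat⟩ := exists_mem_segment (C := C) hac hAB fun X h1 h2 =>
      (hz X (by rw [hc]; simp [h1, h2])).1
    obtain ⟨u, hu0, hu1, hau⟩ := exists_mem_segment (C := C) hbc hAB fun X h1 h2 =>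
      (hz X (by rw [hc]; simp [h1, h2])).2
    left
    have htu : t ≠ u := by rintro rfl; exact hab (hat.trans hau.symm)
    rcases lt_or_gt_of_ne htu with htu | htu
    · exact ⟨A, B, hAB, hfC, hab, hf, t, u, ht0, htu, hu1, hat, hau⟩
    · have : SubEdge F C A B b a :=
        ⟨hAB, hfC, hab.symm, by rwa [Finset.pair_comm], u, t, hu0, htu, ht1, hau, hat⟩
      exact ⟨B, A, this.symm⟩
  · right
    have hpo := ht.mem_openTri hw hc
    have key : ∀ n : Plane, IsOneSidedDeriv Ω g ((1 / 2 : ℝ) • a + (1 / 2 : ℝ) • b) n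
        ((triAffine c d e g).linear n) := fun n => by
      set p := (1 / 2 : ℝ) • a + (1 / 2 : ℝ) • b
      have hcont : Continuous fun ε : ℝ => p + ε • n := by fun_prop
      have h0 : ∀ᶠ ε in 𝓝 (0 : ℝ), p + ε • n ∈ openTri c d e :=
        hcont.continuousAt.eventually ((isOpen_openTri c d e).mem_nhds (by simpa using hpo))
      obtain ⟨δ, h1, h2 : 0 < δ⟩ := ((h0.filter_mono nhdsWithin_le_nhds).and
        (self_mem_nhdsWithin (a := (0 : ℝ)) (s := Ioi 0))).exists
      refine Or.inl ⟨δ, h2, fun ε hε => ?_⟩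
      have h3 := (convex_openTri c d e).add_smul_sub_mem hpo h1 (t := ε / δ)
        ⟨div_nonneg hε.1 h2.le, (div_le_one h2).2 hε.2⟩
      rw [add_sub_cancel_left, smul_smul, div_mul_cancel₀ _ h2.ne'] at h3
      have h4 := openTri_subset_closedTri _ _ _ h3
      exact ⟨ht.closedTri_subset h4, by
        rw [ht.apply hg h4, ht.apply hg (openTri_subset_closedTri _ _ _ hpo), affine_add_smul]⟩
    rw [jump_unique hΩ hΩc (h.mem_piecewiseLinear hg) hab hf hp (key _) (key _)]
    simp

lemma edgeForm_refine (hΩ : IsOpen Ω) (hΩc : Convex ℝ Ω) (h : F.Refines C) (s : Plane → ℝ)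
    {f g : Plane → ℝ} (hf : f ∈ C.piecewiseLinear) (hg : g ∈ C.piecewiseLinear) :
    F.edgeForm s f g = C.edgeForm s f g := by
  classical
  rw [edgeForm_comm s f g, edgeForm_comm s f g]
  have e1 : ∀ a b, F.jump g a b * ((f a - f b) * (s a - s b)) =
      ∑ A ∈ C.nodes, ∑ B ∈ C.nodes, C.jump g A B * (f A - f B) *
        (if SubEdge F C A B a b then s a - s b else 0) := by
    intro a b
    by_cases hab : a = b
    · subst hab
      rw [Finset.sum_eq_zero fun A _ => Finset.sum_eq_zero fun B _ => by
        rw [if_neg fun hs => hs.2.2.1 rfl, mul_zero]]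
      simp
    by_cases hex : ∃ A B, SubEdge F C A B a b
    · obtain ⟨A, B, hs⟩ := hex
      rw [Finset.sum_eq_single A, Finset.sum_eq_single B, if_pos hs,
        ← hs.apply_sub h hΩ hΩc hf hg, mul_assoc]
      · intro B' _ hne
        rw [if_neg fun hs' => hne (hs.unique hs').2, mul_zero]
      · intro hn; exact absurd (mem_nodes_of_face hs.2.1 (by simp)) hn
      · intro A' _ hne
        exact Finset.sum_eq_zero fun B' _ => by
          rw [if_neg fun hs' => hne (hs.unique hs').1, mul_zero]
      · intro hn; exact absurd (mem_nodes_of_face hs.2.1 (by simp)) hn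
    · rw [(subEdge_or_jump_eq_zero hΩ hΩc h hab hg).resolve_left hex, zero_mul]
      exact (Finset.sum_eq_zero fun A _ => Finset.sum_eq_zero fun B _ => by
        rw [if_neg fun hs => hex ⟨A, B, hs⟩, mul_zero]).symm
  calc F.edgeForm g f s = ∑ a ∈ F.nodes, ∑ b ∈ F.nodes, ∑ A ∈ C.nodes, ∑ B ∈ C.nodes,
        C.jump g A B * (f A - f B) * (if SubEdge F C A B a b then s a - s b else 0) :=
        Finset.sum_congr rfl fun a _ => Finset.sum_congr rfl fun b _ => e1 a b
    _ = ∑ A ∈ C.nodes, ∑ B ∈ C.nodes, ∑ a ∈ F.nodes, ∑ b ∈ F.nodes,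
        C.jump g A B * (f A - f B) * (if SubEdge F C A B a b then s a - s b else 0) := by
        rw [Finset.sum_congr rfl fun k _ => Finset.sum_comm, Finset.sum_comm]
        refine Finset.sum_congr rfl fun m _ => ?_
        rw [Finset.sum_congr rfl fun k _ => Finset.sum_comm, Finset.sum_comm]
    _ = C.edgeForm g f s := by
        refine Finset.sum_congr rfl fun A _ => Finset.sum_congr rfl fun B _ => ?_
        simp only [← Finset.mul_sum]
        by_cases hAB : A = B
        · simp [hAB]
        by_cases hfa : ({A, B} : Finset Plane) ∈ C.faces
        · rw [sum_subEdge hΩ hΩc h hAB hfa, mul_assoc]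
        · rw [jump_eq_zero_of_notMem hAB hfa]; simp

/-- For an interior edge, the form is determined by the hinge formula. -/
lemma edgeForm_hat (s : Plane → ℝ) {i j : Plane} (hij : i ≠ j) (hi : i ∈ C.nodes)
    (hj : j ∈ C.nodes) : C.edgeForm s (C.hat i) (C.hat j) = -2 * C.jump s i j := by
  classical
  have e : ∀ a ∈ C.nodes, ∀ b ∈ C.nodes, C.jump s a b * ((C.hat i a - C.hat i b) *
      (C.hat j a - C.hat j b)) = (if i = a then if j = b then -C.jump s i j else 0 else 0) +
        (if j = a then if i = b then -C.jump s i j else 0 else 0) := by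
    intro a ha b hb
    rw [hat_apply_node ha, hat_apply_node hb, hat_apply_node ha, hat_apply_node hb]
    by_cases h1 : i = a
    · subst h1
      by_cases h2 : j = b
      · subst h2; simp [hij, hij.symm]
      · simp [hij.symm, h2]
    · by_cases h2 : j = a
      · subst h2
        by_cases h3 : i = b
        · subst h3; simp [hij, hij.symm, jump_symm hij.symm]
        · simp [hij, h3]
      · by_cases h3 : i = b
        · subst h3; simp [h1, h2, hij.symm]
        · simp [h1, h2, h3]
  rw [edgeForm, Finset.sum_congr rfl fun a ha => Finset.sum_congr rfl fun b hb => e a ha b hb]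
  simp only [Finset.sum_add_distrib]
  simp [hi, hj]
  ring

lemma coarsenCond_hinge (hΩ : IsOpen Ω) (hΩc : Convex ℝ Ω) (h : F.Refines C)
    (s : F.piecewiseLinear) : coarsenCond F C (F.hinge s) = C.hinge (coarsenInterp F C s) := by
  classical
  ext e
  have hij := e.2.1
  have hi : e.1.1 ∈ C.nodes := mem_nodes_of_face e.2.edge (by simp)
  have hj : e.1.2 ∈ C.nodes := mem_nodes_of_face e.2.edge (by simp)
  set M : Plane → Plane → ℝ := fun k l =>
    if k = l then -∑ m ∈ F.nodes.erase k, F.jump s.1 k m else F.jump s.1 k l with hM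
  have hrow : ∀ k ∈ F.nodes, ∑ l ∈ F.nodes, M k l = 0 := fun k hk => by
    have e : ∑ l ∈ F.nodes.erase k, M k l = ∑ l ∈ F.nodes.erase k, F.jump s.1 k l :=
      Finset.sum_congr rfl fun l hl => if_neg (Finset.ne_of_mem_erase hl).symm
    rw [← Finset.add_sum_erase _ _ hk, e]
    simp [hM]
  rw [coarsenCond_eq_of_matrix hΩ hΩc h (M := M) hrow ?_ ?_, sum_mul_eq_of_row hrow]
  · have h1 : ∑ k ∈ F.nodes, ∑ l ∈ F.nodes, C.hat e.1.1 k * (C.hat e.1.2 l - C.hat e.1.2 k) *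
        M k l = ∑ k ∈ F.nodes, ∑ l ∈ F.nodes,
          F.jump s.1 k l * (C.hat e.1.1 k * (C.hat e.1.2 l - C.hat e.1.2 k)) := by
      refine Finset.sum_congr rfl fun k _ => Finset.sum_congr rfl fun l _ => ?_
      by_cases hkl : k = l
      · simp [hkl]
      · simp only [hM, if_neg hkl]; ring
    have h2 : ∑ k ∈ F.nodes, ∑ l ∈ F.nodes,
          F.jump s.1 k l * (C.hat e.1.1 k * (C.hat e.1.2 l - C.hat e.1.2 k)) =
        ∑ k ∈ F.nodes, ∑ l ∈ F.nodes,
          F.jump s.1 k l * (C.hat e.1.1 l * (C.hat e.1.2 k - C.hat e.1.2 l)) := by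
      rw [Finset.sum_comm]
      refine Finset.sum_congr rfl fun k _ => Finset.sum_congr rfl fun l _ => ?_
      by_cases hkl : k = l
      · simp [hkl]
      · rw [jump_symm hkl]
    have h3 : F.edgeForm s.1 (C.hat e.1.1) (C.hat e.1.2) = -(∑ k ∈ F.nodes, ∑ l ∈ F.nodes,
          F.jump s.1 k l * (C.hat e.1.1 k * (C.hat e.1.2 l - C.hat e.1.2 k)) +
        ∑ k ∈ F.nodes, ∑ l ∈ F.nodes,
          F.jump s.1 k l * (C.hat e.1.1 l * (C.hat e.1.2 k - C.hat e.1.2 l))) := by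
      simp only [edgeForm, ← Finset.sum_add_distrib, ← Finset.sum_neg_distrib]
      exact Finset.sum_congr rfl fun k _ => Finset.sum_congr rfl fun l _ => by ring
    rw [← h2, edgeForm_refine hΩ hΩc h s.1 (C.hat_mem _) (C.hat_mem _),
      edgeForm_hat s.1 hij hi hj] at h3
    rw [h1, hinge_apply, coarsenInterp_eq,
      jump_congr (s' := s.1) (fun k hk => interp_apply_node _ hk) hij]
    linarith
  · intro k _ l _ hkl hf
    simp only [hM, if_neg hkl]
    exact jump_eq_zero_of_notMem hkl hf _
  · intro e'
    simp only [hM, if_neg e'.2.1]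
    exact F.hinge_apply s e'

end Triangulation

end GeomHom

end

noncomputable section

namespace GeomHom

/-! ### Locally affine functions -/

/-- `f` agrees with an affine function near `x`. -/
def LocallyAffineAt (f : Plane → ℝ) (x : Plane) : Prop :=
  ∃ A : Plane →ᵃ[ℝ] ℝ, ∀ᶠ y in 𝓝 x, f y = A y

lemma LocallyAffineAt.add {f g : Plane → ℝ} {x : Plane} (hf : LocallyAffineAt f x)
    (hg : LocallyAffineAt g x) : LocallyAffineAt (fun y => f y + g y) x := by
  obtain ⟨A, hA⟩ := hf
  obtain ⟨B, hB⟩ := hg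
  refine ⟨A + B, ?_⟩
  filter_upwards [hA, hB] with y h1 h2
  simp [h1, h2]

lemma LocallyAffineAt.const_mul {f : Plane → ℝ} {x : Plane} (hf : LocallyAffineAt f x) (c : ℝ) :
    LocallyAffineAt (fun y => c * f y) x := by
  obtain ⟨A, hA⟩ := hf
  refine ⟨c • A, ?_⟩
  filter_upwards [hA] with y h1
  simp [h1]

lemma LocallyAffineAt.sum {ι : Type*} {s : Finset ι} {f : ι → Plane → ℝ} {x : Plane}
    (hf : ∀ i ∈ s, LocallyAffineAt (f i) x) : LocallyAffineAt (fun y => ∑ i ∈ s, f i y) x := by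
  classical
  induction s using Finset.induction_on with
  | empty => exact ⟨0, by simp⟩
  | insert i s hi ih =>
    simp only [Finset.sum_insert hi]
    exact (hf i (by simp)).add (ih fun j hj => hf j (by simp [hj]))

lemma LocallyAffineAt.congr {f g : Plane → ℝ} {x : Plane} (hf : LocallyAffineAt f x)
    (h : ∀ᶠ y in 𝓝 x, g y = f y) : LocallyAffineAt g x := by
  obtain ⟨A, hA⟩ := hf
  exact ⟨A, by filter_upwards [hA, h] with y h1 h2; rw [h2, h1]⟩

lemma affine_eq_of_eventuallyEq {A B : Plane →ᵃ[ℝ] ℝ} {x : Plane} (h : ∀ᶠ y in 𝓝 x, A y = B y) :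
    A = B := by
  have hx : A x = B x := h.self_of_nhds
  ext y
  have hc : Continuous fun ε : ℝ => x + ε • (y - x) := by fun_prop
  have h0 : ∀ᶠ ε in 𝓝 (0 : ℝ), A (x + ε • (y - x)) = B (x + ε • (y - x)) :=
    (hc.tendsto' 0 x (by simp)).eventually h
  obtain ⟨ε, h1, h2 : 0 < ε⟩ := ((h0.filter_mono nhdsWithin_le_nhds).and
    (self_mem_nhdsWithin (a := (0 : ℝ)) (s := Ioi 0))).exists
  rw [affine_add_smul, affine_add_smul, hx] at h1
  have h3 := mul_left_cancel₀ h2.ne' (add_left_cancel h1)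
  have h4 := affine_sub A y x
  have h5 := affine_sub B y x
  rw [h3, ← h5, hx] at h4
  linarith

lemma exists_affine_of_locallyAffine {f : Plane → ℝ} {U : Set Plane} (hU : IsPreconnected U)
    (h : ∀ x ∈ U, LocallyAffineAt f x) : ∃ A : Plane →ᵃ[ℝ] ℝ, ∀ x ∈ U, f x = A x := by
  rcases U.eq_empty_or_nonempty with rfl | ⟨x₀, hx₀⟩
  · exact ⟨0, by simp⟩
  obtain ⟨A, hA⟩ := h x₀ hx₀
  refine ⟨A, fun x hx => ?_⟩
  set V : (Plane →ᵃ[ℝ] ℝ) → Set Plane := fun B => {x | ∀ᶠ y in 𝓝 x, f y = B y} with hV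
  have ho : ∀ B, IsOpen (V B) := fun B => isOpen_setOfPred_eventually_nhds
  have hsub : U ⊆ V A := by
    refine hU.subset_left_of_subset_union (ho A)
      (isOpen_biUnion fun B (_ : B ∈ {B | B ≠ A}) => ho B) ?_ ?_ ⟨x₀, hx₀, hA⟩
    · rw [disjoint_iUnion₂_right]
      refine fun B hB => disjoint_left.2 fun y hy hy' => hB ?_
      refine affine_eq_of_eventuallyEq (x := y) ?_
      filter_upwards [hy, hy'] with z h1 h2
      rw [← h1, ← h2]
    · intro y hy
      obtain ⟨B, hB⟩ := h y hy
      by_cases hBA : B = A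
      · subst hBA; exact Or.inl hB
      · refine Or.inr ?_
        simp only [mem_iUnion]
        exact ⟨B, hBA, hB⟩
  exact (hsub hx).self_of_nhds

/-! ### Points in general position -/

lemma exists_generic (L : Finset (Plane × Plane)) (hL : ∀ l ∈ L, l.1 ≠ l.2) {U : Set Plane}
    (hU : IsOpen U) (hne : U.Nonempty) :
    ∃ z ∈ U, ∀ l ∈ L, wedge (l.2 - l.1) (z - l.1) ≠ 0 := by
  classical
  induction L using Finset.induction_on generalizing U with
  | empty => obtain ⟨z, hz⟩ := hne; exact ⟨z, hz, by simp⟩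
  | insert l L hl ih =>
    have hc : Continuous fun z : Plane => wedge (l.2 - l.1) (z - l.1) :=
      continuous_wedge (by fun_prop) (by fun_prop)
    obtain ⟨z, ⟨hz, hz1⟩, hz2⟩ := ih (fun l hl => hL l (by simp [hl]))
      (U := U ∩ {z | wedge (l.2 - l.1) (z - l.1) ≠ 0})
      (hU.inter (isOpen_ne_fun hc continuous_const)) (by
        obtain ⟨z, hz⟩ := hne
        by_cases h : wedge (l.2 - l.1) (z - l.1) = 0
        swap
        · exact ⟨z, hz, h⟩
        have hc' : Continuous fun ε : ℝ => z + ε • normalVec l.1 l.2 := by fun_prop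
        obtain ⟨ε, h1, h2 : 0 < ε⟩ := (((hc'.tendsto' 0 z (by simp)).eventually
          (hU.mem_nhds hz)).filter_mono nhdsWithin_le_nhds |>.and
            (self_mem_nhdsWithin (a := (0 : ℝ)) (s := Ioi 0))).exists
        refine ⟨_, h1, ?_⟩
        have h3 := wedge_normalVec (hL l (by simp))
        have : wedge (l.2 - l.1) (z + ε • normalVec l.1 l.2 - l.1) = ε := by
          simp only [wedge, PiLp.sub_apply, PiLp.add_apply, PiLp.smul_apply, smul_eq_mul] at h h3 ⊢
          linear_combination h + ε * h3
        simp only [mem_ofPred_eq, this]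
        exact h2.ne')
    refine ⟨z, hz, fun l' hl' => ?_⟩
    rcases Finset.mem_insert.1 hl' with rfl | h
    · exact hz1
    · exact hz2 l' h

lemma isPreconnected_diff_finset {U : Set Plane} (hU : IsOpen U) (hc : Convex ℝ U)
    (N : Finset Plane) : IsPreconnected (U \ N) := by
  classical
  refine isPreconnected_of_forall_pair fun x hx y hy => ?_
  obtain ⟨z, hz, hzl⟩ := exists_generic
    (N.image (fun v => (x, v)) ∪ N.image (fun v => (y, v)))
    (by
      intro l hl
      simp only [Finset.mem_union, Finset.mem_image] at hl
      rcases hl with ⟨v, hv, rfl⟩ | ⟨v, hv, rfl⟩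
      · exact fun he => hx.2 (by rw [show x = v from he]; exact hv)
      · exact fun he => hy.2 (by rw [show y = v from he]; exact hv)) hU ⟨x, hx.1⟩
  have key : ∀ x ∈ U, (∀ v ∈ N, wedge (v - x) (z - x) ≠ 0) → segment ℝ x z ⊆ U \ N := by
    intro x hx h w hw
    refine ⟨hc.segment_subset hx hz hw, fun hwN => h w hwN ?_⟩
    obtain ⟨α, β, -, -, hs, rfl⟩ := hw
    obtain rfl : α = 1 - β := by linarith
    simp [wedge]; ring
  refine ⟨segment ℝ x z ∪ segment ℝ y z, union_subset
    (key x hx.1 fun v hv => hzl (x, v) (by simp [hv]))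
    (key y hy.1 fun v hv => hzl (y, v) (by simp [hv])),
    Or.inl (left_mem_segment ℝ _ _), Or.inr (left_mem_segment ℝ _ _), ?_⟩
  exact IsPreconnected.union z (right_mem_segment ℝ _ _) (right_mem_segment ℝ _ _)
    (convex_segment _ _).isPreconnected (convex_segment _ _).isPreconnected

namespace Triangulation

variable {Ω : Set Plane} {T : Triangulation Ω}

/-- Near a point of an interior edge, a piecewise linear function is affine up to a kink. -/
lemma IsInteriorEdge.local_form {a b : Plane} (h : T.IsInteriorEdge a b) {g : Plane → ℝ}
    (hg : g ∈ T.piecewiseLinear) {x : Plane} (hx : x ∈ openSegment ℝ a b) :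
    LocallyAffineAt (fun y => g y - T.jump g a b * max 0 (wedge (b - a) (y - a))) x := by
  obtain ⟨c, c', hc, hc', h1, h2⟩ := h.exists_opposite
  have hcc : c ≠ c' := by rintro rfl; linarith
  have hopp : T.opposite a b = {c, c'} := by
    refine (Finset.eq_of_subset_of_card_le ?_ ?_).symm
    · intro d; simp only [Finset.mem_insert, Finset.mem_singleton]
      rintro (rfl | rfl)
      · exact (mem_opposite h.1).2 hc
      · exact (mem_opposite h.1).2 hc'
    · rw [h.2, Finset.card_pair hcc]
  have hj : T.jump g a b = (triAffine a b c g).linear (normalVec a b) -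
      (triAffine a b c' g).linear (normalVec a b) := by
    rw [jump, hopp, Finset.sum_pair hcc, hc.linear_normal, hc'.linear_normal, abs_of_pos h1,
      abs_of_neg h2, div_self h1.ne', div_neg, div_self h2.ne]
    ring
  have key : ∀ y, triAffine a b c g y = triAffine a b c' g y +
      T.jump g a b * wedge (b - a) (y - a) := by
    intro y
    have e1 := affine_sub (triAffine a b c g) y a
    have e2 := affine_sub (triAffine a b c' g) y a
    have e3 := affine_sub (triAffine a b c g) b a
    have e4 := affine_sub (triAffine a b c' g) b a
    rw [normal_decomp h.1 y, map_add, map_smul, map_smul, ← e3, hc.triAffine_mid,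
      hc.triAffine_left] at e1
    rw [normal_decomp h.1 y, map_add, map_smul, map_smul, ← e4, hc'.triAffine_mid,
      hc'.triAffine_left] at e2
    simp only [smul_eq_mul] at e1 e2
    rw [hj]
    linarith
  have hnear : ∀ d, T.IsTriangle a b d → ∀ᶠ y in 𝓝 x,
      0 ≤ wedge (b - a) (y - a) / wedge (b - a) (d - a) → y ∈ closedTri a b d := by
    intro d hd
    obtain ⟨α, β, hα, hβ, hs, rfl⟩ := hx
    have e1 := (continuous_baryCoord a b d).continuousAt.eventually_const_lt
      (show 0 < baryCoord a b d (α • a + β • b) by rwa [hd.baryCoord_segment_left hs])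
    have e2 := (continuous_baryCoord b d a).continuousAt.eventually_const_lt
      (show 0 < baryCoord b d a (α • a + β • b) by rwa [hd.baryCoord_segment_mid hs])
    filter_upwards [e1, e2] with y h1 h2 h3
    refine ⟨h1.le, h2.le, ?_⟩
    rw [baryCoord, wedge_cycle' a b d]
    convert h3 using 2
    simp [wedge]; ring
  refine ⟨triAffine a b c' g, ?_⟩
  filter_upwards [hnear c hc, hnear c' hc'] with y e1 e2
  rcases le_total 0 (wedge (b - a) (y - a)) with h3 | h3
  · rw [max_eq_right h3, hc.apply hg (e1 (div_nonneg h3 h1.le)), key]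
    ring
  · rw [max_eq_left h3, hc'.apply hg (e2 (div_nonneg_of_nonpos h3 h2.le))]
    ring

lemma cases_of_mem {x : Plane} (hx : x ∈ closure Ω) (hn : x ∉ T.nodes) :
    (∃ a b c, T.IsTriangle a b c ∧ x ∈ openTri a b c) ∨
      ∃ a b, a ≠ b ∧ ({a, b} : Finset Plane) ∈ T.faces ∧ x ∈ openSegment ℝ a b := by
  obtain ⟨w, hw⟩ := exists_isBary_of_closure (T := T) hx
  have e1 := hw.2.2.1
  have e2 := hw.2.2.2
  have hpos : ∀ v ∈ w.support, 0 < w v := fun v hv =>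
    lt_of_le_of_ne (hw.2.1 v) (Finsupp.mem_support_iff.1 hv).symm
  rcases face_cases hw.1 with ⟨a, ha⟩ | ⟨a, b, hab, hs⟩ | ⟨a, b, c, h, habc⟩
  · rw [Finsupp.sum, ha, Finset.sum_singleton] at e1 e2
    rw [e1, one_smul] at e2
    exact absurd (hw.support_subset (by rw [ha]; simp [e2])) hn
  · rw [Finsupp.sum, hs, Finset.sum_pair hab] at e1 e2
    exact Or.inr ⟨a, b, hab, by rw [← hs]; exact hw.1, w a, w b, hpos a (by rw [hs]; simp),
      hpos b (by rw [hs]; simp), e1, e2⟩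
  · exact Or.inl ⟨a, b, c, h, h.mem_openTri hw habc⟩

/-- A piecewise linear function without kinks is affine. -/
lemma affine_of_jump_eq_zero (hΩ : IsOpen Ω) (hΩc : Convex ℝ Ω) {g : Plane → ℝ}
    (hg : g ∈ T.piecewiseLinear) (h : ∀ a b, T.IsInteriorEdge a b → T.jump g a b = 0) :
    ∃ A : Plane →ᵃ[ℝ] ℝ, ∀ x ∈ closure Ω, g x = A x := by
  obtain ⟨A, hA⟩ := exists_affine_of_locallyAffine (isPreconnected_diff_finset hΩ hΩc T.nodes)
    (f := g) (fun x hx => by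
      rcases cases_of_mem (subset_closure hx.1) hx.2 with ⟨a, b, c, ht, hm⟩ | ⟨a, b, hab, hf, hm⟩
      · refine ⟨triAffine a b c g, ?_⟩
        filter_upwards [(isOpen_openTri a b c).mem_nhds hm] with y hy
        exact ht.apply hg (openTri_subset_closedTri _ _ _ hy)
      · have hi := isInteriorEdge_of_mem hΩ hΩc hab hf hm hx.1
        have := hi.local_form hg hm
        rw [h a b hi] at this
        simpa using this)
  refine ⟨A, ?_⟩
  have hd : Ω ⊆ closure (Ω ∩ (T.nodes : Set Plane)ᶜ) :=
    (T.nodes.finite_toSet.countable.dense_compl ℝ).open_subset_closure_inter hΩ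
  refine EqOn.of_subset_closure (s := Ω \ T.nodes) hA (continuousOn_of_mem hΩ hg)
    (AffineMap.continuous_of_finiteDimensional A).continuousOn
    (sdiff_subset.trans subset_closure) ?_
  exact closure_minimal hd isClosed_closure

lemma jump_affine (A : Plane →ᵃ[ℝ] ℝ) {a b : Plane} (h : T.IsInteriorEdge a b) :
    T.jump A a b = 0 := by
  obtain ⟨c, c', hc, hc', h1, h2⟩ := h.exists_opposite
  have hcc : c ≠ c' := by rintro rfl; linarith
  have hopp : T.opposite a b = {c, c'} := by
    refine (Finset.eq_of_subset_of_card_le ?_ ?_).symm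
    · intro d; simp only [Finset.mem_insert, Finset.mem_singleton]
      rintro (rfl | rfl)
      · exact (mem_opposite h.1).2 hc
      · exact (mem_opposite h.1).2 hc'
    · rw [h.2, Finset.card_pair hcc]
  have key : ∀ d, hingeTerm a b d A = wedge (b - a) (d - a) / |wedge (b - a) (d - a)| *
      A.linear (normalVec a b) := by
    intro d
    have e1 := affine_sub A d a
    have e2 := affine_sub A b a
    rw [normal_decomp h.1 d, map_add, map_smul, map_smul, ← e2] at e1
    simp only [smul_eq_mul] at e1
    rw [hingeTerm, e1]; ring
  rw [jump, hopp, Finset.sum_pair hcc, key, key, abs_of_pos h1, abs_of_neg h2, div_self h1.ne',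
    div_neg, div_self h2.ne]
  ring

lemma hinge_eq_iff (hΩ : IsOpen Ω) (hΩc : Convex ℝ Ω) (s s' : T.piecewiseLinear) :
    T.hinge s' = T.hinge s ↔ ∃ A : Plane →ᵃ[ℝ] ℝ, ∀ x ∈ closure Ω, s'.1 x - s.1 x = A x := by
  rw [← sub_eq_zero, ← map_sub]
  constructor
  · intro h
    refine affine_of_jump_eq_zero hΩ hΩc (s' - s).2 fun a b hab => ?_
    have := congrFun h ⟨(a, b), hab⟩
    rwa [hinge_apply] at this
  · rintro ⟨A, hA⟩
    ext e
    rw [hinge_apply, jump_congr (s := (s' - s : T.piecewiseLinear).1) (s' := A)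
      (fun k hk => hA k (node_mem_closure hk)) e.2.1]
    exact jump_affine A e.2

end Triangulation

end GeomHom

end

noncomputable section

namespace GeomHom

namespace Triangulation

variable {Ω : Set Plane} {T : Triangulation Ω}

/-- The sign of `(v - p) ∧ (w - p)`. -/
def orient (p v w : Plane) : ℝ := if 0 < wedge (v - p) (w - p) then 1 else -1

/-- The indicator of the half-plane to the left of the ray from `p` through `v`. -/
def leftOf (p v x : Plane) : ℝ := if 0 ≤ wedge (v - p) (x - p) then 1 else 0

/-- The kink function of the edge `v, w`, vanishing on the side of `p`, with the orientation as
sign. -/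
def kink (p v w x : Plane) : ℝ :=
  orient p v w * max 0 (orient p v w * wedge (x - v) (w - v))

/-- The integral of edge stresses along the rays from `p`. -/
def maxwellLift (T : Triangulation Ω) (q : Plane → Plane → ℝ) (p x : Plane) : ℝ :=
  ∑ v ∈ T.nodes, leftOf p v x * ∑ w ∈ T.nodes, q v w * kink p v w x

lemma orient_sq (p v w : Plane) : orient p v w * orient p v w = 1 := by
  unfold orient; split_ifs <;> norm_num

lemma orient_mul_pos {p v w : Plane} (h : wedge (v - p) (w - p) ≠ 0) :
    0 < orient p v w * wedge (v - p) (w - p) := by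
  unfold orient
  split_ifs with h1
  · linarith
  · have := lt_of_le_of_ne (not_lt.1 h1) h; linarith

lemma orient_swap {p v w : Plane} (h : wedge (v - p) (w - p) ≠ 0) :
    orient p w v = -orient p v w := by
  have e : wedge (w - p) (v - p) = -wedge (v - p) (w - p) := by simp [wedge]; ring
  unfold orient
  rw [e]
  rcases lt_or_gt_of_ne h with h1 | h1
  · rw [if_pos (by linarith), if_neg (by linarith)]; ring
  · rw [if_neg (by linarith), if_pos h1]

lemma kink_swap {p v w : Plane} (h : wedge (v - p) (w - p) ≠ 0) (x : Plane) :
    kink p w v x = -kink p v w x := by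
  have e : wedge (x - w) (v - w) = -wedge (x - v) (w - v) := by simp [wedge]; ring
  rw [kink, kink, orient_swap h, e]; ring_nf

lemma continuous_kink (p v w : Plane) : Continuous (kink p v w) :=
  continuous_const.mul (continuous_const.max (continuous_const.mul
    (continuous_wedge (by fun_prop) (by fun_prop))))

lemma continuous_wedge_right (u v : Plane) : Continuous fun x : Plane => wedge u (x - v) :=
  continuous_wedge continuous_const (by fun_prop)

lemma leftOf_eventually_eq {p v x : Plane} (h : wedge (v - p) (x - p) ≠ 0) :
    ∀ᶠ y in 𝓝 x, leftOf p v y = leftOf p v x := by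
  have hc := (continuous_wedge_right (v - p) p).continuousAt (x := x)
  rcases lt_or_gt_of_ne h with h1 | h1
  · filter_upwards [hc.eventually_lt_const h1] with y hy
    rw [leftOf, leftOf, if_neg (by linarith), if_neg (by linarith)]
  · filter_upwards [hc.eventually_const_lt h1] with y hy
    rw [leftOf, leftOf, if_pos hy.le, if_pos h1.le]

lemma eq_on_line {p v x : Plane} (hv : v ≠ p) (h : wedge (v - p) (x - p) = 0) :
    ∃ μ : ℝ, x = p + μ • (v - p) := by
  have h1 := (sqLen_pos (sub_ne_zero.2 hv)).ne'
  have h2 := normal_decomp hv.symm x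
  rw [h, zero_smul, add_zero] at h2
  exact ⟨_, by rw [← h2]; abel⟩

section Lift

variable {q : Plane → Plane → ℝ} {p : Plane}

/-- On the line through `p` and a node, off that node, the coefficient of the half-plane function
of the node vanishes. -/
lemma coefficient_eventually_zero (hΩc : Convex ℝ Ω)
    (hq0 : ∀ v w, ¬T.IsInteriorEdge v w → q v w = 0)
    (heq : ∀ v ∈ T.nodes, v ∈ Ω → ∑ w ∈ T.nodes, q v w • (w - v) = 0)
    (hp : p ∈ Ω) (hgen : ∀ v ∈ T.nodes, ∀ w ∈ T.nodes, v ≠ w → wedge (v - p) (w - p) ≠ 0)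
    {v x : Plane} (hv : v ∈ T.nodes) (hvp : v ≠ p) (hx : x ∈ Ω) (hxv : x ≠ v)
    (hw : wedge (v - p) (x - p) = 0) :
    ∀ᶠ y in 𝓝 x, ∑ w ∈ T.nodes, q v w * kink p v w y = 0 := by
  obtain ⟨μ, hμ⟩ := eq_on_line hvp hw
  have hval : ∀ w, wedge (x - v) (w - v) = (μ - 1) * wedge (v - p) (w - p) := fun w => by
    rw [hμ]; simp [wedge]; ring
  have hc : ∀ w, Continuous fun y : Plane => orient p v w * wedge (y - v) (w - v) := fun w =>
    continuous_const.mul (continuous_wedge (by fun_prop) (by fun_prop))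
  rcases lt_trichotomy μ 1 with h1 | h1 | h1
  · have key : ∀ᶠ y in 𝓝 x, ∀ w ∈ T.nodes, q v w * kink p v w y = 0 := by
      rw [eventually_all_finset]
      intro w hwn
      by_cases hvw : v = w
      · exact Eventually.of_forall fun y => by rw [hq0 v w (fun h => h.1 hvw), zero_mul]
      · have h2 : orient p v w * wedge (x - v) (w - v) < 0 := by
          rw [hval]; nlinarith [orient_mul_pos (hgen v hv w hwn hvw)]
        filter_upwards [(hc w).continuousAt.eventually_lt_const h2] with y hy
        rw [kink, max_eq_left hy.le]; ring
    filter_upwards [key] with y hy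
    exact Finset.sum_eq_zero hy
  · exact absurd (by rw [hμ, h1]; simp) hxv
  · have hvΩ : v ∈ Ω := by
      have hne : μ ≠ 0 := by linarith
      have := hΩc hp hx (a := 1 - μ⁻¹) (b := μ⁻¹) (by
        have := inv_le_one_of_one_le₀ h1.le; linarith) (by positivity) (by ring)
      convert this using 1
      rw [hμ, smul_add, smul_smul, inv_mul_cancel₀ hne]
      module
    have key : ∀ᶠ y in 𝓝 x, ∀ w ∈ T.nodes, q v w * kink p v w y =
        wedge (y - v) (q v w • (w - v)) := by
      rw [eventually_all_finset]
      intro w hwn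
      by_cases hvw : v = w
      · exact Eventually.of_forall fun y => by
          rw [hq0 v w (fun h => h.1 hvw)]; simp [wedge]
      · have h2 : 0 < orient p v w * wedge (x - v) (w - v) := by
          rw [hval]; nlinarith [orient_mul_pos (hgen v hv w hwn hvw)]
        filter_upwards [(hc w).continuousAt.eventually_const_lt h2] with y hy
        rw [kink, max_eq_right hy.le, ← mul_assoc (orient p v w), orient_sq, one_mul]
        simp [wedge]; ring
    filter_upwards [key] with y hy
    rw [Finset.sum_congr rfl hy]
    have h3 : ∑ w ∈ T.nodes, wedge (y - v) (q v w • (w - v)) =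
        wedge (y - v) (∑ w ∈ T.nodes, q v w • (w - v)) := by
      simp [wedge, Finset.mul_sum, Finset.sum_sub_distrib]
    rw [h3, heq v hv hvΩ]
    simp [wedge]

lemma maxwellLift_continuousAt
    (hgen : ∀ v ∈ T.nodes, ∀ w ∈ T.nodes, v ≠ w → wedge (v - p) (w - p) ≠ 0)
    {x : Plane} (hx : x ∈ T.nodes) : ContinuousAt (T.maxwellLift q p) x := by
  have hcont : ∀ v, Continuous fun y => ∑ w ∈ T.nodes, q v w * kink p v w y := fun v =>
    continuous_finsetSum _ fun w _ => continuous_const.mul (continuous_kink p v w)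
  refine tendsto_finsetSum _ fun v hv => ?_
  by_cases hvx : v = x
  · subst hvx
    have h0 : ∑ w ∈ T.nodes, q v w * kink p v w v = 0 :=
      Finset.sum_eq_zero fun w _ => by simp [kink, wedge]
    rw [h0, mul_zero]
    refine squeeze_zero_norm (a := fun y => ‖∑ w ∈ T.nodes, q v w * kink p v w y‖) (fun y => ?_) ?_
    · rw [norm_mul]
      refine mul_le_of_le_one_left (norm_nonneg _) ?_
      unfold leftOf; split_ifs <;> simp
    · have := (hcont v).norm.tendsto v
      rwa [h0, norm_zero] at this
  · refine Tendsto.mul ?_ (hcont v).continuousAt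
    exact tendsto_const_nhds.congr' (by
      filter_upwards [leftOf_eventually_eq (hgen v hv x hx hvx)] with y hy using hy.symm)

open Classical in
/-- The lift is affine near each point that is not a node, up to the kink of the edge through the
point. -/
lemma maxwellLift_local (hΩc : Convex ℝ Ω)
    (hq0 : ∀ v w, ¬T.IsInteriorEdge v w → q v w = 0) (hqs : ∀ v w, q v w = q w v)
    (heq : ∀ v ∈ T.nodes, v ∈ Ω → ∑ w ∈ T.nodes, q v w • (w - v) = 0)
    (hp : p ∈ Ω) (hpn : p ∉ T.nodes)
    (hgen : ∀ v ∈ T.nodes, ∀ w ∈ T.nodes, v ≠ w → wedge (v - p) (w - p) ≠ 0)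
    {x : Plane} (hx : x ∈ Ω) (hxn : x ∉ T.nodes) :
    LocallyAffineAt (fun y => T.maxwellLift q p y - 1 / 2 * ∑ v ∈ T.nodes, ∑ w ∈ T.nodes,
      if x ∈ openSegment ℝ v w then
        q v w * max 0 (orient p v w * wedge (y - v) (w - v)) else 0) x := by
  have e1 : ∀ᶠ y in 𝓝 x, T.maxwellLift q p y =
      ∑ v ∈ T.nodes, leftOf p v x * ∑ w ∈ T.nodes, q v w * kink p v w y := by
    have key : ∀ᶠ y in 𝓝 x, ∀ v ∈ T.nodes,
        leftOf p v y * ∑ w ∈ T.nodes, q v w * kink p v w y =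
          leftOf p v x * ∑ w ∈ T.nodes, q v w * kink p v w y := by
      rw [eventually_all_finset]
      intro v hv
      by_cases h : wedge (v - p) (x - p) = 0
      · filter_upwards [coefficient_eventually_zero hΩc hq0 heq hp hgen hv
          (fun h => hpn (h ▸ hv)) hx (fun h => hxn (h ▸ hv)) h] with y hy
        rw [hy, mul_zero, mul_zero]
      · filter_upwards [leftOf_eventually_eq h] with y hy
        rw [hy]
    filter_upwards [key] with y hy
    exact Finset.sum_congr rfl hy
  have e2 : ∀ y, ∑ v ∈ T.nodes, leftOf p v x * ∑ w ∈ T.nodes, q v w * kink p v w y =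
      1 / 2 * ∑ v ∈ T.nodes, ∑ w ∈ T.nodes,
        q v w * ((leftOf p v x - leftOf p w x) * kink p v w y) := by
    intro y
    have h1 : ∑ v ∈ T.nodes, leftOf p v x * ∑ w ∈ T.nodes, q v w * kink p v w y =
        ∑ v ∈ T.nodes, ∑ w ∈ T.nodes, q v w * (leftOf p v x * kink p v w y) := by
      refine Finset.sum_congr rfl fun v _ => ?_
      rw [Finset.mul_sum]
      exact Finset.sum_congr rfl fun w _ => by ring
    have h2 : ∑ v ∈ T.nodes, ∑ w ∈ T.nodes, q v w * (leftOf p v x * kink p v w y) =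
        ∑ v ∈ T.nodes, ∑ w ∈ T.nodes, q v w * (-leftOf p w x * kink p v w y) := by
      rw [Finset.sum_comm]
      refine Finset.sum_congr rfl fun v hv => Finset.sum_congr rfl fun w hw => ?_
      by_cases hvw : v = w
      · rw [hq0 w v (fun h => h.1 hvw.symm), hq0 v w (fun h => h.1 hvw)]; ring
      · rw [hqs w v, kink_swap (hgen v hv w hw hvw)]; ring
    have h3 : ∑ v ∈ T.nodes, ∑ w ∈ T.nodes,
        q v w * ((leftOf p v x - leftOf p w x) * kink p v w y) =
        ∑ v ∈ T.nodes, ∑ w ∈ T.nodes, q v w * (leftOf p v x * kink p v w y) +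
        ∑ v ∈ T.nodes, ∑ w ∈ T.nodes, q v w * (-leftOf p w x * kink p v w y) := by
      simp only [← Finset.sum_add_distrib]
      exact Finset.sum_congr rfl fun v _ => Finset.sum_congr rfl fun w _ => by ring
    rw [h3, ← h2, h1]; ring
  have e3 : LocallyAffineAt (fun y => 1 / 2 * ∑ v ∈ T.nodes, ∑ w ∈ T.nodes,
      (q v w * ((leftOf p v x - leftOf p w x) * kink p v w y) -
        if x ∈ openSegment ℝ v w then
          q v w * max 0 (orient p v w * wedge (y - v) (w - v)) else 0)) x := by
    refine LocallyAffineAt.const_mul (LocallyAffineAt.sum fun v hv =>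
      LocallyAffineAt.sum fun w hw => ?_) _
    by_cases hvw : v = w
    · refine ⟨0, Eventually.of_forall fun y => ?_⟩
      rw [hq0 v w (fun h => h.1 hvw)]; simp
    have hgvw := hgen v hv w hw hvw
    have hpos := orient_mul_pos hgvw
    by_cases hl : wedge (w - v) (x - v) = 0
    · obtain ⟨μ, hμ⟩ := eq_on_line (Ne.symm hvw) hl
      have ev : wedge (v - p) (x - p) = μ * wedge (v - p) (w - p) := by
        rw [hμ]; simp [wedge]; ring
      have ew : wedge (w - p) (x - p) = (μ - 1) * wedge (v - p) (w - p) := by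
        rw [hμ]; simp [wedge]; ring
      have hμ0 : μ ≠ 0 := by
        rintro rfl; exact hxn (by rw [hμ]; simpa using hv)
      have hμ1 : μ ≠ 1 := by
        rintro rfl; exact hxn (by rw [hμ]; simpa using hw)
      by_cases hs : 0 < μ ∧ μ < 1
      · have hseg : x ∈ openSegment ℝ v w :=
          ⟨1 - μ, μ, by linarith, hs.1, by ring, by rw [hμ]; module⟩
        have hlr : leftOf p v x - leftOf p w x = orient p v w := by
          rw [leftOf, leftOf, orient, ev, ew]
          rcases lt_or_gt_of_ne hgvw with h1 | h1
          · rw [if_neg (by nlinarith), if_pos (by nlinarith), if_neg (by linarith)]; ring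
          · rw [if_pos (by nlinarith), if_neg (by nlinarith), if_pos h1]; ring
        refine ⟨0, Eventually.of_forall fun y => ?_⟩
        simp only [if_pos hseg]
        rw [hlr, kink, ← mul_assoc (orient p v w), orient_sq]
        simp
      · have hseg : x ∉ openSegment ℝ v w := by
          rintro ⟨α, β, hα, hβ, hs', he⟩
          have : v + β • (w - v) = v + μ • (w - v) := by
            rw [← hμ, ← he, show α = 1 - β by linarith]; module
          have := smul_dir_injective hvw this
          exact hs ⟨by linarith, by linarith⟩
        have hlr : leftOf p v x - leftOf p w x = 0 := by
          rw [leftOf, leftOf, ev, ew]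
          have hcase : μ < 0 ∨ 1 < μ := by
            by_contra hcon
            rw [not_or, not_lt, not_lt] at hcon
            exact hs ⟨lt_of_le_of_ne hcon.1 (Ne.symm hμ0), lt_of_le_of_ne hcon.2 hμ1⟩
          rcases lt_or_gt_of_ne hgvw with h1 | h1 <;> rcases hcase with h2 | h2
          · rw [if_pos (by nlinarith), if_pos (by nlinarith)]; ring
          · rw [if_neg (by nlinarith), if_neg (by nlinarith)]; ring
          · rw [if_neg (by nlinarith), if_neg (by nlinarith)]; ring
          · rw [if_pos (by nlinarith), if_pos (by nlinarith)]; ring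
        refine ⟨0, Eventually.of_forall fun y => ?_⟩
        simp only [if_neg hseg, hlr]
        simp
    · have hseg : x ∉ openSegment ℝ v w := by
        rintro ⟨α, β, hα, hβ, hs', he⟩
        refine hl ?_
        rw [← he, show α = 1 - β by linarith]
        simp [wedge]; ring
      have hl' : orient p v w * wedge (x - v) (w - v) ≠ 0 := by
        refine mul_ne_zero (fun h0 => by rw [h0, zero_mul] at hpos; exact lt_irrefl _ hpos) ?_
        intro h0; refine hl ?_
        rw [← neg_eq_zero, ← h0]; simp [wedge]; ring
      have hc : Continuous fun y : Plane => orient p v w * wedge (y - v) (w - v) :=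
        continuous_const.mul (continuous_wedge (by fun_prop) (by fun_prop))
      have hk : LocallyAffineAt (kink p v w) x := by
        rcases lt_or_gt_of_ne hl' with h1 | h1
        · refine ⟨0, ?_⟩
          filter_upwards [hc.continuousAt.eventually_lt_const h1] with y hy
          rw [kink, max_eq_left hy.le]; simp
        · refine ⟨⟨fun y => wedge (y - v) (w - v),
              { toFun := fun u => wedge u (w - v)
                map_add' := fun u u' => by simp [wedge]; ring
                map_smul' := fun r u => by simp [wedge]; ring },
              fun y u => by simp [wedge]; ring⟩, ?_⟩
          filter_upwards [hc.continuousAt.eventually_const_lt h1] with y hy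
          rw [kink, max_eq_right hy.le, ← mul_assoc, orient_sq, one_mul]
          rfl
      refine ((hk.const_mul (leftOf p v x - leftOf p w x)).const_mul (q v w)).congr
        (Eventually.of_forall fun y => ?_)
      simp only [if_neg hseg]; ring
  refine e3.congr ?_
  filter_upwards [e1] with y hy
  rw [hy, e2]
  simp only [Finset.sum_sub_distrib, mul_sub]

lemma maxwellLift_openTri (hΩc : Convex ℝ Ω) (hΩ : IsOpen Ω)
    (hq0 : ∀ v w, ¬T.IsInteriorEdge v w → q v w = 0) (hqs : ∀ v w, q v w = q w v)
    (heq : ∀ v ∈ T.nodes, v ∈ Ω → ∑ w ∈ T.nodes, q v w • (w - v) = 0)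
    (hp : p ∈ Ω) (hpn : p ∉ T.nodes)
    (hgen : ∀ v ∈ T.nodes, ∀ w ∈ T.nodes, v ≠ w → wedge (v - p) (w - p) ≠ 0)
    {a b c : Plane} (ht : T.IsTriangle a b c) {y : Plane} (hy : y ∈ openTri a b c) :
    (T.interp (T.maxwellLift q p)).1 y = T.maxwellLift q p y := by
  classical
  have hnot : ∀ x ∈ openTri a b c, ∀ w : Plane →₀ ℝ, T.IsBary x w → w.support = {a, b, c} := by
    intro x hx w hw
    obtain ⟨w', hw', hs⟩ := ht.isBary hx
    rwa [hw.unique hw']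
  have hcard : ({a, b, c} : Finset Plane).card = 3 :=
    Finset.card_eq_three.2 ⟨a, b, c, ht.1, ht.2.1, ht.2.2.1, rfl⟩
  have hxn : ∀ x ∈ openTri a b c, x ∉ T.nodes := by
    intro x hx hn
    obtain ⟨w, hw, hwe⟩ := isBary_hat (T := T) (node_mem_closure hn)
    have h1 : w.support = {x} := by
      ext v
      rw [Finsupp.mem_support_iff, ← hwe, hat_apply_node hn]; simp
    have h2 := hnot x hx w hw
    rw [← h2, h1, Finset.card_singleton] at hcard
    omega
  have hloc : ∀ x ∈ openTri a b c, LocallyAffineAt (T.maxwellLift q p) x := by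
    intro x hx
    refine (maxwellLift_local hΩc hq0 hqs heq hp hpn hgen (openTri_subset hΩ hΩc ht hx)
      (hxn x hx)).congr (Eventually.of_forall fun y => ?_)
    rw [Finset.sum_eq_zero, mul_zero, sub_zero]
    refine fun v _ => Finset.sum_eq_zero fun w _ => ?_
    split_ifs with hs
    · by_cases hi : T.IsInteriorEdge v w
      · obtain ⟨u, hu, hus⟩ := isBary_edge hi.1 hi.edge hs
        rw [← hnot x hx u hu, hus, Finset.card_pair hi.1] at hcard
        omega
      · rw [hq0 v w hi, zero_mul]
    · rfl
  obtain ⟨A, hA⟩ := exists_affine_of_locallyAffine (convex_openTri a b c).isPreconnected hloc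
  have hcl : openTri a b c ⊆ closedTri a b c := openTri_subset_closedTri a b c
  have hvert : ∀ v ∈ ({a, b, c} : Finset Plane), A v = T.maxwellLift q p v := by
    intro v hv
    have hvn : v ∈ T.nodes := mem_nodes_of_face ht.2.2.2 hv
    have hvc : v ∈ closedTri a b c := by
      rw [ht.closedTri_eq]; exact subset_convexHull ℝ _ hv
    have hc : Continuous fun ε : ℝ => v + ε • (y - v) := by fun_prop
    have ht0 : Tendsto (fun ε : ℝ => v + ε • (y - v)) (𝓝[>] 0) (𝓝 v) :=
      (hc.tendsto' 0 v (by simp)).mono_left nhdsWithin_le_nhds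
    have h1 := (maxwellLift_continuousAt (q := q) hgen hvn).tendsto.comp ht0
    have h2 := ((AffineMap.continuous_of_finiteDimensional A).tendsto v).comp ht0
    refine tendsto_nhds_unique h2 (h1.congr' ?_)
    filter_upwards [Ioc_mem_nhdsGT (show (0 : ℝ) < 1 by norm_num)] with ε hε
    refine hA _ ?_
    have hb : ∀ u, u ∈ openTri a b c → v + ε • (u - v) = (1 - ε) • v + ε • u := fun u _ => by module
    have hle : 0 ≤ 1 - ε := by linarith [hε.2]
    have key : ∀ r s t : Plane, baryCoord r s t (v + ε • (y - v)) =
        (1 - ε) * baryCoord r s t v + ε * baryCoord r s t y := fun r s t => by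
      have e1 := affine_add_smul (baryMap r s t) v (y - v) ε
      rw [← affine_sub] at e1
      simp only [baryMap_apply] at e1
      rw [e1]; ring
    refine ⟨?_, ?_, ?_⟩ <;> rw [key]
    · nlinarith [mul_nonneg hle hvc.1, mul_pos hε.1 hy.1]
    · nlinarith [mul_nonneg hle hvc.2.1, mul_pos hε.1 hy.2.1]
    · nlinarith [mul_nonneg hle hvc.2.2, mul_pos hε.1 hy.2.2]
  have hAtri : ∀ x, triAffine a b c A x = A x := by
    intro x
    have hlin : (triAffine a b c A).linear = A.linear := by
      refine LinearMap.ext fun u => ?_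
      have hw := ht.wedge_ne
      have hu : u = (wedge u (c - a) / wedge (b - a) (c - a)) • (b - a) +
          (wedge (b - a) u / wedge (b - a) (c - a)) • (c - a) := by
        apply plane_ext <;> simp <;> field_simp <;> simp [wedge] <;> ring
      rw [hu, map_add, map_add, map_smul, map_smul, map_smul, map_smul, ← affine_sub,
        ← affine_sub, ← affine_sub, ← affine_sub, ht.triAffine_left, ht.triAffine_mid,
        ht.triAffine_right]
    have e1 := affine_sub (triAffine a b c A) x a
    have e2 := affine_sub A x a
    rw [hlin, ← e2, ht.triAffine_left] at e1
    linarith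
  rw [hA y hy, ht.apply (T.interp _).2 (hcl hy), ← hAtri, triAffine_apply, triAffine_apply,
    hvert a (by simp), hvert b (by simp), hvert c (by simp),
    interp_apply_node _ (mem_nodes_of_face ht.2.2.2 (by simp)),
    interp_apply_node _ (mem_nodes_of_face ht.2.2.2 (by simp)),
    interp_apply_node _ (mem_nodes_of_face ht.2.2.2 (by simp))]

/-- Edge stresses in equilibrium at the interior nodes are the kinks of a piecewise linear
function. -/
lemma exists_jump_eq (hΩc : Convex ℝ Ω) (hΩ : IsOpen Ω) (hne : Ω.Nonempty)
    (hq0 : ∀ v w, ¬T.IsInteriorEdge v w → q v w = 0) (hqs : ∀ v w, q v w = q w v)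
    (heq : ∀ v ∈ T.nodes, v ∈ Ω → ∑ w ∈ T.nodes, q v w • (w - v) = 0) :
    ∃ s : T.piecewiseLinear, ∀ a b, T.IsInteriorEdge a b → T.jump s.1 a b = q a b := by
  classical
  obtain ⟨p, ⟨hp, hpn⟩, hpl⟩ := exists_generic ((T.nodes ×ˢ T.nodes).filter fun l => l.1 ≠ l.2)
    (fun l hl => (Finset.mem_filter.1 hl).2) (U := Ω ∩ (T.nodes : Set Plane)ᶜ)
    (hΩ.inter T.nodes.finite_toSet.isClosed.isOpen_compl)
    ((T.nodes.finite_toSet.countable.dense_compl ℝ).inter_open_nonempty Ω hΩ hne)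
  have hgen : ∀ v ∈ T.nodes, ∀ w ∈ T.nodes, v ≠ w → wedge (v - p) (w - p) ≠ 0 := by
    intro v hv w hw hvw
    have := hpl (v, w) (by simp [hv, hw, hvw])
    intro h0
    refine this ?_
    rw [← h0]; simp [wedge]; ring
  refine ⟨T.interp (T.maxwellLift q p), fun a b hab => ?_⟩
  set g := T.interp (T.maxwellLift q p) with hg
  have hx := midpoint_mem a b
  set x : Plane := (1 / 2 : ℝ) • a + (1 / 2 : ℝ) • b with hxdef
  have hxΩ := hab.openSegment_subset hΩ hΩc hx
  obtain ⟨wx, hwx, hwxs⟩ := isBary_edge hab.1 hab.edge hx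
  have hcard : ({a, b} : Finset Plane).card = 2 := Finset.card_pair hab.1
  have hxn : x ∉ T.nodes := by
    intro hn
    have h1 : wx.support = {x} := by
      ext v
      rw [Finsupp.mem_support_iff, ← hwx.hat_eq, hat_apply_node hn]; simp
    rw [← hwxs, h1, Finset.card_singleton] at hcard
    omega
  obtain ⟨A₁, hA₁⟩ := hab.local_form g.2 hx
  obtain ⟨A₂, hA₂⟩ := maxwellLift_local hΩc hq0 hqs heq hp hpn hgen hxΩ hxn
  have hterm : ∀ y, 1 / 2 * ∑ v ∈ T.nodes, ∑ w ∈ T.nodes, (if x ∈ openSegment ℝ v w then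
      q v w * max 0 (orient p v w * wedge (y - v) (w - v)) else 0) =
      q a b * max 0 (orient p a b * wedge (y - a) (b - a)) := by
    intro y
    have han : a ∈ T.nodes := mem_nodes_of_face hab.edge (by simp)
    have hbn : b ∈ T.nodes := mem_nodes_of_face hab.edge (by simp)
    have e : ∀ v ∈ T.nodes, ∀ w ∈ T.nodes, (if x ∈ openSegment ℝ v w then
        q v w * max 0 (orient p v w * wedge (y - v) (w - v)) else 0) =
        (if a = v then if b = w then
          q a b * max 0 (orient p a b * wedge (y - a) (b - a)) else 0 else 0) +
        (if b = v then if a = w then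
          q a b * max 0 (orient p a b * wedge (y - a) (b - a)) else 0 else 0) := by
      intro v hv w hw
      by_cases h1 : a = v ∧ b = w
      · obtain ⟨rfl, rfl⟩ := h1
        simp [hx, hab.1.symm]
      by_cases h2 : b = v ∧ a = w
      · obtain ⟨rfl, rfl⟩ := h2
        rw [openSegment_symm, if_pos hx, hqs, orient_swap (hgen a han b hbn hab.1),
          show wedge (y - b) (a - b) = -wedge (y - a) (b - a) by simp [wedge]; ring, neg_mul_neg]
        simp [hab.1]
      have hR : (if a = v then if b = w then
          q a b * max 0 (orient p a b * wedge (y - a) (b - a)) else 0 else 0) +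
        (if b = v then if a = w then
          q a b * max 0 (orient p a b * wedge (y - a) (b - a)) else 0 else 0) = 0 := by
        rw [← ite_and, ← ite_and, if_neg h1, if_neg h2, add_zero]
      rw [hR]
      split_ifs with hs
      · by_cases hi : T.IsInteriorEdge v w
        · exfalso
          obtain ⟨u, hu, hus⟩ := isBary_edge hi.1 hi.edge hs
          rw [hu.unique hwx, hwxs] at hus
          have hva : v ∈ ({a, b} : Finset Plane) := by rw [hus]; simp
          have hwa : w ∈ ({a, b} : Finset Plane) := by rw [hus]; simp
          simp only [Finset.mem_insert, Finset.mem_singleton] at hva hwa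
          rcases hva with rfl | rfl <;> rcases hwa with rfl | rfl
          · exact hi.1 rfl
          · exact h1 ⟨rfl, rfl⟩
          · exact h2 ⟨rfl, rfl⟩
          · exact hi.1 rfl
        · rw [hq0 v w hi, zero_mul]
      · rfl
    rw [Finset.sum_congr rfl fun v hv => Finset.sum_congr rfl fun w hw => e v hv w hw]
    simp only [Finset.sum_add_distrib]
    simp [han, hbn]
    ring
  simp only [hterm] at hA₂
  obtain ⟨c, c', hc, hc', h1, h2⟩ := hab.exists_opposite
  have hn := wedge_normalVec hab.1
  set n := normalVec a b
  have hn' : wedge (b - a) (-n) = -1 := by rw [← hn]; simp [wedge]; ring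
  have hcont : Continuous fun ε : ℝ => x + ε • n := by fun_prop
  have hcont' : Continuous fun ε : ℝ => x + ε • -n := by fun_prop
  have t0 : Tendsto (fun ε : ℝ => x + ε • n) (𝓝[>] 0) (𝓝 x) :=
    (hcont.tendsto' 0 x (by simp)).mono_left nhdsWithin_le_nhds
  have t0' : Tendsto (fun ε : ℝ => x + ε • -n) (𝓝[>] 0) (𝓝 x) :=
    (hcont'.tendsto' 0 x (by simp)).mono_left nhdsWithin_le_nhds
  have hev := (hc.eventually_mem hx (v := n) (by rw [hn]; linarith)).and
    ((hc'.eventually_mem hx (v := -n) (by rw [hn']; linarith)).and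
    ((t0.eventually hA₁).and ((t0'.eventually hA₁).and
      ((t0.eventually hA₂).and (t0'.eventually hA₂)))))
  have hw1 : ∀ ε : ℝ, wedge (b - a) (x + ε • n - a) = ε := fun ε => by
    have : wedge (b - a) (x + ε • n - a) = ε * wedge (b - a) n := by
      rw [hxdef]; simp [wedge]; ring
    rw [this, hn, mul_one]
  have hw2 : ∀ ε : ℝ, wedge (b - a) (x + ε • -n - a) = -ε := fun ε => by
    have := hw1 (-ε)
    rwa [neg_smul, ← smul_neg] at this
  have hflip : ∀ y, wedge (y - a) (b - a) = -wedge (b - a) (y - a) := fun y => by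
    simp [wedge]; ring
  have key : ∀ᶠ ε in 𝓝[>] (0 : ℝ), 2 * (A₁ x - A₂ x) + (T.jump g.1 a b - q a b) * ε = 0 := by
    filter_upwards [hev, self_mem_nhdsWithin] with ε ⟨m1, m2, a1, a1', a2, a2'⟩ (hε : 0 < ε)
    rw [hg, maxwellLift_openTri hΩc hΩ hq0 hqs heq hp hpn hgen hc m1, hw1, ← hg] at a1
    rw [hg, maxwellLift_openTri hΩc hΩ hq0 hqs heq hp hpn hgen hc' m2, hw2, ← hg] at a1'
    rw [hflip, hw1] at a2
    rw [hflip, hw2] at a2'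
    rw [affine_add_smul] at a1 a1' a2 a2'
    rw [map_neg] at a1' a2'
    rw [max_eq_right hε.le] at a1
    rw [max_eq_left (by linarith)] at a1'
    have ho : orient p a b = 1 ∨ orient p a b = -1 := by
      unfold orient; split_ifs <;> simp
    rcases ho with ho | ho <;> rw [ho] at a2 a2'
    · rw [max_eq_left (by linarith)] at a2
      rw [max_eq_right (by linarith)] at a2'
      linarith
    · rw [max_eq_right (by linarith)] at a2
      rw [max_eq_left (by linarith)] at a2'
      linarith
  have hlim : Tendsto (fun ε : ℝ => 2 * (A₁ x - A₂ x) + (T.jump g.1 a b - q a b) * ε) (𝓝[>] 0)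
      (𝓝 (2 * (A₁ x - A₂ x))) := by
    have hcc : Continuous fun ε : ℝ => 2 * (A₁ x - A₂ x) + (T.jump g.1 a b - q a b) * ε := by
      fun_prop
    exact (hcc.tendsto' 0 _ (by simp)).mono_left nhdsWithin_le_nhds
  have hzero : 2 * (A₁ x - A₂ x) = 0 :=
    tendsto_nhds_unique hlim (tendsto_const_nhds.congr' (by
      filter_upwards [key] with ε h using h.symm))
  obtain ⟨ε, hk, hε : 0 < ε⟩ := (key.and self_mem_nhdsWithin).exists
  rw [hzero, zero_add] at hk
  exact sub_eq_zero.1 ((mul_eq_zero.1 hk).resolve_right hε.ne')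

end Lift

end Triangulation

end GeomHom

end

noncomputable section

namespace GeomHom

/-! ### Strong and weak convergence of square integrable functions -/

section L2

variable {α E : Type*} [MeasurableSpace α] {μ : Measure α} [NormedAddCommGroup E]

lemma integrable_inner_of_memLp [InnerProductSpace ℝ E] {f g : α → E} (hf : MemLp f 2 μ)
    (hg : MemLp g 2 μ) : Integrable (fun x => inner ℝ (f x) (g x)) μ := by
  refine (L2.integrable_inner (𝕜 := ℝ) (hf.toLp f) (hg.toLp g)).congr ?_
  filter_upwards [hf.coeFn_toLp, hg.coeFn_toLp] with x h1 h2
  rw [h1, h2]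

lemma inner_toLp [InnerProductSpace ℝ E] {f g : α → E} (hf : MemLp f 2 μ) (hg : MemLp g 2 μ) :
    inner ℝ (hf.toLp f) (hg.toLp g) = ∫ x, inner ℝ (f x) (g x) ∂μ := by
  rw [L2.inner_def]
  refine integral_congr_ae ?_
  filter_upwards [hf.coeFn_toLp, hg.coeFn_toLp] with x h1 h2
  rw [h1, h2]

lemma norm_toLp_sq [InnerProductSpace ℝ E] {f : α → E} (hf : MemLp f 2 μ) :
    ‖hf.toLp f‖ ^ 2 = ∫ x, ‖f x‖ ^ 2 ∂μ := by
  rw [← real_inner_self_eq_norm_sq, inner_toLp]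
  simp only [real_inner_self_eq_norm_sq]

/-- Strong convergence in `L²`. -/
def StrongTendsto (μ : Measure α) (f : ℕ → α → E) (g : α → E) : Prop :=
  (∀ n, MemLp (f n) 2 μ) ∧ MemLp g 2 μ ∧
    Tendsto (fun n => eLpNorm (fun x => f n x - g x) 2 μ) atTop (𝓝 0)

namespace StrongTendsto

lemma toLp {f : ℕ → α → E} {g : α → E} (h : StrongTendsto μ f g) :
    Tendsto (fun n => (h.1 n).toLp (f n)) atTop (𝓝 (h.2.1.toLp g)) :=
  (Lp.tendsto_Lp_iff_tendsto_eLpNorm'' f h.1 g h.2.1).2 h.2.2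

lemma const {g : α → E} (h : MemLp g 2 μ) : StrongTendsto μ (fun _ => g) g :=
  ⟨fun _ => h, h, by simp⟩

lemma of_le {E' : Type*} [NormedAddCommGroup E'] {f : ℕ → α → E} {g : α → E} {f' : ℕ → α → E'}
    {g' : α → E'} (h : StrongTendsto μ f g) (hf : ∀ n, MemLp (f' n) 2 μ) (hg : MemLp g' 2 μ) (C : ℝ)
    (hle : ∀ n, ∀ᵐ x ∂μ, ‖f' n x - g' x‖ ≤ C * ‖f n x - g x‖) : StrongTendsto μ f' g' := by
  refine ⟨hf, hg, ?_⟩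
  have h1 : Tendsto (fun n => ENNReal.ofReal C * eLpNorm (fun x => f n x - g x) 2 μ) atTop
      (𝓝 (ENNReal.ofReal C * 0)) := ENNReal.Tendsto.const_mul h.2.2 (Or.inr ENNReal.ofReal_ne_top)
  rw [mul_zero] at h1
  exact tendsto_of_tendsto_of_tendsto_of_le_of_le tendsto_const_nhds h1 (fun _ => zero_le)
    fun n => eLpNorm_le_mul_eLpNorm_of_ae_le_mul (hle n) 2

lemma add {f f' : ℕ → α → E} {g g' : α → E} (h : StrongTendsto μ f g)
    (h' : StrongTendsto μ f' g') :
    StrongTendsto μ (fun n x => f n x + f' n x) (fun x => g x + g' x) := by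
  refine ⟨fun n => (h.1 n).add (h'.1 n), h.2.1.add h'.2.1, ?_⟩
  have h1 := h.2.2.add h'.2.2
  rw [add_zero] at h1
  refine tendsto_of_tendsto_of_tendsto_of_le_of_le tendsto_const_nhds h1 (fun _ => zero_le)
    fun n => ?_
  refine le_trans (le_of_eq ?_) (eLpNorm_add_le ((h.1 n).1.sub h.2.1.1) ((h'.1 n).1.sub h'.2.1.1)
    (by norm_num))
  congr 1
  ext x
  simp only [Pi.add_apply]
  abel

lemma of_uniform [IsFiniteMeasure μ] {f : ℕ → α → E} {g : α → E} (hf : ∀ n, MemLp (f n) 2 μ)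
    (hg : MemLp g 2 μ) {ε : ℕ → ℝ} (hε : Tendsto ε atTop (𝓝 0))
    (hle : ∀ n, ∀ᵐ x ∂μ, ‖f n x - g x‖ ≤ ε n) : StrongTendsto μ f g := by
  refine ⟨hf, hg, ?_⟩
  have h1 : Tendsto (fun n => μ univ ^ (2 : ℝ≥0∞).toReal⁻¹ * ENNReal.ofReal (ε n)) atTop
      (𝓝 (μ univ ^ (2 : ℝ≥0∞).toReal⁻¹ * ENNReal.ofReal 0)) :=
    ENNReal.Tendsto.const_mul (ENNReal.tendsto_ofReal hε)
      (Or.inr (ENNReal.rpow_ne_top_of_nonneg (by positivity) (measure_ne_top _ _)))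
  rw [ENNReal.ofReal_zero, mul_zero] at h1
  exact tendsto_of_tendsto_of_tendsto_of_le_of_le tendsto_const_nhds h1 (fun _ => zero_le)
    fun n => eLpNorm_le_of_ae_bound (hle n)

lemma comp_tendsto {f : ℕ → α → E} {g : α → E} (h : StrongTendsto μ f g) {k : ℕ → ℕ}
    (hk : Tendsto k atTop atTop) : StrongTendsto μ (fun n => f (k n)) g :=
  ⟨fun _ => h.1 _, h.2.1, h.2.2.comp hk⟩

lemma exists_subseq_ae {f : ℕ → α → E} {g : α → E} (h : StrongTendsto μ f g) :
    ∃ k : ℕ → ℕ, StrictMono k ∧ ∀ᵐ x ∂μ, Tendsto (fun n => f (k n) x) atTop (𝓝 (g x)) :=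
  (tendstoInMeasure_of_tendsto_eLpNorm two_ne_zero (fun n => (h.1 n).1) h.2.1.1
    h.2.2).exists_seq_tendsto_ae

lemma exists_bound {f : ℕ → α → E} {g : α → E} (h : StrongTendsto μ f g) :
    ∃ B, ∀ n, (eLpNorm (f n) 2 μ).toReal ≤ B := by
  obtain ⟨B, hB⟩ := h.toLp.norm.bddAbove_range
  refine ⟨B, fun n => ?_⟩
  have := hB ⟨n, rfl⟩
  simpa only [Lp.norm_toLp] using this

lemma integral_inner [InnerProductSpace ℝ E] {f f' : ℕ → α → E} {g g' : α → E}
    (h : StrongTendsto μ f g) (h' : StrongTendsto μ f' g') :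
    Tendsto (fun n => ∫ x, inner ℝ (f n x) (f' n x) ∂μ) atTop (𝓝 (∫ x, inner ℝ (g x) (g' x) ∂μ)) := by
  simpa only [inner_toLp] using h.toLp.inner (𝕜 := ℝ) h'.toLp

end StrongTendsto

/-- Weak convergence in `L²` along a filter. -/
def WeakTendsto [InnerProductSpace ℝ E] (μ : Measure α) (f : ℕ → α → E) (l : Filter ℕ)
    (g : α → E) : Prop :=
  (∀ n, MemLp (f n) 2 μ) ∧ MemLp g 2 μ ∧ (∃ B, ∀ n, (eLpNorm (f n) 2 μ).toReal ≤ B) ∧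
  ∀ w : α → E, MemLp w 2 μ →
    Tendsto (fun n => ∫ x, inner ℝ (f n x) (w x) ∂μ) l (𝓝 (∫ x, inner ℝ (g x) (w x) ∂μ))

lemma exists_weak_limit {H : Type*} [NormedAddCommGroup H] [InnerProductSpace ℝ H]
    [CompleteSpace H] (l : Ultrafilter ℕ) (x : ℕ → H) (B : ℝ) (hB : ∀ n, ‖x n‖ ≤ B) :
    ∃ y : H, ∀ w, Tendsto (fun n => inner ℝ (x n) w) l (𝓝 (inner ℝ y w)) := by
  let f : ℕ → WeakDual ℝ H := fun n => StrongDual.toWeakDual (InnerProductSpace.toDual ℝ H (x n))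
  have hmem : ∀ n, f n ∈ WeakDual.toStrongDual ⁻¹' Metric.closedBall (0 : StrongDual ℝ H) B := by
    intro n
    rw [mem_preimage, mem_closedBall_zero_iff]
    change ‖InnerProductSpace.toDual ℝ H (x n)‖ ≤ B
    rw [LinearIsometryEquiv.norm_map]
    exact hB n
  obtain ⟨y, -, hy⟩ := (WeakDual.isCompact_closedBall (𝕜 := ℝ) (0 : StrongDual ℝ H) B).ultrafilter_le_nhds'
    (l.map f) (Filter.mem_map.2 (Filter.univ_mem' hmem))
  refine ⟨(InnerProductSpace.toDual ℝ H).symm (WeakDual.toStrongDual y), fun w => ?_⟩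
  have h1 : Tendsto (fun n => f n w) l (𝓝 (y w)) :=
    ((WeakDual.eval_continuous w).tendsto y).comp hy
  rw [InnerProductSpace.toDual_symm_apply]
  exact h1

lemma exists_weakTendsto [InnerProductSpace ℝ E] [CompleteSpace E] (l : Ultrafilter ℕ)
    {f : ℕ → α → E} (hf : ∀ n, MemLp (f n) 2 μ) {B : ℝ}
    (hB : ∀ n, (eLpNorm (f n) 2 μ).toReal ≤ B) : ∃ g, WeakTendsto μ f l g := by
  obtain ⟨y, hy⟩ := exists_weak_limit l (fun n => (hf n).toLp (f n)) B
    (fun n => by rw [Lp.norm_toLp]; exact hB n)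
  refine ⟨y, hf, Lp.memLp y, ⟨B, hB⟩, fun w hw => ?_⟩
  have := hy (hw.toLp w)
  simp only [inner_toLp] at this
  rw [← Lp.toLp_coeFn y (Lp.memLp y), inner_toLp] at this
  exact this

lemma WeakTendsto.integral_inner [InnerProductSpace ℝ E] {f : ℕ → α → E} {g : α → E}
    {l : Filter ℕ} (hl : l ≤ atTop) (h : WeakTendsto μ f l g) {w : ℕ → α → E} {w' : α → E}
    (hw : StrongTendsto μ w w') :
    Tendsto (fun n => ∫ x, inner ℝ (f n x) (w n x) ∂μ) l (𝓝 (∫ x, inner ℝ (g x) (w' x) ∂μ)) := by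
  obtain ⟨B, hB⟩ := h.2.2.1
  have h1 := h.2.2.2 w' hw.2.1
  have h2 : Tendsto (fun n => ∫ x, inner ℝ (f n x) (w n x) ∂μ - ∫ x, inner ℝ (f n x) (w' x) ∂μ) l
      (𝓝 0) := by
    have h3 : Tendsto (fun n => B * ‖(hw.1 n).toLp (w n) - hw.2.1.toLp w'‖) l (𝓝 0) := by
      have := ((tendsto_iff_norm_sub_tendsto_zero.1 hw.toLp).mono_left hl).const_mul B
      rwa [mul_zero] at this
    refine squeeze_zero_norm (fun n => ?_) h3
    rw [← inner_toLp (h.1 n) (hw.1 n), ← inner_toLp (h.1 n) hw.2.1, ← inner_sub_right]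
    refine (norm_inner_le_norm _ _).trans (mul_le_mul_of_nonneg_right ?_ (norm_nonneg _))
    rw [Lp.norm_toLp]
    exact hB n
  simpa using h2.add h1

end L2

/-! ### Gradients and weak gradients -/

lemma inner_gradient (φ : Plane → ℝ) (x v : Plane) : inner ℝ ((∇ φ) x) v = fderiv ℝ φ x v :=
  inner_gradient_left

lemma norm_gradient (φ : Plane → ℝ) (x : Plane) : ‖(∇ φ) x‖ = ‖fderiv ℝ φ x‖ := by
  simp [gradient]

lemma continuous_gradient {φ : Plane → ℝ} (h : ContDiff ℝ 1 φ) : Continuous (∇ φ) :=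
  (InnerProductSpace.toDual ℝ Plane).symm.continuous.comp (h.continuous_fderiv one_ne_zero)

lemma gradient_comp {φ : Plane → ℝ} {θ : ℝ → ℝ} {x : Plane} (hθ : DifferentiableAt ℝ θ (φ x))
    (h : DifferentiableAt ℝ φ x) : (∇ (θ ∘ φ)) x = deriv θ (φ x) • (∇ φ) x := by
  refine ext_inner_right ℝ fun v => ?_
  rw [inner_gradient, inner_smul_left, inner_gradient,
    (hθ.hasDerivAt.comp_hasFDerivAt x h.hasFDerivAt).fderiv]
  simp

lemma gradient_add' {φ ψ : Plane → ℝ} {x : Plane} (h : DifferentiableAt ℝ φ x)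
    (h' : DifferentiableAt ℝ ψ x) : (∇ (fun y => φ y + ψ y)) x = (∇ φ) x + (∇ ψ) x := by
  refine ext_inner_right ℝ fun v => ?_
  rw [inner_gradient, inner_add_left, inner_gradient, inner_gradient, fderiv_fun_add h h']
  simp

lemma gradient_coord (i : Fin 2) (x : Plane) :
    (∇ (fun y : Plane => y i)) x = EuclideanSpace.single i 1 := by
  refine ext_inner_right ℝ fun v => ?_
  rw [inner_gradient]
  have : fderiv ℝ (fun y : Plane => y i) x = EuclideanSpace.proj i :=
    (EuclideanSpace.proj i : Plane →L[ℝ] ℝ).fderiv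
  rw [this, real_inner_comm]
  simp [EuclideanSpace.inner_single_right]

variable {Ω : Set Plane}

lemma IsTest.continuous {φ : Plane → ℝ} (h : IsTest Ω φ) : Continuous φ := h.1.continuous

lemma IsTest.contDiff_one {φ : Plane → ℝ} (h : IsTest Ω φ) : ContDiff ℝ 1 φ :=
  h.1.of_le (by exact_mod_cast le_top)

lemma IsTest.support_gradient {φ : Plane → ℝ} {x : Plane} (hx : x ∉ tsupport φ) :
    (∇ φ) x = 0 := by
  have : fderiv ℝ φ x = 0 := by
    by_contra h
    exact hx (support_fderiv_subset ℝ h)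
  simp [gradient, this]

lemma IsTest.hasCompactSupport_gradient {φ : Plane → ℝ} (h : IsTest Ω φ) :
    HasCompactSupport (∇ φ) :=
  HasCompactSupport.intro h.2.1 fun _ hx => IsTest.support_gradient hx

lemma IsTest.memLp {φ : Plane → ℝ} (h : IsTest Ω φ) (p : ℝ≥0∞) :
    MemLp φ p (volume.restrict Ω) :=
  (h.continuous.memLp_of_hasCompactSupport h.2.1).restrict Ω

lemma IsTest.memLp_gradient {φ : Plane → ℝ} (h : IsTest Ω φ) (p : ℝ≥0∞) :
    MemLp (∇ φ) p (volume.restrict Ω) :=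
  ((continuous_gradient h.contDiff_one).memLp_of_hasCompactSupport
    h.hasCompactSupport_gradient).restrict Ω

lemma memLp_of_continuous (hΩb : Bornology.IsBounded Ω) {E : Type*} [NormedAddCommGroup E] {f : Plane → E} (hf : Continuous f) (p : ℝ≥0∞) :
    MemLp f p (volume.restrict Ω) := by
  have : IsFiniteMeasure (volume.restrict Ω) :=
    isFiniteMeasure_restrict.2 (measure_lt_top_of_subset subset_closure
      hΩb.isCompact_closure.measure_lt_top.ne).ne
  obtain ⟨C, hC⟩ := hΩb.isCompact_closure.exists_bound_of_continuousOn hf.continuousOn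
  refine MemLp.of_bound hf.aestronglyMeasurable C ?_
  have := ae_restrict_mem (μ := volume) (isClosed_closure (s := Ω)).measurableSet
  filter_upwards [ae_restrict_of_ae_restrict_of_subset subset_closure this] with x hx
  exact hC x hx

end GeomHom

end

noncomputable section

namespace GeomHom

variable {Ω : Set Plane}

lemma isFiniteMeasure_of_bounded (hΩb : Bornology.IsBounded Ω) :
    IsFiniteMeasure (volume.restrict Ω) :=
  isFiniteMeasure_restrict.2 hΩb.measure_lt_top.ne

/-- `u` and its weak gradient `g` are square integrable. -/
def HasGrad (Ω : Set Plane) (u : Plane → ℝ) (g : Plane → Plane) : Prop :=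
  MemLp u 2 (volume.restrict Ω) ∧ MemLp g 2 (volume.restrict Ω) ∧
    ∀ φ, IsTest Ω φ → ∀ v : Plane,
      ∫ x in Ω, u x * inner ℝ ((∇ φ) x) v = - ∫ x in Ω, φ x * inner ℝ (g x) v

lemma integrableOn_mul {u v : Plane → ℝ} (hu : MemLp u 2 (volume.restrict Ω))
    (hv : MemLp v 2 (volume.restrict Ω)) : IntegrableOn (fun x => u x * v x) Ω :=
  hu.integrable_mul hv

lemma HasGrad.integrableOn_left {u φ : Plane → ℝ} (hu : MemLp u 2 (volume.restrict Ω))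
    (hφ : IsTest Ω φ) (v : Plane) : IntegrableOn (fun x => u x * inner ℝ ((∇ φ) x) v) Ω :=
  integrableOn_mul hu ((hφ.memLp_gradient 2).inner_const v)

lemma HasGrad.integrableOn_right {φ : Plane → ℝ} {g : Plane → Plane}
    (hg : MemLp g 2 (volume.restrict Ω)) (hφ : IsTest Ω φ) (v : Plane) :
    IntegrableOn (fun x => φ x * inner ℝ (g x) v) Ω :=
  integrableOn_mul (hφ.memLp 2) (hg.inner_const v)

lemma HasGrad.isWeakGrad (hΩb : Bornology.IsBounded Ω) {u : Plane → ℝ} {g : Plane → Plane}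
    (h : HasGrad Ω u g) : IsWeakGrad Ω u g := by
  have := isFiniteMeasure_of_bounded hΩb
  refine ⟨IntegrableOn.locallyIntegrableOn (h.1.integrable one_le_two),
    IntegrableOn.locallyIntegrableOn (h.2.1.integrable one_le_two), fun φ hφ => ?_⟩
  refine ext_inner_left ℝ fun v => ?_
  have h1 : Integrable (fun x => u x • (∇ φ) x) (volume.restrict Ω) :=
    memLp_one_iff_integrable.1 ((hφ.memLp_gradient 2).smul h.1)
  have h2 : Integrable (fun x => φ x • g x) (volume.restrict Ω) :=
    memLp_one_iff_integrable.1 (h.2.1.smul (hφ.memLp 2))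
  rw [inner_neg_right, ← integral_inner h1, ← integral_inner h2]
  simp only [inner_smul_right]
  simpa only [real_inner_comm] using h.2.2 φ hφ v

lemma IsWeakGrad.hasGrad {u : Plane → ℝ} {g : Plane → Plane} (h : IsWeakGrad Ω u g)
    (hu : MemLp u 2 (volume.restrict Ω)) (hg : MemLp g 2 (volume.restrict Ω)) :
    HasGrad Ω u g := by
  refine ⟨hu, hg, fun φ hφ v => ?_⟩
  have h1 : Integrable (fun x => u x • (∇ φ) x) (volume.restrict Ω) :=
    memLp_one_iff_integrable.1 ((hφ.memLp_gradient 2).smul hu)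
  have h2 : Integrable (fun x => φ x • g x) (volume.restrict Ω) :=
    memLp_one_iff_integrable.1 (hg.smul (hφ.memLp 2))
  have h3 := congrArg (fun z => inner ℝ v z) (h.2.2 φ hφ)
  rw [inner_neg_right, ← integral_inner h1, ← integral_inner h2] at h3
  simp only [inner_smul_right] at h3
  simpa only [real_inner_comm] using h3

lemma integrableOn_test_smul {φ : Plane → ℝ} {g : Plane → Plane} (hφ : IsTest Ω φ)
    (hg : LocallyIntegrableOn g Ω) : IntegrableOn (fun x => φ x • g x) Ω := by
  have h1 : IntegrableOn g (tsupport φ) := hg.integrableOn_compact_subset hφ.2.2 hφ.2.1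
  obtain ⟨C, hC⟩ := hφ.2.1.exists_bound_of_continuous hφ.continuous
  have h2 : IntegrableOn (fun x => φ x • g x) (tsupport φ) :=
    Integrable.bdd_smul h1 C hφ.continuous.aestronglyMeasurable (ae_of_all _ hC)
  exact (integrableOn_iff_integrable_of_support_subset (fun x hx => subset_tsupport φ fun h0 =>
    hx (by simp [h0]))).1 h2 |>.integrableOn

lemma IsWeakGrad.ae_unique (hΩ : IsOpen Ω) {u : Plane → ℝ} {g g' : Plane → Plane}
    (h : IsWeakGrad Ω u g) (h' : IsWeakGrad Ω u g') : g =ᵐ[volume.restrict Ω] g' := by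
  have key := hΩ.ae_eq_zero_of_integral_contDiff_smul_eq_zero (μ := volume)
    (f := fun x => g x - g' x) (h.2.1.sub h'.2.1) fun φ h1 h2 h3 => by
      have ht : IsTest Ω φ := ⟨h1, h2, h3⟩
      have e : ∫ x in Ω, φ x • (g x - g' x) = 0 := by
        simp only [smul_sub]
        rw [integral_sub (integrableOn_test_smul ht h.2.1) (integrableOn_test_smul ht h'.2.1)]
        have e1 := h.2.2 φ ht
        rw [h'.2.2 φ ht] at e1
        rw [sub_eq_zero]
        exact neg_injective e1.symm
      rw [← e, setIntegral_eq_integral_of_forall_compl_eq_zero]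
      intro x hx
      rw [image_eq_zero_of_notMem_tsupport fun hh => hx (h3 hh), zero_smul]
  rw [Filter.EventuallyEq, ae_restrict_iff' hΩ.measurableSet]
  filter_upwards [key] with x hx hxΩ
  exact sub_eq_zero.1 (hx hxΩ)

lemma HasGrad.ae_unique (hΩ : IsOpen Ω) (hΩb : Bornology.IsBounded Ω) {u : Plane → ℝ}
    {g g' : Plane → Plane} (h : HasGrad Ω u g) (h' : HasGrad Ω u g') :
    g =ᵐ[volume.restrict Ω] g' :=
  (h.isWeakGrad hΩb).ae_unique hΩ (h'.isWeakGrad hΩb)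

lemma isWeakGrad_weakGrad {u : Plane → ℝ} (h : ∃ g, IsWeakGrad Ω u g) :
    IsWeakGrad Ω u (weakGrad Ω u) := by
  rw [weakGrad, dif_pos h]
  exact h.choose_spec

lemma HasGrad.weakGrad_eq (hΩ : IsOpen Ω) (hΩb : Bornology.IsBounded Ω) {u : Plane → ℝ}
    {g : Plane → Plane} (h : HasGrad Ω u g) : weakGrad Ω u =ᵐ[volume.restrict Ω] g :=
  (isWeakGrad_weakGrad ⟨g, h.isWeakGrad hΩb⟩).ae_unique hΩ (h.isWeakGrad hΩb)

lemma HasGrad.congr {u u' : Plane → ℝ} {g g' : Plane → Plane} (h : HasGrad Ω u g)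
    (hu : u =ᵐ[volume.restrict Ω] u') (hg : g =ᵐ[volume.restrict Ω] g') : HasGrad Ω u' g' := by
  refine ⟨h.1.ae_eq hu, h.2.1.ae_eq hg, fun φ hφ v => ?_⟩
  have h1 : ∫ x in Ω, u' x * inner ℝ ((∇ φ) x) v = ∫ x in Ω, u x * inner ℝ ((∇ φ) x) v :=
    integral_congr_ae (by filter_upwards [hu] with x hx; rw [hx])
  have h2 : ∫ x in Ω, φ x * inner ℝ (g' x) v = ∫ x in Ω, φ x * inner ℝ (g x) v :=
    integral_congr_ae (by filter_upwards [hg] with x hx; rw [hx])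
  rw [h1, h2, h.2.2 φ hφ v]

lemma HasGrad.weakGrad (hΩ : IsOpen Ω) (hΩb : Bornology.IsBounded Ω) {u : Plane → ℝ}
    {g : Plane → Plane} (h : HasGrad Ω u g) : HasGrad Ω u (weakGrad Ω u) :=
  h.congr EventuallyEq.rfl (h.weakGrad_eq hΩ hΩb).symm

lemma InH1.exists_hasGrad {u : Plane → ℝ} (h : InH1 Ω u) : ∃ g, HasGrad Ω u g := by
  obtain ⟨hu, g, hg, hg2⟩ := h
  exact ⟨g, hg.hasGrad hu hg2⟩

lemma InH1.hasGrad (hΩ : IsOpen Ω) (hΩb : Bornology.IsBounded Ω) {u : Plane → ℝ} (h : InH1 Ω u) :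
    HasGrad Ω u (weakGrad Ω u) :=
  h.exists_hasGrad.choose_spec.weakGrad hΩ hΩb

lemma HasGrad.inH1 (hΩb : Bornology.IsBounded Ω) {u : Plane → ℝ} {g : Plane → Plane}
    (h : HasGrad Ω u g) : InH1 Ω u :=
  ⟨h.1, g, h.isWeakGrad hΩb, h.2.1⟩

lemma HasGrad.add {u u' : Plane → ℝ} {g g' : Plane → Plane} (h : HasGrad Ω u g)
    (h' : HasGrad Ω u' g') : HasGrad Ω (fun x => u x + u' x) (fun x => g x + g' x) := by
  refine ⟨h.1.add h'.1, h.2.1.add h'.2.1, fun φ hφ v => ?_⟩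
  simp only [add_mul, mul_add, inner_add_left]
  rw [integral_add (integrableOn_left h.1 hφ v) (integrableOn_left h'.1 hφ v),
    integral_add (integrableOn_right h.2.1 hφ v) (integrableOn_right h'.2.1 hφ v),
    h.2.2 φ hφ v, h'.2.2 φ hφ v, neg_add]

lemma HasGrad.const_smul {u : Plane → ℝ} {g : Plane → Plane} (h : HasGrad Ω u g) (c : ℝ) :
    HasGrad Ω (fun x => c * u x) (fun x => c • g x) := by
  refine ⟨h.1.const_mul c, h.2.1.const_smul c, fun φ hφ v => ?_⟩
  simp only [inner_smul_left, mul_assoc, mul_left_comm _ c, integral_const_mul, h.2.2 φ hφ v,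
    conj_trivial, mul_neg]

lemma hasGrad_zero : HasGrad Ω (fun _ => 0) (fun _ => 0) :=
  ⟨MemLp.zero', MemLp.zero', fun φ _ v => by simp⟩

lemma HasGrad.sum {ι : Type*} (s : Finset ι) {u : ι → Plane → ℝ} {g : ι → Plane → Plane}
    (h : ∀ i ∈ s, HasGrad Ω (u i) (g i)) :
    HasGrad Ω (fun x => ∑ i ∈ s, u i x) (fun x => ∑ i ∈ s, g i x) := by
  classical
  induction s using Finset.induction_on with
  | empty => simpa using hasGrad_zero
  | insert a s ha ih =>
    simp only [Finset.sum_insert ha]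
    exact (h a (Finset.mem_insert_self a s)).add
      (ih fun i hi => h i (Finset.mem_insert_of_mem hi))

lemma hasGrad_of_contDiff (hΩb : Bornology.IsBounded Ω) {u : Plane → ℝ} (hu : ContDiff ℝ 1 u) :
    HasGrad Ω u (∇ u) := by
  refine ⟨memLp_of_continuous hΩb hu.continuous 2,
    memLp_of_continuous hΩb (continuous_gradient hu) 2, fun φ hφ v => ?_⟩
  simp only [inner_gradient]
  have hc : ∀ f : Plane → ℝ, ∀ ψ : Plane → ℝ, Continuous f → Continuous ψ → HasCompactSupport ψ →
      Integrable (fun x => f x * ψ x) := fun f ψ hf hψ hs =>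
    (hf.mul hψ).integrable_of_hasCompactSupport hs.mul_left
  have hf1 : Continuous fun x => fderiv ℝ φ x v :=
    (hφ.contDiff_one.continuous_fderiv one_ne_zero).clm_apply continuous_const
  have hf2 : HasCompactSupport fun x => fderiv ℝ φ x v := hφ.2.1.fderiv_apply ℝ v
  have hf3 : Continuous fun x => fderiv ℝ u x v :=
    (hu.continuous_fderiv one_ne_zero).clm_apply continuous_const
  have key := integral_mul_fderiv_eq_neg_fderiv_mul_of_integrable (μ := volume) (f := u) (g := φ)
    (v := v) (hc _ _ hf3 hφ.continuous hφ.2.1) (hc _ _ hu.continuous hf1 hf2)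
    (hc _ _ hu.continuous hφ.continuous hφ.2.1)
    (fun x _ => hu.differentiable one_ne_zero x)
    (fun x _ => hφ.contDiff_one.differentiable one_ne_zero x)
  rw [setIntegral_eq_integral_of_forall_compl_eq_zero, key,
    setIntegral_eq_integral_of_forall_compl_eq_zero]
  · simp only [mul_comm]
  · intro x hx
    rw [image_eq_zero_of_notMem_tsupport fun hh => hx (hφ.2.2 hh), zero_mul]
  · intro x hx
    rw [← inner_gradient, IsTest.support_gradient fun hh => hx (hφ.2.2 hh), inner_zero_left,
      mul_zero]

lemma hasGrad_of_weakTendsto {l : Filter ℕ} [l.NeBot] (hl : l ≤ atTop) {u : ℕ → Plane → ℝ}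
    {u' : Plane → ℝ} {g : ℕ → Plane → Plane} {g' : Plane → Plane}
    (h : ∀ n, HasGrad Ω (u n) (g n)) (hu : StrongTendsto (volume.restrict Ω) u u')
    (hg : WeakTendsto (volume.restrict Ω) g l g') : HasGrad Ω u' g' := by
  refine ⟨hu.2.1, hg.2.1, fun φ hφ v => ?_⟩
  have h1 := (StrongTendsto.integral_inner (.const ((hφ.memLp_gradient 2).inner_const v))
    hu).mono_left hl
  have h2 : Tendsto (fun n => -∫ x in Ω, φ x * inner ℝ (g n x) v) l
      (𝓝 (-∫ x in Ω, φ x * inner ℝ (g' x) v)) := by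
    have := hg.2.2.2 (fun x => φ x • v) ((memLp_top_const v).smul (hφ.memLp 2))
    simp only [inner_smul_right] at this
    exact this.neg
  simp only [RCLike.inner_apply, conj_trivial] at h1
  refine tendsto_nhds_unique h1 (h2.congr fun n => ?_)
  exact ((h n).2.2 φ hφ v).symm

end GeomHom

end

noncomputable section

namespace GeomHom

variable {Ω : Set Plane}

lemma memLp_comp_lipschitz (hΩb : Bornology.IsBounded Ω) {u : Plane → ℝ}
    (hu : MemLp u 2 (volume.restrict Ω)) {θ : ℝ → ℝ} {K : ℝ}
    (hθ : ∀ r s, |θ r - θ s| ≤ K * |r - s|) : MemLp (fun x => θ (u x)) 2 (volume.restrict Ω) := by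
  have := isFiniteMeasure_of_bounded hΩb
  have hc : Continuous θ := (LipschitzWith.of_dist_le_mul (K := K.toNNReal) fun r s => by
    rw [Real.dist_eq, Real.dist_eq]
    exact (hθ r s).trans (mul_le_mul_of_nonneg_right (Real.le_coe_toNNReal K)
      (abs_nonneg _))).continuous
  have h1 : MemLp (fun x => θ (u x) - θ 0) 2 (volume.restrict Ω) := by
    refine MemLp.of_le_mul hu ((hc.sub continuous_const).comp_aestronglyMeasurable hu.1)
      (c := K) (ae_of_all _ fun x => ?_)
    simpa using hθ (u x) 0
  refine (h1.add (memLp_const (θ 0))).ae_eq (ae_of_all _ fun x => ?_)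
  simp

lemma hasGrad_comp_of_weakTendsto (hΩb : Bornology.IsBounded Ω) {l : Filter ℕ} [l.NeBot]
    (hl : l ≤ atTop) {u : ℕ → Plane → ℝ} {u' : Plane → ℝ} {g : Plane → Plane}
    (hc : ∀ n, ContDiff ℝ 1 (u n)) (hu : StrongTendsto (volume.restrict Ω) u u')
    (hg : WeakTendsto (volume.restrict Ω) (fun n => ∇ (u n)) l g) {θ : ℝ → ℝ}
    (hθ : ContDiff ℝ 1 θ) {K : ℝ} (h0 : ∀ r, |deriv θ r| ≤ K)
    (h1 : ∀ r s, |θ r - θ s| ≤ K * |r - s|)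
    (h2 : ∀ r s, |deriv θ r - deriv θ s| ≤ K * |r - s|) :
    HasGrad Ω (fun x => θ (u' x)) (fun x => deriv θ (u' x) • g x) := by
  have hθ' : Continuous (deriv θ) := hθ.continuous_deriv le_rfl
  have hK : 0 ≤ K := (abs_nonneg _).trans (h0 0)
  have m1 : StrongTendsto (volume.restrict Ω) (fun n x => θ (u n x)) (fun x => θ (u' x)) :=
    hu.of_le (fun n => memLp_comp_lipschitz hΩb (hu.1 n) h1) (memLp_comp_lipschitz hΩb hu.2.1 h1) K
      fun n => ae_of_all _ fun x => h1 _ _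
  refine ⟨m1.2.1, ?_, fun φ hφ v => ?_⟩
  · exact MemLp.of_le_mul hg.2.1 ((hθ'.comp_aestronglyMeasurable hu.2.1.1).smul hg.2.1.1) (c := K)
      (ae_of_all _ fun x => by
        rw [norm_smul]; exact mul_le_mul_of_nonneg_right (h0 _) (norm_nonneg _))
  · have e1 := (StrongTendsto.integral_inner (.const ((hφ.memLp_gradient 2).inner_const v))
      m1).mono_left hl
    obtain ⟨C, hC⟩ := hφ.2.1.exists_bound_of_continuous hφ.continuous
    have m2 : StrongTendsto (volume.restrict Ω) (fun n x => (φ x * deriv θ (u n x)) • v)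
        (fun x => (φ x * deriv θ (u' x)) • v) := by
      have hm : ∀ w : Plane → ℝ, MemLp w 2 (volume.restrict Ω) →
          MemLp (fun x => (φ x * deriv θ (w x)) • v) 2 (volume.restrict Ω) := by
        intro w hw
        have h3 : MemLp (fun x => φ x * deriv θ (w x)) 2 (volume.restrict Ω) :=
          (memLp_comp_lipschitz hΩb hw h2).mul (hφ.memLp ⊤)
        exact (memLp_top_const v).smul h3
      refine hu.of_le (fun n => hm _ (hu.1 n)) (hm _ hu.2.1) (C * K * ‖v‖) fun n =>
        ae_of_all _ fun x => ?_
      rw [← sub_smul, ← mul_sub, norm_smul, norm_mul]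
      have a1 := hC x
      have a2 := h2 (u n x) (u' x)
      rw [← Real.norm_eq_abs, ← Real.norm_eq_abs] at a2
      calc ‖φ x‖ * ‖deriv θ (u n x) - deriv θ (u' x)‖ * ‖v‖
          ≤ C * (K * ‖u n x - u' x‖) * ‖v‖ := by
            have := (norm_nonneg _).trans a1
            gcongr
        _ = C * K * ‖v‖ * ‖u n x - u' x‖ := by ring
    have e2 := (hg.integral_inner hl m2).neg
    simp only [RCLike.inner_apply, conj_trivial] at e1
    simp only [inner_smul_right] at e2
    have e3 := tendsto_nhds_unique e1 (e2.congr fun n => by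
      have hcn : ContDiff ℝ 1 (θ ∘ u n) := hθ.comp (hc n)
      have := (hasGrad_of_contDiff hΩb hcn).2.2 φ hφ v
      simp only [Function.comp_apply] at this
      rw [this]
      congr 1
      refine integral_congr_ae (ae_of_all _ fun x => ?_)
      simp only
      rw [gradient_comp (hθ.differentiable one_ne_zero _) ((hc n).differentiable one_ne_zero x),
        inner_smul_left]
      simp only [conj_trivial]
      ring)
    rw [e3]
    congr 1
    refine integral_congr_ae (ae_of_all _ fun x => ?_)
    simp only [inner_smul_left, conj_trivial]
    ring

section Arctan

lemma hasDerivAt_smallArctan {ε : ℝ} (hε : 0 < ε) (r : ℝ) :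
    HasDerivAt (fun r => ε * Real.arctan (r / ε)) (1 / (1 + (r / ε) ^ 2)) r := by
  have h := (((hasDerivAt_id r).div_const ε).arctan).const_mul ε
  convert! h using 1
  simp
  field_simp

lemma abs_inv_sub_le (r s : ℝ) : |1 / (1 + r ^ 2) - 1 / (1 + s ^ 2)| ≤ |r - s| := by
  have h1 : 0 < 1 + r ^ 2 := by positivity
  have h2 : 0 < 1 + s ^ 2 := by positivity
  have e : 1 / (1 + r ^ 2) - 1 / (1 + s ^ 2) = (s - r) * ((s + r) / ((1 + r ^ 2) * (1 + s ^ 2))) := by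
    field_simp
    ring
  have h3 : |(s + r) / ((1 + r ^ 2) * (1 + s ^ 2))| ≤ 1 := by
    rw [abs_div, abs_of_pos (mul_pos h1 h2), div_le_one (mul_pos h1 h2), abs_le]
    constructor <;> nlinarith [sq_nonneg (r - 1), sq_nonneg (s - 1), sq_nonneg (r + 1),
      sq_nonneg (s + 1), mul_nonneg (sq_nonneg r) (sq_nonneg s)]
  rw [e, abs_mul, abs_sub_comm]
  exact mul_le_of_le_one_right (abs_nonneg _) h3

end Arctan

/-- A function approximated by smooth functions with bounded gradients has a weak gradient, which
vanishes where the function vanishes. -/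
lemma exists_hasGrad_of_approx (hΩ : IsOpen Ω) (hΩb : Bornology.IsBounded Ω)
    {u : ℕ → Plane → ℝ} {u' : Plane → ℝ}
    (hc : ∀ n, ContDiff ℝ 1 (u n)) (hu : StrongTendsto (volume.restrict Ω) u u') {B : ℝ}
    (hB : ∀ n, (eLpNorm (∇ (u n)) 2 (volume.restrict Ω)).toReal ≤ B) :
    ∃ g, HasGrad Ω u' g ∧
      WeakTendsto (volume.restrict Ω) (fun n => ∇ (u n)) (hyperfilter ℕ : Filter ℕ) g ∧
      ∀ᵐ x ∂volume.restrict Ω, u' x = 0 → g x = 0 := by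
  have := isFiniteMeasure_of_bounded hΩb
  have hl : (hyperfilter ℕ : Filter ℕ) ≤ atTop := by
    rw [← Nat.cofinite_eq_atTop]; exact hyperfilter_le_cofinite
  obtain ⟨g, hg⟩ := exists_weakTendsto (hyperfilter ℕ)
    (fun n => memLp_of_continuous hΩb (continuous_gradient (hc n)) 2) hB
  have hgrad : HasGrad Ω u' g :=
    hasGrad_of_weakTendsto hl (fun n => hasGrad_of_contDiff hΩb (hc n)) hu hg
  refine ⟨g, hgrad, hg, ?_⟩
  let ε : ℕ → ℝ := fun m => 1 / ((m : ℝ) + 1)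
  have hε : ∀ m, 0 < ε m := fun m => by positivity
  have hε0 : Tendsto ε atTop (𝓝 0) := tendsto_one_div_add_atTop_nhds_zero_nat
  let θ : ℕ → ℝ → ℝ := fun m r => ε m * Real.arctan (r / ε m)
  have hd : ∀ m r, deriv (θ m) r = 1 / (1 + (r / ε m) ^ 2) := fun m r =>
    (hasDerivAt_smallArctan (hε m) r).deriv
  have hd1 : ∀ m r, |1 / (1 + (r / ε m) ^ 2)| ≤ 1 := fun m r => by
    rw [abs_of_pos (by positivity), div_le_one (by positivity)]
    nlinarith [sq_nonneg (r / ε m)]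
  have hθ : ∀ m, HasGrad Ω (fun x => θ m (u' x)) (fun x => (1 / (1 + (u' x / ε m) ^ 2)) • g x) := by
    intro m
    have hcd : ContDiff ℝ 1 (θ m) :=
      contDiff_const.mul (Real.contDiff_arctan.comp (contDiff_id.div_const _))
    have h1 : ∀ r s, |θ m r - θ m s| ≤ |r - s| := by
      intro r s
      have := Convex.norm_image_sub_le_of_norm_deriv_le (f := θ m) (s := univ) (x := s) (y := r)
        (C := 1) (fun x _ => hcd.differentiable one_ne_zero x)
        (fun x _ => by rw [hd, Real.norm_eq_abs]; exact hd1 m x) convex_univ (mem_univ _)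
        (mem_univ _)
      simpa using this
    have hK : 1 ≤ max 1 (1 / ε m) := le_max_left _ _
    have := hasGrad_comp_of_weakTendsto hΩb hl hc hu hg hcd (K := max 1 (1 / ε m))
      (fun r => by rw [hd]; exact (hd1 m r).trans hK)
      (fun r s => (h1 r s).trans (le_mul_of_one_le_left (abs_nonneg _) hK))
      (fun r s => by
        rw [hd, hd]
        refine (abs_inv_sub_le _ _).trans ?_
        rw [← sub_div, abs_div, abs_of_pos (hε m), div_eq_mul_one_div, mul_comm]
        exact mul_le_mul_of_nonneg_right (le_max_right _ _) (abs_nonneg _))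
    simpa only [hd] using this
  have hs : StrongTendsto (volume.restrict Ω) (fun m x => θ m (u' x)) (fun _ => 0) := by
    refine StrongTendsto.of_uniform (fun m => (hθ m).1) MemLp.zero' (ε := fun m => ε m * 2) ?_ ?_
    · simpa using hε0.mul_const 2
    · refine fun m => ae_of_all _ fun x => ?_
      rw [sub_zero, norm_mul, Real.norm_of_nonneg (hε m).le]
      refine mul_le_mul_of_nonneg_left ?_ (hε m).le
      rw [Real.norm_eq_abs, abs_le]
      have h1 := Real.neg_pi_div_two_lt_arctan (u' x / ε m)
      have h2 := Real.arctan_lt_pi_div_two (u' x / ε m)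
      have h3 := Real.pi_le_four
      constructor <;> linarith
  let χ : Plane → ℝ := fun x => if u' x = 0 then 1 else 0
  have hlim : ∀ x, Tendsto (fun m => 1 / (1 + (u' x / ε m) ^ 2)) atTop (𝓝 (χ x)) := by
    intro x
    by_cases hx : u' x = 0
    · simp [χ, hx]
    · simp only [χ, if_neg hx]
      have e : (fun m => 1 / (1 + (u' x / ε m) ^ 2)) = fun m => (ε m) ^ 2 / ((ε m) ^ 2 + u' x ^ 2) := by
        ext m
        have := (hε m).ne'
        field_simp
      rw [e]
      have h2 : Tendsto (fun m => (ε m) ^ 2) atTop (𝓝 0) := by simpa using hε0.pow 2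
      have h3 : (0 : ℝ) + u' x ^ 2 ≠ 0 := by positivity
      have h4 := h2.div (h2.add_const (u' x ^ 2)) h3
      rwa [zero_div] at h4
  have hχm : AEStronglyMeasurable (fun x => χ x • g x) (volume.restrict Ω) :=
    aestronglyMeasurable_of_tendsto_ae atTop (fun m => (hθ m).2.1.1)
      (ae_of_all _ fun x => (hlim x).smul_const (g x))
  have hχ : MemLp (fun x => χ x • g x) 2 (volume.restrict Ω) := by
    refine hgrad.2.1.of_le hχm (ae_of_all _ fun x => ?_)
    by_cases hx : u' x = 0 <;> simp [χ, hx]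
  have hle : ∀ m x, ‖(1 / (1 + (u' x / ε m) ^ 2)) • g x‖ ≤ ‖g x‖ := fun m x => by
    rw [norm_smul]
    exact mul_le_of_le_one_left (norm_nonneg _) (hd1 m _)
  have hw : WeakTendsto (volume.restrict Ω) (fun m x => (1 / (1 + (u' x / ε m) ^ 2)) • g x) atTop
      (fun x => χ x • g x) := by
    refine ⟨fun m => (hθ m).2.1, hχ, ⟨(eLpNorm g 2 (volume.restrict Ω)).toReal, fun m =>
      ENNReal.toReal_mono hgrad.2.1.2.ne (eLpNorm_mono (hle m))⟩, fun w hw => ?_⟩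
    refine tendsto_integral_of_dominated_convergence (fun x => ‖g x‖ * ‖w x‖)
      (fun m => (integrable_inner_of_memLp (hθ m).2.1 hw).1)
      (integrableOn_mul hgrad.2.1.norm hw.norm) (fun m => ae_of_all _ fun x => ?_)
      (ae_of_all _ fun x => ((hlim x).smul_const (g x)).inner tendsto_const_nhds)
    exact (norm_inner_le_norm _ _).trans (mul_le_mul_of_nonneg_right (hle m x) (norm_nonneg _))
  have h0 := hasGrad_of_weakTendsto le_rfl hθ hs hw
  filter_upwards [h0.ae_unique hΩ hΩb hasGrad_zero] with x hx hx0
  simpa [χ, hx0] using hx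

end GeomHom

end

noncomputable section

namespace GeomHom

variable {Ω : Set Plane} {σ : Plane → Matrix (Fin 2) (Fin 2) ℝ}

/-! ### Bounds for the coefficients -/

/-- The unit vectors of the plane. -/
def stdVec (i : Fin 2) : Plane := EuclideanSpace.single i 1

/-- The matrix-vector product. -/
def matVec (A : Matrix (Fin 2) (Fin 2) ℝ) (w : Plane) : Plane :=
  ∑ a, (∑ b, A a b * w b) • stdVec a

lemma inner_stdVec (v : Plane) (i : Fin 2) : inner ℝ v (stdVec i) = v i := by
  simp [stdVec, EuclideanSpace.inner_single_right]

lemma form_eq_inner (A : Matrix (Fin 2) (Fin 2) ℝ) (v w : Plane) :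
    form A v w = inner ℝ v (matVec A w) := by
  rw [matVec, inner_sum]
  simp only [inner_smul_right, inner_stdVec, form, Fin.sum_univ_two]
  ring

lemma form_comm {A : Matrix (Fin 2) (Fin 2) ℝ} (hA : A.IsSymm) (v w : Plane) :
    form A v w = form A w v := by
  have := hA.apply 0 1
  simp only [form, Fin.sum_univ_two, this]
  ring

lemma form_add_right (A : Matrix (Fin 2) (Fin 2) ℝ) (v w w' : Plane) :
    form A v (w + w') = form A v w + form A v w' := by
  simp only [form, Fin.sum_univ_two, PiLp.add_apply]
  ring

lemma form_smul_right (A : Matrix (Fin 2) (Fin 2) ℝ) (v w : Plane) (c : ℝ) :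
    form A v (c • w) = c * form A v w := by
  simp only [form, Fin.sum_univ_two, PiLp.smul_apply, smul_eq_mul]
  ring

lemma form_add_left (A : Matrix (Fin 2) (Fin 2) ℝ) (v v' w : Plane) :
    form A (v + v') w = form A v w + form A v' w := by
  simp only [form, Fin.sum_univ_two, PiLp.add_apply]
  ring

lemma form_smul_left (A : Matrix (Fin 2) (Fin 2) ℝ) (v w : Plane) (c : ℝ) :
    form A (c • v) w = c * form A v w := by
  simp only [form, Fin.sum_univ_two, PiLp.smul_apply, smul_eq_mul]
  ring

lemma abs_coord_le (v : Plane) (i : Fin 2) : |v i| ≤ ‖v‖ := by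
  simpa using PiLp.norm_apply_le v i

lemma abs_form_le {A : Matrix (Fin 2) (Fin 2) ℝ} {M : ℝ} (hA : ∀ a b, |A a b| ≤ M) (v w : Plane) :
    |form A v w| ≤ 4 * M * ‖v‖ * ‖w‖ := by
  have h : ∀ a b, |v a * A a b * w b| ≤ ‖v‖ * M * ‖w‖ := fun a b => by
    rw [abs_mul, abs_mul]
    have hM : 0 ≤ M := (abs_nonneg _).trans (hA a b)
    gcongr
    · exact abs_coord_le v a
    · exact hA a b
    · exact abs_coord_le w b
  rw [form, Fin.sum_univ_two, Fin.sum_univ_two, Fin.sum_univ_two]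
  refine (abs_add_le _ _).trans ((add_le_add (abs_add_le _ _) (abs_add_le _ _)).trans ?_)
  linarith [h 0 0, h 0 1, h 1 0, h 1 1]

lemma abs_entry_le {A : Matrix (Fin 2) (Fin 2) ℝ} (hA : A.IsSymm) {M : ℝ}
    (h : ∀ v : Plane, 0 ≤ form A v v ∧ form A v v ≤ M * ‖v‖ ^ 2) (a b : Fin 2) : |A a b| ≤ M := by
  have h0 := h !₂[1, 0]
  have h1 := h !₂[0, 1]
  have h2 := h !₂[1, 1]
  have h3 := h !₂[1, -1]
  have hs := hA.apply 0 1
  simp [form, Fin.sum_univ_two, EuclideanSpace.norm_sq_eq] at h0 h1 h2 h3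
  fin_cases a <;> fin_cases b <;> simp <;> rw [abs_le] <;> constructor <;> linarith

lemma exists_form_bounds (hσ : σ ∈ conductivities Ω) : ∃ m K : ℝ, 0 < m ∧ 0 ≤ K ∧
    ∀ᵐ x ∂volume.restrict Ω, (σ x).IsSymm ∧ (∀ v, m * ‖v‖ ^ 2 ≤ form (σ x) v v) ∧
      ∀ v w, |form (σ x) v w| ≤ K * ‖v‖ * ‖w‖ := by
  obtain ⟨-, hs, m, M, hm, h⟩ := hσ
  refine ⟨m, 4 * max M 0, hm, by positivity, ?_⟩
  filter_upwards [hs, h] with x hx hx'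
  refine ⟨hx, fun v => (hx' v).1, fun v w => abs_form_le (fun a b => ?_) v w⟩
  exact (abs_entry_le hx (fun v => ⟨(by positivity : 0 ≤ m * ‖v‖ ^ 2).trans (hx' v).1,
    (hx' v).2⟩) a b).trans (le_max_left _ _)

lemma norm_matVec_le {A : Matrix (Fin 2) (Fin 2) ℝ} {K : ℝ}
    (h : ∀ v w, |form A v w| ≤ K * ‖v‖ * ‖w‖) (w : Plane) : ‖matVec A w‖ ≤ K * ‖w‖ := by
  by_cases h0 : ‖matVec A w‖ = 0
  · have h1 : 0 ≤ K * ‖stdVec 0‖ * ‖stdVec 0‖ := (abs_nonneg _).trans (h _ _)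
    have h2 : 0 ≤ K := by simpa [stdVec] using h1
    rw [h0]
    positivity
  · have h1 := (le_abs_self _).trans (h (matVec A w) w)
    rw [form_eq_inner, real_inner_self_eq_norm_sq] at h1
    have h2 : 0 < ‖matVec A w‖ := lt_of_le_of_ne (norm_nonneg _) (Ne.symm h0)
    nlinarith

lemma aestronglyMeasurable_matVec (hσ : σ ∈ conductivities Ω) {w : Plane → Plane}
    (hw : AEStronglyMeasurable w (volume.restrict Ω)) :
    AEStronglyMeasurable (fun x => matVec (σ x) (w x)) (volume.restrict Ω) := by
  simp only [matVec, Fin.sum_univ_two]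
  have h : ∀ a b, AEStronglyMeasurable (fun x => σ x a b * w x b) (volume.restrict Ω) := fun a b =>
    (hσ.1 a b).aestronglyMeasurable.mul
      ((EuclideanSpace.proj b : Plane →L[ℝ] ℝ).continuous.comp_aestronglyMeasurable hw)
  exact (((h 0 0).add (h 0 1)).smul_const _).add (((h 1 0).add (h 1 1)).smul_const _)

lemma memLp_matVec (hσ : σ ∈ conductivities Ω) {w : Plane → Plane}
    (hw : MemLp w 2 (volume.restrict Ω)) :
    MemLp (fun x => matVec (σ x) (w x)) 2 (volume.restrict Ω) := by
  obtain ⟨m, K, -, -, h⟩ := exists_form_bounds hσ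
  refine hw.of_le_mul (aestronglyMeasurable_matVec hσ hw.1) (c := K) ?_
  filter_upwards [h] with x hx
  exact norm_matVec_le hx.2.2 _

lemma integrable_form (hσ : σ ∈ conductivities Ω) {v w : Plane → Plane}
    (hv : MemLp v 2 (volume.restrict Ω)) (hw : MemLp w 2 (volume.restrict Ω)) :
    Integrable (fun x => form (σ x) (v x) (w x)) (volume.restrict Ω) := by
  simp only [form_eq_inner]
  exact integrable_inner_of_memLp hv (memLp_matVec hσ hw)

/-! ### The Poincaré inequality -/

lemma IsTest.add {φ ψ : Plane → ℝ} (h : IsTest Ω φ) (h' : IsTest Ω ψ) :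
    IsTest Ω (fun x => φ x + ψ x) :=
  ⟨h.1.add h'.1, h.2.1.add h'.2.1, (tsupport_add φ ψ).trans (union_subset h.2.2 h'.2.2)⟩

lemma IsTest.mul_left {φ : Plane → ℝ} (h : IsTest Ω φ) {f : Plane → ℝ} (hf : ContDiff ℝ ∞ f) :
    IsTest Ω (fun x => f x * φ x) :=
  ⟨hf.mul h.1, h.2.1.mul_left, (tsupport_mul_subset_right).trans h.2.2⟩

lemma gradient_const_mul {φ : Plane → ℝ} {x : Plane} (h : DifferentiableAt ℝ φ x) (c : ℝ) :
    (∇ (fun y => c * φ y)) x = c • (∇ φ) x := by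
  refine ext_inner_right ℝ fun v => ?_
  rw [inner_gradient, inner_smul_left, inner_gradient, fderiv_const_mul h]
  simp

lemma IsTest.differentiableAt {φ : Plane → ℝ} (h : IsTest Ω φ) (x : Plane) :
    DifferentiableAt ℝ φ x := h.contDiff_one.differentiable one_ne_zero x

lemma contDiff_coord (i : Fin 2) {n : WithTop ℕ∞} : ContDiff ℝ n (fun x : Plane => x i) :=
  (EuclideanSpace.proj i : Plane →L[ℝ] ℝ).contDiff

lemma exists_poincare (hΩb : Bornology.IsBounded Ω) : ∃ C : ℝ, 0 ≤ C ∧ ∀ φ, IsTest Ω φ →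
    ∫ x in Ω, ‖φ x‖ ^ 2 ≤ C * ∫ x in Ω, ‖(∇ φ) x‖ ^ 2 := by
  obtain ⟨R, hR⟩ := hΩb.exists_norm_le
  refine ⟨4 * R ^ 2, by positivity, fun φ hφ => ?_⟩
  have h1 := (hasGrad_of_contDiff hΩb (contDiff_coord 0)).2.2 _ (hφ.mul_left hφ.1) (stdVec 0)
  simp only [gradient_coord] at h1
  have e1 : ∀ x, inner ℝ ((∇ (fun y => φ y * φ y)) x) (stdVec 0) = 2 * φ x * (∇ φ) x 0 := by
    intro x
    rw [inner_gradient, fderiv_fun_mul (hφ.differentiableAt x) (hφ.differentiableAt x),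
      ← inner_stdVec, inner_gradient]
    simp
    ring
  have e2 : inner ℝ (EuclideanSpace.single (0 : Fin 2) (1 : ℝ)) (stdVec 0) = 1 := by
    rw [inner_stdVec]; simp
  simp only [e1, e2, mul_one] at h1
  have i1 : IntegrableOn (fun x => ‖φ x‖ ^ 2) Ω := (hφ.memLp 2).norm.integrable_sq
  have i2 : IntegrableOn (fun x => ‖(∇ φ) x‖ ^ 2) Ω := (hφ.memLp_gradient 2).norm.integrable_sq
  have h2 : ∫ x in Ω, ‖φ x‖ ^ 2 ≤ ∫ x in Ω, (1 / 2 * ‖φ x‖ ^ 2 + 2 * R ^ 2 * ‖(∇ φ) x‖ ^ 2) := by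
    have e3 : ∫ x in Ω, ‖φ x‖ ^ 2 = ∫ x in Ω, -(x 0 * (2 * φ x * (∇ φ) x 0)) := by
      rw [integral_neg, h1, neg_neg]
      refine integral_congr_ae (ae_of_all _ fun x => ?_)
      simp only [Real.norm_eq_abs, sq_abs]
      ring
    rw [e3]
    have i3 : IntegrableOn (fun x => -(x 0 * (2 * φ x * (∇ φ) x 0))) Ω := by
      have := (memLp_of_continuous hΩb (contDiff_coord 0 (n := 1)).continuous 2).integrable_mul
        (((hφ.mul_left hφ.1).memLp_gradient 2).inner_const (stdVec 0))
      simp only [Pi.mul_def, e1] at this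
      exact this.neg
    refine integral_mono_ae i3 ((i1.const_mul _).add (i2.const_mul _)) ?_
    have hint : ∀ᵐ x ∂volume.restrict Ω, ‖x‖ ≤ R := by
      refine (ae_restrict_of_ae_restrict_of_subset subset_closure
        (ae_restrict_mem isClosed_closure.measurableSet)).mono fun x hx => ?_
      exact closure_minimal (s := Ω) (t := {x | ‖x‖ ≤ R}) hR
        (isClosed_le continuous_norm continuous_const) hx
    filter_upwards [hint] with x hx
    have a1 := abs_coord_le x 0
    have a2 := abs_coord_le ((∇ φ) x) 0
    have a3 : -(x 0 * (2 * φ x * (∇ φ) x 0)) ≤ 2 * (R * (‖φ x‖ * ‖(∇ φ) x‖)) := by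
      refine (neg_le_abs _).trans ?_
      rw [abs_mul, abs_mul, abs_mul, abs_two, ← Real.norm_eq_abs (φ x)]
      calc |x 0| * (2 * ‖φ x‖ * |(∇ φ) x 0|) = 2 * (|x 0| * (‖φ x‖ * |(∇ φ) x 0|)) := by ring
        _ ≤ 2 * (R * (‖φ x‖ * ‖(∇ φ) x‖)) := by
          have : 0 ≤ R := (norm_nonneg x).trans hx
          gcongr
          exact a1.trans hx
    nlinarith [sq_nonneg (‖φ x‖ - 2 * R * ‖(∇ φ) x‖)]
  rw [integral_add (i1.const_mul _) (i2.const_mul _), integral_const_mul, integral_const_mul] at h2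
  linarith

/-! ### Existence of harmonic coordinates -/

/-- The gradients of the test functions. -/
def testGradients (Ω : Set Plane) : Submodule ℝ (Lp Plane 2 (volume.restrict Ω)) where
  carrier := {v | ∃ φ, ∃ h : IsTest Ω φ, v = (h.memLp_gradient 2).toLp (∇ φ)}
  zero_mem' := by
    have h : IsTest Ω (fun _ => 0) :=
      ⟨contDiff_const, HasCompactSupport.zero, by simp [tsupport]⟩
    refine ⟨_, h, ?_⟩
    have : (∇ (fun _ : Plane => (0 : ℝ))) = 0 := by
      ext1 x
      simp [gradient]
    simp only [this]
    exact (MemLp.toLp_zero _).symm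
  add_mem' := by
    rintro v w ⟨φ, h, rfl⟩ ⟨ψ, h', rfl⟩
    refine ⟨_, h.add h', ?_⟩
    rw [← MemLp.toLp_add]
    refine MemLp.toLp_congr _ _ (ae_of_all _ fun x => ?_)
    exact (gradient_add' (h.differentiableAt x) (h'.differentiableAt x)).symm
  smul_mem' := by
    rintro c v ⟨φ, h, rfl⟩
    refine ⟨_, h.mul_left (contDiff_const (c := c)), ?_⟩
    rw [← MemLp.toLp_const_smul]
    refine MemLp.toLp_congr _ _ (ae_of_all _ fun x => ?_)
    exact (gradient_const_mul (h.differentiableAt x) c).symm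

lemma StrongTendsto.weakTendsto {α E : Type*} [MeasurableSpace α] {μ : Measure α}
    [NormedAddCommGroup E] [InnerProductSpace ℝ E] {f : ℕ → α → E} {g : α → E}
    (h : StrongTendsto μ f g) : WeakTendsto μ f atTop g :=
  ⟨h.1, h.2.1, h.exists_bound, fun _ hw => h.integral_inner (.const hw)⟩

/-- The limit of gradients of test functions is the weak gradient of a function in `H¹₀`. -/
lemma exists_of_mem_closure_testGradients (hΩb : Bornology.IsBounded Ω)
    {G : Lp Plane 2 (volume.restrict Ω)} (hG : G ∈ (testGradients Ω).topologicalClosure) :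
    ∃ (u : Plane → ℝ) (φ : ℕ → Plane → ℝ), (∀ n, IsTest Ω (φ n)) ∧ HasGrad Ω u G ∧
      StrongTendsto (volume.restrict Ω) φ u ∧
      StrongTendsto (volume.restrict Ω) (fun n => ∇ (φ n)) G := by
  obtain ⟨C, hC0, hC⟩ := exists_poincare hΩb
  obtain ⟨v, hv, hlim⟩ := mem_closure_iff_seq_limit.1 hG
  choose φ hφ hvφ using hv
  have hcau : CauchySeq fun n => ((hφ n).memLp 2).toLp (φ n) := by
    have h1 := hlim.cauchySeq
    have hle : ∀ n k, dist (((hφ n).memLp 2).toLp (φ n)) (((hφ k).memLp 2).toLp (φ k))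
        ≤ √C * dist (v n) (v k) := by
      intro n k
      have ht : IsTest Ω (fun x => φ n x + (-1) * φ k x) :=
        (hφ n).add ((hφ k).mul_left contDiff_const)
      have h2 := hC _ ht
      rw [← norm_toLp_sq (ht.memLp 2), ← norm_toLp_sq (ht.memLp_gradient 2)] at h2
      have e1 : (ht.memLp 2).toLp _ = ((hφ n).memLp 2).toLp (φ n) - ((hφ k).memLp 2).toLp (φ k) := by
        rw [← MemLp.toLp_sub]
        refine MemLp.toLp_congr _ _ (ae_of_all _ fun x => ?_)
        simp
        ring
      have e2 : (ht.memLp_gradient 2).toLp _ = v n - v k := by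
        rw [hvφ n, hvφ k, ← MemLp.toLp_sub]
        refine MemLp.toLp_congr _ _ (ae_of_all _ fun x => ?_)
        rw [gradient_add' ((hφ n).differentiableAt x) (((hφ k).differentiableAt x).const_mul _),
          gradient_const_mul ((hφ k).differentiableAt x)]
        simp
        abel
      rw [e1, e2] at h2
      rw [dist_eq_norm, dist_eq_norm]
      refine le_of_sq_le_sq ?_ (by positivity)
      rw [mul_pow, Real.sq_sqrt hC0]
      exact h2
    rw [Metric.cauchySeq_iff'] at h1 ⊢
    intro ε hε
    obtain ⟨N, hN⟩ := h1 (ε / (√C + 1)) (by positivity)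
    refine ⟨N, fun n hn => (hle n N).trans_lt ?_⟩
    have h3 := hN n hn
    rw [lt_div_iff₀ (by positivity)] at h3
    nlinarith [dist_nonneg (x := v n) (y := v N)]
  obtain ⟨u, hu⟩ := cauchySeq_tendsto_of_complete hcau
  have s1 : StrongTendsto (volume.restrict Ω) φ u := by
    refine ⟨fun n => (hφ n).memLp 2, Lp.memLp u, ?_⟩
    refine (Lp.tendsto_Lp_iff_tendsto_eLpNorm'' φ (fun n => (hφ n).memLp 2) u (Lp.memLp u)).1 ?_
    rwa [Lp.toLp_coeFn]
  have s2 : StrongTendsto (volume.restrict Ω) (fun n => ∇ (φ n)) G := by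
    refine ⟨fun n => (hφ n).memLp_gradient 2, Lp.memLp G, ?_⟩
    refine (Lp.tendsto_Lp_iff_tendsto_eLpNorm'' (fun n => ∇ (φ n))
      (fun n => (hφ n).memLp_gradient 2) G (Lp.memLp G)).1 ?_
    rw [Lp.toLp_coeFn]
    exact hlim.congr hvφ
  exact ⟨u, φ, hφ, hasGrad_of_weakTendsto le_rfl
    (fun n => hasGrad_of_contDiff hΩb (hφ n).contDiff_one) s1 s2.weakTendsto, s1, s2⟩

end GeomHom

end

noncomputable section

namespace GeomHom

variable {Ω : Set Plane} {σ : Plane → Matrix (Fin 2) (Fin 2) ℝ}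

/-- The Dirichlet form of a conductivity, on square integrable vector fields. -/
def dirichletForm (hσ : σ ∈ conductivities Ω) :
    Lp Plane 2 (volume.restrict Ω) →ₗ[ℝ] Lp Plane 2 (volume.restrict Ω) →ₗ[ℝ] ℝ :=
  LinearMap.mk₂ ℝ (fun v w => ∫ x in Ω, form (σ x) (w x) (v x))
    (fun v v' w => by
      rw [← integral_add (integrable_form hσ (Lp.memLp w) (Lp.memLp v))
        (integrable_form hσ (Lp.memLp w) (Lp.memLp v'))]
      refine integral_congr_ae ?_
      filter_upwards [Lp.coeFn_add v v'] with x hx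
      rw [hx, Pi.add_apply, form_add_right])
    (fun c v w => by
      rw [smul_eq_mul, ← integral_const_mul]
      refine integral_congr_ae ?_
      filter_upwards [Lp.coeFn_smul c v] with x hx
      rw [hx, Pi.smul_apply, form_smul_right])
    (fun v w w' => by
      rw [← integral_add (integrable_form hσ (Lp.memLp w) (Lp.memLp v))
        (integrable_form hσ (Lp.memLp w') (Lp.memLp v))]
      refine integral_congr_ae ?_
      filter_upwards [Lp.coeFn_add w w'] with x hx
      rw [hx, Pi.add_apply, form_add_left])
    (fun c v w => by
      rw [smul_eq_mul, ← integral_const_mul]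
      refine integral_congr_ae ?_
      filter_upwards [Lp.coeFn_smul c w] with x hx
      rw [hx, Pi.smul_apply, form_smul_left])

lemma dirichletForm_apply (hσ : σ ∈ conductivities Ω) (v w : Lp Plane 2 (volume.restrict Ω)) :
    dirichletForm hσ v w = ∫ x in Ω, form (σ x) (w x) (v x) := rfl

lemma exists_dirichletForm_bound (hσ : σ ∈ conductivities Ω) :
    ∃ K : ℝ, ∀ v w, ‖dirichletForm hσ v w‖ ≤ K * ‖v‖ * ‖w‖ := by
  obtain ⟨m, K, -, hK, h⟩ := exists_form_bounds hσ
  refine ⟨K, fun v w => ?_⟩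
  have hm := memLp_matVec hσ (Lp.memLp v)
  have e : dirichletForm hσ v w = inner ℝ w (hm.toLp _) := by
    conv_rhs => rw [← Lp.toLp_coeFn w (Lp.memLp w)]
    rw [inner_toLp, dirichletForm_apply]
    simp only [form_eq_inner]
  rw [e, mul_comm]
  refine (norm_inner_le_norm _ _).trans (mul_le_mul_of_nonneg_left ?_ (norm_nonneg _))
  have hle : ∀ᵐ x ∂volume.restrict Ω, ‖hm.toLp (fun x => matVec (σ x) (v x)) x‖ ≤ K * ‖v x‖ := by
    filter_upwards [h, hm.coeFn_toLp] with x hx h1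
    rw [h1]
    exact norm_matVec_le hx.2.2 _
  exact Lp.norm_le_mul_norm_of_ae_le_mul hle

lemma exists_coercive (hσ : σ ∈ conductivities Ω) :
    ∃ m : ℝ, 0 < m ∧ ∀ v : Plane → Plane, MemLp v 2 (volume.restrict Ω) →
      m * ∫ x in Ω, ‖v x‖ ^ 2 ≤ ∫ x in Ω, form (σ x) (v x) (v x) := by
  obtain ⟨m, K, hm, hK, h⟩ := exists_form_bounds hσ
  refine ⟨m, hm, fun v hv => ?_⟩
  rw [← integral_const_mul]
  refine integral_mono_ae (hv.norm.integrable_sq.const_mul m) (integrable_form hσ hv hv) ?_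
  filter_upwards [h] with x hx
  exact hx.2.1 _

/-- The Lax–Milgram theorem on a closed subspace. -/
lemma exists_of_coercive {H : Type*} [NormedAddCommGroup H] [InnerProductSpace ℝ H]
    [CompleteSpace H] (K : Submodule ℝ H) (hK : IsClosed (K : Set H)) (b : H →ₗ[ℝ] H →ₗ[ℝ] ℝ)
    {C m : ℝ} (hm : 0 < m) (hb : ∀ v w, ‖b v w‖ ≤ C * ‖v‖ * ‖w‖) (hc : ∀ v, m * ‖v‖ ^ 2 ≤ b v v)
    (f : H) : ∃ G ∈ K, ∀ w ∈ K, b G w = - inner ℝ f w := by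
  have : CompleteSpace K := hK.completeSpace_coe
  let B : K →L[ℝ] K →L[ℝ] ℝ := LinearMap.mkContinuous₂
    (b.compl₁₂ K.subtype K.subtype) C fun v w => hb v w
  have hB : IsCoercive B := by
    refine ⟨m, hm, fun v => ?_⟩
    calc m * ‖v‖ * ‖v‖ = m * ‖(v : H)‖ ^ 2 := by rw [Submodule.coe_norm]; ring
      _ ≤ _ := hc v
  let ℓ : K →L[ℝ] ℝ := -((innerSL ℝ f).comp K.subtypeL)
  let G : K := hB.continuousLinearEquivOfBilin.symm ((InnerProductSpace.toDual ℝ K).symm ℓ)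
  refine ⟨G, G.2, fun w hw => ?_⟩
  have h1 := hB.continuousLinearEquivOfBilin_apply G ⟨w, hw⟩
  have e1 : hB.continuousLinearEquivOfBilin G = (InnerProductSpace.toDual ℝ K).symm ℓ :=
    ContinuousLinearEquiv.apply_symm_apply _ _
  rw [e1, InnerProductSpace.toDual_symm_apply] at h1
  exact h1.symm

/-- The Dirichlet problem with homogeneous boundary values. -/
lemma exists_mem_closure_testGradients (hσ : σ ∈ conductivities Ω) {f : Plane → Plane}
    (hf : MemLp f 2 (volume.restrict Ω)) :
    ∃ G ∈ (testGradients Ω).topologicalClosure, ∀ φ, IsTest Ω φ →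
      ∫ x in Ω, form (σ x) ((∇ φ) x) (G x) = - ∫ x in Ω, form (σ x) ((∇ φ) x) (f x) := by
  obtain ⟨C, hC⟩ := exists_dirichletForm_bound hσ
  obtain ⟨m, hm, hmv⟩ := exists_coercive hσ
  have hv := memLp_matVec hσ hf
  obtain ⟨G, hG, h⟩ := exists_of_coercive (testGradients Ω).topologicalClosure
    (testGradients Ω).isClosed_topologicalClosure (dirichletForm hσ) hm hC (fun v => by
      have h1 := hmv v (Lp.memLp v)
      rw [← norm_toLp_sq (Lp.memLp v), Lp.toLp_coeFn] at h1
      exact h1) (hv.toLp _)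
  refine ⟨G, hG, fun φ hφ => ?_⟩
  have h1 := h ((hφ.memLp_gradient 2).toLp (∇ φ))
    ((testGradients Ω).le_topologicalClosure ⟨φ, hφ, rfl⟩)
  rw [real_inner_comm, inner_toLp, dirichletForm_apply] at h1
  simp only [← form_eq_inner] at h1
  rw [← h1]
  refine integral_congr_ae ?_
  filter_upwards [(hφ.memLp_gradient 2).coeFn_toLp] with x hx
  rw [hx]

lemma exists_isHarmonicCoord (hΩ : IsOpen Ω) (hΩb : Bornology.IsBounded Ω)
    (hσ : σ ∈ conductivities Ω) : ∃ F, IsHarmonicCoord Ω σ F := by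
  have := isFiniteMeasure_of_bounded hΩb
  have hex : ∀ i : Fin 2, ∃ (u : Plane → ℝ) (G : Plane → Plane), HasGrad Ω u G ∧
      (∃ φ : ℕ → Plane → ℝ, (∀ n, IsTest Ω (φ n)) ∧
        StrongTendsto (volume.restrict Ω) φ u ∧
        StrongTendsto (volume.restrict Ω) (fun n => ∇ (φ n)) G) ∧ ∀ φ, IsTest Ω φ →
      ∫ x in Ω, form (σ x) ((∇ φ) x) (G x) = - ∫ x in Ω, form (σ x) ((∇ φ) x) (stdVec i) := by
    intro i
    obtain ⟨G, hG, h⟩ := exists_mem_closure_testGradients hσ (memLp_const (stdVec i))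
    obtain ⟨u, φ, hφ, hu, h1, h2⟩ := exists_of_mem_closure_testGradients hΩb hG
    exact ⟨u, G, hu, ⟨φ, hφ, h1, h2⟩, h⟩
  choose u G hu hφ h using hex
  refine ⟨fun x => WithLp.toLp 2 fun i => x i + u i x, fun i => ?_⟩
  simp only
  have hg : HasGrad Ω (fun x => x i + u i x) (fun x => stdVec i + G i x) := by
    have := (hasGrad_of_contDiff hΩb (contDiff_coord i)).add (hu i)
    simp only [gradient_coord] at this
    exact this
  obtain ⟨φ, h0, h1, h2⟩ := hφ i
  refine ⟨hg.inH1 hΩb, ⟨?_, G i, ?_, (hu i).2.1, φ, h0, ?_, ?_⟩, fun φ hφ => ?_⟩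
  · simpa using (hu i).1
  · simpa using (hu i).isWeakGrad hΩb
  · refine h1.2.2.congr fun n => ?_
    rw [← eLpNorm_neg]
    refine eLpNorm_congr_ae (ae_of_all _ fun x => ?_)
    simp
  · refine h2.2.2.congr fun n => ?_
    rw [← eLpNorm_neg]
    refine eLpNorm_congr_ae (ae_of_all _ fun x => ?_)
    simp
  · have e : ∫ x in Ω, form (σ x) ((∇ φ) x) (weakGrad Ω (fun y => y i + u i y) x) =
        ∫ x in Ω, (form (σ x) ((∇ φ) x) (stdVec i) + form (σ x) ((∇ φ) x) (G i x)) := by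
      refine integral_congr_ae ?_
      filter_upwards [hg.weakGrad_eq hΩ hΩb] with x hx
      rw [hx, form_add_right]
    rw [e, integral_add (integrable_form hσ (hφ.memLp_gradient 2) (memLp_const _))
      (integrable_form hσ (hφ.memLp_gradient 2) (hu i).2.1), h i φ hφ, add_neg_cancel]

lemma isHarmonicCoord_harmonicCoord (hΩ : IsOpen Ω) (hΩb : Bornology.IsBounded Ω)
    (hσ : σ ∈ conductivities Ω) : IsHarmonicCoord Ω σ (harmonicCoord Ω σ) := by
  have h := exists_isHarmonicCoord hΩ hΩb hσ
  rw [harmonicCoord, dif_pos h]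
  exact h.choose_spec

/-- Smooth perturbations of the identity, with compact support in `Ω`, that approximate `F`. -/
structure IsApprox (Ω : Set Plane) (F : Plane → Plane) (Φ : ℕ → Fin 2 → Plane → ℝ) : Prop where
  test : ∀ n i, IsTest Ω (Φ n i)
  tendsto : ∀ i, StrongTendsto (volume.restrict Ω) (fun n x => x i + Φ n i x) (fun x => F x i)
  tendsto_gradient : ∀ i, StrongTendsto (volume.restrict Ω)
    (fun n => ∇ (fun x => x i + Φ n i x)) (weakGrad Ω fun x => F x i)
  tendsto_ae : ∀ᵐ x ∂volume.restrict Ω, ∀ i,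
    Tendsto (fun n => x i + Φ n i x) atTop (𝓝 (F x i))

lemma IsHarmonicCoord.exists_isApprox (hΩ : IsOpen Ω) (hΩb : Bornology.IsBounded Ω)
    {F : Plane → Plane} (hF : IsHarmonicCoord Ω σ F) : ∃ Φ, IsApprox Ω F Φ := by
  have hex : ∀ i : Fin 2, ∃ φ : ℕ → Plane → ℝ, (∀ n, IsTest Ω (φ n)) ∧
      StrongTendsto (volume.restrict Ω) (fun n x => x i + φ n x) (fun x => F x i) ∧
      StrongTendsto (volume.restrict Ω) (fun n => ∇ (fun x => x i + φ n x))
        (weakGrad Ω fun x => F x i) := by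
    intro i
    obtain ⟨h1, ⟨h2, g, hg, hg2, φ, hφ, hl1, hl2⟩, -⟩ := hF i
    have hx : MemLp (fun x : Plane => x i) 2 (volume.restrict Ω) :=
      memLp_of_continuous hΩb (contDiff_coord i (n := 1)).continuous 2
    have hgr : HasGrad Ω (fun x => x i + (F x i - x i)) (fun x => stdVec i + g x) := by
      have := (hasGrad_of_contDiff hΩb (contDiff_coord i)).add (hg.hasGrad h2 hg2)
      simp only [gradient_coord] at this
      exact this
    have hcd : ∀ n, ContDiff ℝ 1 (fun x => x i + φ n x) := fun n =>
      (contDiff_coord i).add (hφ n).contDiff_one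
    have he := (h1.hasGrad hΩ hΩb).ae_unique hΩ hΩb (hgr.congr (ae_of_all _ fun x => by simp) .rfl)
    refine ⟨φ, hφ, ⟨fun n => hx.add ((hφ n).memLp 2), h1.1, ?_⟩,
      ⟨fun n => memLp_of_continuous hΩb (continuous_gradient (hcd n)) 2,
      (h1.hasGrad hΩ hΩb).2.1, ?_⟩⟩
    · refine hl1.congr fun n => ?_
      rw [← eLpNorm_neg]
      refine eLpNorm_congr_ae (ae_of_all _ fun x => ?_)
      simp only [Pi.neg_apply]
      ring
    · refine hl2.congr fun n => ?_
      rw [← eLpNorm_neg]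
      refine eLpNorm_congr_ae ?_
      filter_upwards [he] with x hx
      rw [hx, gradient_add' ((contDiff_coord i (n := 1)).differentiable one_ne_zero x)
        ((hφ n).differentiableAt x), gradient_coord]
      simp [stdVec]
  choose φ h0 h1 h2 using hex
  obtain ⟨k, hk, hka⟩ := (h1 0).exists_subseq_ae
  obtain ⟨j, hj, hja⟩ := ((h1 1).comp_tendsto hk.tendsto_atTop).exists_subseq_ae
  have hkj : Tendsto (fun n => k (j n)) atTop atTop := hk.tendsto_atTop.comp hj.tendsto_atTop
  refine ⟨fun n i => φ i (k (j n)), fun n i => h0 i _, fun i => (h1 i).comp_tendsto hkj,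
    fun i => (h2 i).comp_tendsto hkj, ?_⟩
  filter_upwards [hka, hja] with x hx hx'
  rw [Fin.forall_fin_two]
  exact ⟨hx.comp hj.tendsto_atTop, hx'⟩

end GeomHom

end

noncomputable section

namespace GeomHom

variable {Ω : Set Plane} {σ : Plane → Matrix (Fin 2) (Fin 2) ℝ} {F : Plane → Plane}
  {Φ : ℕ → Fin 2 → Plane → ℝ}

lemma StrongTendsto.const_smul {α E : Type*} [MeasurableSpace α] {μ : Measure α}
    [NormedAddCommGroup E] [NormedSpace ℝ E] {f : ℕ → α → E} {g : α → E}
    (h : StrongTendsto μ f g) (c : ℝ) :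
    StrongTendsto μ (fun n x => c • f n x) (fun x => c • g x) :=
  h.of_le (fun n => (h.1 n).const_smul c) (h.2.1.const_smul c) |c| fun n => ae_of_all _ fun x => by
    rw [← smul_sub, norm_smul, Real.norm_eq_abs]

/-- The perturbation of the identity with components `Φ i`. -/
def perturb (Φ : Fin 2 → Plane → ℝ) (x : Plane) : Plane := WithLp.toLp 2 fun i => x i + Φ i x

lemma perturb_apply (Φ : Fin 2 → Plane → ℝ) (x : Plane) (i : Fin 2) :
    perturb Φ x i = x i + Φ i x := rfl

lemma contDiff_perturb {Φ : Fin 2 → Plane → ℝ} (h : ∀ i, IsTest Ω (Φ i)) :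
    ContDiff ℝ ∞ (perturb Φ) :=
  contDiff_euclidean.2 fun i => (contDiff_coord i).add (h i).1

lemma contDiff_perturb_one {Φ : Fin 2 → Plane → ℝ} (h : ∀ i, IsTest Ω (Φ i)) :
    ContDiff ℝ 1 (perturb Φ) := (contDiff_perturb h).of_le (by exact_mod_cast le_top)

lemma gradient_comp_map {ψ : Plane → ℝ} {f : Plane → Plane} {x : Plane}
    (hψ : DifferentiableAt ℝ ψ (f x)) (hf : DifferentiableAt ℝ f x) :
    (∇ (ψ ∘ f)) x = ∑ i, (∇ ψ) (f x) i • (∇ (fun y => f y i)) x := by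
  refine ext_inner_right ℝ fun v => ?_
  rw [inner_gradient, fderiv_comp x hψ hf, ContinuousLinearMap.comp_apply, ← inner_gradient,
    sum_inner]
  simp only [inner_smul_left, conj_trivial, inner_gradient]
  have e : ∀ i, fderiv ℝ (fun y => f y i) x v = fderiv ℝ f x v i := fun i => by
    have := ((EuclideanSpace.proj i : Plane →L[ℝ] ℝ).hasFDerivAt.comp x hf.hasFDerivAt).fderiv
    have h2 : (fun y => f y i) = (EuclideanSpace.proj i : Plane →L[ℝ] ℝ) ∘ f := rfl
    rw [h2, this]
    rfl
  rw [← inner_gradient]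
  simp only [e, Fin.sum_univ_two, PiLp.inner_apply, RCLike.inner_apply, conj_trivial]
  ring

lemma isTest_comp_perturb_sub {Φ : Fin 2 → Plane → ℝ} (h : ∀ i, IsTest Ω (Φ i)) {ψ : Plane → ℝ}
    (hψ : ContDiff ℝ ∞ ψ) : IsTest Ω (fun x => ψ (perturb Φ x) - ψ x) := by
  have hz : ∀ x, x ∉ tsupport (Φ 0) ∪ tsupport (Φ 1) → ψ (perturb Φ x) - ψ x = 0 := by
    intro x hx
    have h0 : Φ 0 x = 0 := image_eq_zero_of_notMem_tsupport fun hh => hx (Or.inl hh)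
    have h1 : Φ 1 x = 0 := image_eq_zero_of_notMem_tsupport fun hh => hx (Or.inr hh)
    have : perturb Φ x = x := by
      ext i
      fin_cases i <;> simp [perturb_apply, h0, h1]
    rw [this, sub_self]
  have hK : IsCompact (tsupport (Φ 0) ∪ tsupport (Φ 1)) := (h 0).2.1.union (h 1).2.1
  refine ⟨(hψ.comp (contDiff_perturb h)).sub hψ, HasCompactSupport.intro hK fun x hx => hz x hx, ?_⟩
  refine (closure_minimal (fun x hx => ?_) hK.isClosed).trans
    (union_subset (h 0).2.2 (h 1).2.2)
  by_contra hh
  exact hx (hz x hh)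

lemma IsApprox.strongTendsto_gradient_comp (hA : IsApprox Ω F Φ) (f : StrongDual ℝ Plane) :
    StrongTendsto (volume.restrict Ω) (fun n => ∇ (fun x => f (perturb (Φ n) x)))
      (fun x => ∑ i, f (stdVec i) • weakGrad Ω (fun y => F y i) x) := by
  have h := ((hA.tendsto_gradient 0).const_smul (f (stdVec 0))).add
    ((hA.tendsto_gradient 1).const_smul (f (stdVec 1)))
  simp only [Fin.sum_univ_two]
  convert! h using 3 with n x
  have := gradient_comp_map (ψ := f) (f := perturb (Φ n)) (x := x) f.differentiableAt
    ((contDiff_perturb_one (hA.test n)).differentiable one_ne_zero x)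
  have e : ∀ i, (∇ f) (perturb (Φ n) x) i = f (stdVec i) := fun i => by
    rw [← inner_stdVec, inner_gradient, ContinuousLinearMap.fderiv]
  simp only [e, Fin.sum_univ_two] at this
  exact this

lemma exists_integral_form_bound (hσ : σ ∈ conductivities Ω) :
    ∃ K : ℝ, 0 ≤ K ∧ ∀ (v w : Plane → Plane) (hv : MemLp v 2 (volume.restrict Ω))
      (hw : MemLp w 2 (volume.restrict Ω)),
      |∫ x in Ω, form (σ x) (v x) (w x)| ≤ K * ‖hv.toLp v‖ * ‖hw.toLp w‖ := by
  obtain ⟨K, h⟩ := exists_dirichletForm_bound hσ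
  refine ⟨max K 0, le_max_right _ _, fun v w hv hw => ?_⟩
  have h1 := h (hw.toLp w) (hv.toLp v)
  have e : dirichletForm hσ (hw.toLp w) (hv.toLp v) = ∫ x in Ω, form (σ x) (v x) (w x) := by
    rw [dirichletForm_apply]
    refine integral_congr_ae ?_
    filter_upwards [hv.coeFn_toLp, hw.coeFn_toLp] with x h1 h2
    rw [h1, h2]
  rw [e, Real.norm_eq_abs] at h1
  calc _ ≤ K * ‖hw.toLp w‖ * ‖hv.toLp v‖ := h1
    _ = K * (‖hv.toLp v‖ * ‖hw.toLp w‖) := by ring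
    _ ≤ max K 0 * (‖hv.toLp v‖ * ‖hw.toLp w‖) := by gcongr; exact le_max_left _ _
    _ = _ := by ring

lemma exists_deriv_smoothTransition_le :
    ∃ L : ℝ, 0 < L ∧ ∀ r, 0 ≤ deriv Real.smoothTransition r ∧
      deriv Real.smoothTransition r ≤ L := by
  have hc : Continuous (deriv Real.smoothTransition) :=
    (Real.smoothTransition.contDiff (n := 1)).continuous_deriv le_rfl
  obtain ⟨C, hC⟩ := (isCompact_Icc (a := (0 : ℝ)) (b := 1)).exists_bound_of_continuousOn
    hc.continuousOn
  refine ⟨max C 1, by positivity, fun r => ⟨Real.smoothTransition.monotone.deriv_nonneg, ?_⟩⟩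
  by_cases hr : r ∈ Icc (0 : ℝ) 1
  · exact (le_abs_self _).trans ((hC r hr).trans (le_max_left _ _))
  · have h0 : deriv Real.smoothTransition r = 0 := by
      rw [mem_Icc, not_and_or, not_le, not_le] at hr
      rcases hr with hr | hr
      · have : Real.smoothTransition =ᶠ[𝓝 r] fun _ => 0 := by
          filter_upwards [Iio_mem_nhds hr] with y hy
          exact Real.smoothTransition.zero_of_nonpos (le_of_lt hy)
        rw [this.deriv_eq]
        simp
      · have : Real.smoothTransition =ᶠ[𝓝 r] fun _ => 1 := by
          filter_upwards [Ioi_mem_nhds hr] with y hy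
          exact Real.smoothTransition.one_of_one_le (le_of_lt hy)
        rw [this.deriv_eq]
        simp
    rw [h0]
    positivity

lemma IsHarmonicCoord.integral_form_sum (hΩ : IsOpen Ω) (hΩb : Bornology.IsBounded Ω)
    (hσ : σ ∈ conductivities Ω) (hF : IsHarmonicCoord Ω σ F) {φ : Plane → ℝ} (hφ : IsTest Ω φ)
    (c : Fin 2 → ℝ) :
    ∫ x in Ω, form (σ x) ((∇ φ) x) (∑ i, c i • weakGrad Ω (fun y => F y i) x) = 0 := by
  have hi : ∀ i, Integrable (fun x => c i * form (σ x) ((∇ φ) x)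
      (weakGrad Ω (fun y => F y i) x)) (volume.restrict Ω) := fun i =>
    (integrable_form hσ (hφ.memLp_gradient 2) ((hF i).1.hasGrad hΩ hΩb).2.1).const_mul _
  simp only [Fin.sum_univ_two, form_add_right, form_smul_right]
  rw [integral_add (hi 0) (hi 1), integral_const_mul, integral_const_mul, (hF 0).2.2 φ hφ,
    (hF 1).2.2 φ hφ]
  simp

/-- The weak maximum principle. -/
lemma IsHarmonicCoord.ae_le (hΩ : IsOpen Ω) (hΩb : Bornology.IsBounded Ω)
    (hσ : σ ∈ conductivities Ω) (hF : IsHarmonicCoord Ω σ F) (f : StrongDual ℝ Plane) (c : ℝ)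
    (hf : ∀ x ∈ Ω, f x ≤ c) : ∀ᵐ x ∂volume.restrict Ω, f (F x) ≤ c := by
  have := isFiniteMeasure_of_bounded hΩb
  obtain ⟨Φ, hA⟩ := hF.exists_isApprox hΩ hΩb
  obtain ⟨L, hL, hθ⟩ := exists_deriv_smoothTransition_le
  obtain ⟨K, hK, hb⟩ := exists_integral_form_bound hσ
  obtain ⟨m, hm, hco⟩ := exists_coercive hσ
  obtain ⟨C, hC0, hC⟩ := exists_poincare hΩb
  let θ := Real.smoothTransition
  have hθc : ContDiff ℝ ∞ θ := Real.smoothTransition.contDiff (n := ⊤)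
  have hθd : ∀ r, DifferentiableAt ℝ θ r := hθc.differentiable (by simp)
  have hfc : ContDiff ℝ ∞ (fun y => θ (f y - c)) := hθc.comp (f.contDiff.sub contDiff_const)
  let w : ℕ → Plane → ℝ := fun n x => θ (f (perturb (Φ n) x) - c) - θ (f x - c)
  have hw : ∀ n, IsTest Ω (w n) := fun n => isTest_comp_perturb_sub (hA.test n) hfc
  have hwΩ : ∀ n, ∀ x ∈ Ω, w n x = θ (f (perturb (Φ n) x) - c) := fun n x hx => by
    have : θ (f x - c) = 0 := Real.smoothTransition.zero_of_nonpos (by linarith [hf x hx])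
    simp [w, this]
  have hv := hA.strongTendsto_gradient_comp f
  set V : Plane → Plane := fun x => ∑ i, f (stdVec i) • weakGrad Ω (fun y => F y i) x with hV
  have hvd : ∀ n x, DifferentiableAt ℝ (fun x => f (perturb (Φ n) x)) x := fun n x =>
    f.differentiableAt.comp x ((contDiff_perturb_one (hA.test n)).differentiable one_ne_zero x)
  have hgr : ∀ n, ∀ x ∈ Ω, (∇ (w n)) x =
      deriv θ (f (perturb (Φ n) x) - c) • (∇ (fun x => f (perturb (Φ n) x))) x := by
    intro n x hx
    have e1 : w n =ᶠ[𝓝 x] (fun r => θ (r - c)) ∘ (fun x => f (perturb (Φ n) x)) := by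
      filter_upwards [hΩ.mem_nhds hx] with y hy
      exact hwΩ n y hy
    have e2 : DifferentiableAt ℝ (fun r => θ (r - c)) (f (perturb (Φ n) x)) :=
      (hθd _).comp _ (differentiableAt_id.sub_const c)
    rw [e1.gradient_eq, gradient_comp (φ := fun x => f (perturb (Φ n) x)) e2 (hvd n x),
      deriv_comp_sub_const]
  have hsub : ∀ n, MemLp (fun x => (∇ (fun x => f (perturb (Φ n) x))) x - V x) 2
      (volume.restrict Ω) := fun n => (hv.1 n).sub hv.2.1
  have key : ∀ n, m * ‖((hw n).memLp_gradient 2).toLp (∇ (w n))‖ ≤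
      L * K * ‖(hsub n).toLp _‖ := by
    intro n
    have h1 := hco _ ((hw n).memLp_gradient 2)
    rw [← norm_toLp_sq ((hw n).memLp_gradient 2)] at h1
    have h2 : ∫ x in Ω, form (σ x) ((∇ (w n)) x) ((∇ (w n)) x) ≤
        ∫ x in Ω, L * form (σ x) ((∇ (w n)) x) ((∇ (fun x => f (perturb (Φ n) x))) x) := by
      refine integral_mono_ae (integrable_form hσ ((hw n).memLp_gradient 2)
        ((hw n).memLp_gradient 2)) ((integrable_form hσ ((hw n).memLp_gradient 2)
        (hv.1 n)).const_mul L) ?_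
      obtain ⟨m', K', hm', -, hb'⟩ := exists_form_bounds hσ
      filter_upwards [hb', ae_restrict_mem hΩ.measurableSet] with x hx hxΩ
      simp only [hgr n x hxΩ, form_smul_left, form_smul_right]
      have a1 := (hθ (f (perturb (Φ n) x) - c))
      have a2 : 0 ≤ form (σ x) ((∇ (fun x => f (perturb (Φ n) x))) x)
        ((∇ (fun x => f (perturb (Φ n) x))) x) := (by positivity : 0 ≤ m' * _ ^ 2).trans (hx.2.1 _)
      have a3 := mul_nonneg a1.1 a2
      exact mul_le_mul_of_nonneg_right a1.2 a3
    have h3 : ∫ x in Ω, form (σ x) ((∇ (w n)) x) ((∇ (fun x => f (perturb (Φ n) x))) x) =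
        ∫ x in Ω, form (σ x) ((∇ (w n)) x) ((∇ (fun x => f (perturb (Φ n) x))) x - V x) := by
      have e : ∀ x, form (σ x) ((∇ (w n)) x) ((∇ (fun x => f (perturb (Φ n) x))) x) =
          form (σ x) ((∇ (w n)) x) ((∇ (fun x => f (perturb (Φ n) x))) x - V x) +
          form (σ x) ((∇ (w n)) x) (V x) := fun x => by
        rw [← form_add_right, sub_add_cancel]
      simp only [e]
      rw [integral_add (integrable_form hσ ((hw n).memLp_gradient 2) (hsub n))
        (integrable_form hσ ((hw n).memLp_gradient 2) hv.2.1),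
        hF.integral_form_sum hΩ hΩb hσ (hw n) (fun i => f (stdVec i)), add_zero]
    rw [integral_const_mul, h3] at h2
    have h4 := (le_abs_self _).trans (hb _ _ ((hw n).memLp_gradient 2) (hsub n))
    have h5 := h1.trans (h2.trans (mul_le_mul_of_nonneg_left h4 hL.le))
    by_cases h0 : ‖((hw n).memLp_gradient 2).toLp (∇ (w n))‖ = 0
    · rw [h0, mul_zero]
      positivity
    · have h6 : 0 < ‖((hw n).memLp_gradient 2).toLp (∇ (w n))‖ :=
        lt_of_le_of_ne (norm_nonneg _) (Ne.symm h0)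
      refine le_of_mul_le_mul_right ?_ h6
      calc _ = m * ‖((hw n).memLp_gradient 2).toLp (∇ (w n))‖ ^ 2 := by ring
        _ ≤ _ := h5
        _ = _ := by ring
  have hlim0 : Tendsto (fun n => ‖(hsub n).toLp _‖) atTop (𝓝 0) := by
    have := tendsto_iff_norm_sub_tendsto_zero.1 hv.toLp
    refine this.congr fun n => ?_
    rw [← MemLp.toLp_sub]
    rfl
  have hlim1 : Tendsto (fun n => ‖((hw n).memLp_gradient 2).toLp (∇ (w n))‖) atTop (𝓝 0) := by
    have h0 := hlim0.const_mul (L * K / m)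
    rw [mul_zero] at h0
    refine squeeze_zero (fun n => norm_nonneg _) (fun n => ?_) h0
    rw [div_mul_eq_mul_div, le_div_iff₀ hm, mul_comm]
    exact key n
  have hlim2 : Tendsto (fun n => ‖((hw n).memLp 2).toLp (w n)‖) atTop (𝓝 0) := by
    have h0 := hlim1.const_mul (√C)
    rw [mul_zero] at h0
    refine squeeze_zero (fun n => norm_nonneg _) (fun n => ?_) h0
    refine le_of_sq_le_sq ?_ (by positivity)
    rw [mul_pow, Real.sq_sqrt hC0, norm_toLp_sq, norm_toLp_sq]
    exact hC _ (hw n)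
  have hst : StrongTendsto (volume.restrict Ω) w (fun _ => (0 : ℝ)) := by
    refine ⟨fun n => (hw n).memLp 2, MemLp.zero', ?_⟩
    refine (Lp.tendsto_Lp_iff_tendsto_eLpNorm'' w (fun n => (hw n).memLp 2) _ MemLp.zero').1 ?_
    rw [tendsto_iff_norm_sub_tendsto_zero]
    refine hlim2.congr fun n => ?_
    have : MemLp.toLp (fun _ : Plane => (0 : ℝ)) (MemLp.zero' (p := 2) (μ := volume.restrict Ω)) = 0 :=
      MemLp.toLp_zero _
    rw [this, sub_zero]
  obtain ⟨k, hk, hka⟩ := hst.exists_subseq_ae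
  filter_upwards [hka, hA.tendsto_ae, ae_restrict_mem hΩ.measurableSet] with x h1 h2 hx
  have h3 : Tendsto (fun n => perturb (Φ (k n)) x) atTop (𝓝 (F x)) := by
    have : Tendsto (fun n => perturb (Φ n) x) atTop (𝓝 (F x)) := by
      have := (PiLp.continuous_toLp 2 (fun _ : Fin 2 => ℝ)).tendsto (fun i => F x i)
      exact this.comp (tendsto_pi_nhds.2 h2)
    exact this.comp hk.tendsto_atTop
  have h4 : Tendsto (fun n => w (k n) x) atTop (𝓝 (θ (f (F x) - c))) := by
    simp only [hwΩ _ x hx]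
    exact ((hθc.continuous.comp (f.continuous.sub continuous_const)).tendsto _).comp h3
  have h5 : θ (f (F x) - c) = 0 := tendsto_nhds_unique h4 h1
  by_contra hlt
  exact (Real.smoothTransition.pos_of_pos (by linarith : 0 < f (F x) - c)).ne' h5

lemma IsHarmonicCoord.ae_mem_closure (hΩ : IsOpen Ω) (hΩc : Convex ℝ Ω)
    (hΩb : Bornology.IsBounded Ω) (hσ : σ ∈ conductivities Ω) (hF : IsHarmonicCoord Ω σ F) :
    ∀ᵐ x ∂volume.restrict Ω, F x ∈ closure Ω := by
  let ι := {p : StrongDual ℝ Plane × ℝ // ∀ x ∈ Ω, p.1 x ≤ p.2}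
  obtain ⟨T, hT, hTe⟩ := TopologicalSpace.isOpen_iUnion_countable
    (fun p : ι => {y : Plane | p.1.2 < p.1.1 y})
    fun p => isOpen_lt continuous_const p.1.1.continuous
  have h : ∀ᵐ x ∂volume.restrict Ω, ∀ p ∈ T, p.1.1 (F x) ≤ p.1.2 :=
    (ae_ball_iff hT).2 fun p _ => hF.ae_le hΩ hΩb hσ _ _ p.2
  filter_upwards [h] with x hx
  by_contra hn
  obtain ⟨f, u, h1, h2⟩ := geometric_hahn_banach_closed_point hΩc.closure isClosed_closure hn
  have hmem : F x ∈ ⋃ p : ι, {y : Plane | p.1.2 < p.1.1 y} :=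
    mem_iUnion.2 ⟨⟨(f, u), fun y hy => (h1 y (subset_closure hy)).le⟩, h2⟩
  rw [← hTe, mem_iUnion₂] at hmem
  obtain ⟨p, hp, hlt⟩ := hmem
  exact absurd (hx p hp) (not_le.2 hlt)

end GeomHom

end

noncomputable section

namespace GeomHom

variable {Ω : Set Plane} {σ : Plane → Matrix (Fin 2) (Fin 2) ℝ} {F : Plane → Plane}
  {Φ : ℕ → Fin 2 → Plane → ℝ}

open scoped Convolution in
/-- Mollification of Lipschitz functions. -/
lemma exists_smooth_approx {ψ : Plane → ℝ} {L : NNReal} (h : LipschitzWith L ψ) {δ : ℝ}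
    (hδ : 0 < δ) : ∃ ψ' : Plane → ℝ, ContDiff ℝ ∞ ψ' ∧ LipschitzWith L ψ' ∧
      (∀ x, |ψ' x - ψ x| ≤ L * δ) ∧ ∀ x, (∀ y ∈ Metric.ball x δ, ψ y = 0) → ψ' x = 0 := by
  let b : ContDiffBump (0 : Plane) := ⟨δ / 2, δ, by linarith, by linarith⟩
  let ψ' : Plane → ℝ := b.normed volume ⋆[ContinuousLinearMap.lsmul ℝ ℝ, volume] ψ
  have hint : ∀ x, Integrable (fun t => b.normed volume t * ψ (x - t)) := fun x =>
    (b.contDiff_normed (n := 1)).continuous.mul (h.continuous.comp (continuous_const.sub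
      continuous_id)) |>.integrable_of_hasCompactSupport b.hasCompactSupport_normed.mul_right
  refine ⟨ψ', b.hasCompactSupport_normed.contDiff_convolution_left (n := ⊤) _ b.contDiff_normed
    h.continuous.locallyIntegrable, LipschitzWith.of_dist_le_mul fun x y => ?_, fun x => ?_,
    fun x hx => ?_⟩
  · have e : ψ' x - ψ' y = ∫ t, b.normed volume t * (ψ (x - t) - ψ (y - t)) := by
      simp only [mul_sub]
      rw [integral_sub (hint x) (hint y)]
      rfl
    rw [Real.dist_eq, e]
    have h1 : ∀ t, ‖b.normed volume t * (ψ (x - t) - ψ (y - t))‖ ≤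
        b.normed volume t * (L * dist x y) := fun t => by
      rw [norm_mul, Real.norm_of_nonneg (b.nonneg_normed t)]
      refine mul_le_mul_of_nonneg_left ?_ (b.nonneg_normed t)
      have := h.dist_le_mul (x - t) (y - t)
      rwa [dist_sub_right] at this
    refine (norm_integral_le_of_norm_le ((b.contDiff_normed (n := 1)).continuous
      |>.integrable_of_hasCompactSupport b.hasCompactSupport_normed |>.mul_const _)
      (ae_of_all _ h1)).trans ?_
    rw [integral_mul_const, b.integral_normed, one_mul]
  · rw [← Real.dist_eq]
    refine b.dist_normed_convolution_le h.continuous.aestronglyMeasurable fun y hy => ?_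
    exact (h.dist_le_mul y x).trans (mul_le_mul_of_nonneg_left (Metric.mem_ball.1 hy).le L.2)
  · have hx0 : ψ x = 0 := hx x (Metric.mem_ball_self hδ)
    have := b.normed_convolution_eq_right (μ := volume) (g := ψ) (x₀ := x)
      fun y hy => by rw [hx0]; exact hx y hy
    rw [← hx0, ← this]

lemma IsApprox.ae_tendsto (hA : IsApprox Ω F Φ) : ∀ᵐ x ∂volume.restrict Ω,
    Tendsto (fun n => perturb (Φ n) x) atTop (𝓝 (F x)) := by
  filter_upwards [hA.tendsto_ae] with x hx
  exact ((PiLp.continuous_toLp 2 (fun _ : Fin 2 => ℝ)).tendsto (fun i => F x i)).comp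
    (tendsto_pi_nhds.2 hx)

lemma IsApprox.aestronglyMeasurable (hA : IsApprox Ω F Φ) :
    AEStronglyMeasurable F (volume.restrict Ω) :=
  aestronglyMeasurable_of_tendsto_ae atTop
    (fun n => (contDiff_perturb (hA.test n)).continuous.aestronglyMeasurable) hA.ae_tendsto

lemma norm_sub_le_coord (x y : Plane) : ‖x - y‖ ≤ ‖x 0 - y 0‖ + ‖x 1 - y 1‖ := by
  have e : x - y = (x 0 - y 0) • stdVec 0 + (x 1 - y 1) • stdVec 1 := by
    ext i
    fin_cases i <;> simp [stdVec]
  rw [e]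
  refine (norm_add_le _ _).trans (le_of_eq ?_)
  rw [norm_smul, norm_smul]
  simp [stdVec]

lemma IsApprox.strongTendsto (hΩb : Bornology.IsBounded Ω) (hA : IsApprox Ω F Φ) :
    StrongTendsto (volume.restrict Ω) (fun n => perturb (Φ n)) F := by
  have hm : ∀ n, MemLp (perturb (Φ n)) 2 (volume.restrict Ω) := fun n =>
    memLp_of_continuous hΩb (contDiff_perturb (hA.test n)).continuous 2
  have hF : MemLp F 2 (volume.restrict Ω) := by
    refine MemLp.of_le_mul ((hA.tendsto 0).2.1.norm.add (hA.tendsto 1).2.1.norm)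
      hA.aestronglyMeasurable (c := 1) (ae_of_all _ fun x => ?_)
    have := norm_sub_le_coord (F x) 0
    simp only [sub_zero, PiLp.zero_apply] at this
    rw [one_mul]
    exact this.trans (le_abs_self _)
  have hs : ∀ i, StrongTendsto (volume.restrict Ω) (fun n x => ‖(x i + Φ n i x) - F x i‖)
      (fun _ => (0 : ℝ)) := fun i =>
    (hA.tendsto i).of_le (fun n => (((hA.tendsto i).1 n).sub (hA.tendsto i).2.1).norm) MemLp.zero' 1
      fun n => ae_of_all _ fun x => by simp
  refine ((hs 0).add (hs 1)).of_le hm hF 1 fun n => ae_of_all _ fun x => ?_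
  rw [one_mul]
  have := norm_sub_le_coord (perturb (Φ n) x) (F x)
  simp only [perturb_apply] at this
  simpa using this.trans (le_abs_self _)

/-- The composition of a Lipschitz function with the limit of the approximations. -/
lemma IsApprox.exists_hasGrad_comp (hΩ : IsOpen Ω) (hΩb : Bornology.IsBounded Ω)
    (hA : IsApprox Ω F Φ) {L : NNReal} {ψ : Plane → ℝ} (hψ : LipschitzWith L ψ)
    {ψ' : ℕ → Plane → ℝ} (hc : ∀ n, ContDiff ℝ ∞ (ψ' n)) (hL : ∀ n, LipschitzWith L (ψ' n))
    {ε : ℕ → ℝ} (hε : Tendsto ε atTop (𝓝 0)) (hle : ∀ n x, |ψ' n x - ψ x| ≤ ε n) :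
    ∃ g, HasGrad Ω (ψ ∘ F) g ∧
      WeakTendsto (volume.restrict Ω) (fun n => ∇ (ψ' n ∘ perturb (Φ n)))
        (hyperfilter ℕ : Filter ℕ) g ∧
      ∀ᵐ x ∂volume.restrict Ω, ψ (F x) = 0 → g x = 0 := by
  have := isFiniteMeasure_of_bounded hΩb
  have hF := hA.strongTendsto hΩb
  have hc1 : ∀ n, ContDiff ℝ 1 (ψ' n ∘ perturb (Φ n)) := fun n =>
    ((hc n).of_le (by exact_mod_cast le_top)).comp (contDiff_perturb_one (hA.test n))
  have hmψ : ∀ G : Plane → Plane, MemLp G 2 (volume.restrict Ω) →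
      MemLp (ψ ∘ G) 2 (volume.restrict Ω) := fun G hG => by
    have h1 : MemLp (fun x => ψ (G x) - ψ 0) 2 (volume.restrict Ω) := by
      refine MemLp.of_le_mul hG ((hψ.continuous.sub continuous_const).comp_aestronglyMeasurable
        hG.1) (c := L) (ae_of_all _ fun x => ?_)
      have := hψ.dist_le_mul (G x) 0
      rwa [Real.dist_eq, dist_zero_right] at this
    refine (h1.add (memLp_const (ψ 0))).ae_eq (ae_of_all _ fun x => ?_)
    simp
  have hs1 : StrongTendsto (volume.restrict Ω) (fun n => ψ ∘ perturb (Φ n)) (ψ ∘ F) :=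
    hF.of_le (fun n => hmψ _ (hF.1 n)) (hmψ _ hF.2.1) L fun n => ae_of_all _ fun x => by
      rw [← dist_eq_norm, ← dist_eq_norm]
      exact hψ.dist_le_mul _ _
  have hs2 : StrongTendsto (volume.restrict Ω)
      (fun n x => ψ' n (perturb (Φ n) x) - ψ (perturb (Φ n) x)) (fun _ => (0 : ℝ)) :=
    StrongTendsto.of_uniform (fun n => (memLp_of_continuous hΩb (hc1 n).continuous 2).sub
      (hs1.1 n)) MemLp.zero' hε fun n => ae_of_all _ fun x => by
        rw [sub_zero]; exact hle n _
  have hs : StrongTendsto (volume.restrict Ω) (fun n => ψ' n ∘ perturb (Φ n)) (ψ ∘ F) := by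
    have := hs2.add hs1
    simpa [Function.comp_def] using this
  obtain ⟨B0, hB0⟩ := (hA.tendsto_gradient 0).exists_bound
  obtain ⟨B1, hB1⟩ := (hA.tendsto_gradient 1).exists_bound
  refine exists_hasGrad_of_approx hΩ hΩb hc1 hs (B := L * (B0 + B1)) fun n => ?_
  have hg : ∀ x, ‖(∇ (ψ' n ∘ perturb (Φ n))) x‖ ≤ L * ‖‖(∇ (fun x => x 0 + Φ n 0 x)) x‖ +
      ‖(∇ (fun x => x 1 + Φ n 1 x)) x‖‖ := by
    intro x
    rw [gradient_comp_map ((hc n).differentiable (by simp) _)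
      ((contDiff_perturb_one (hA.test n)).differentiable one_ne_zero x), Fin.sum_univ_two,
      Real.norm_of_nonneg (by positivity), mul_add]
    refine (norm_add_le _ _).trans ?_
    rw [norm_smul, norm_smul]
    have hn : ‖(∇ (ψ' n)) (perturb (Φ n) x)‖ ≤ L := by
      rw [norm_gradient]
      exact norm_fderiv_le_of_lipschitz ℝ (hL n)
    exact add_le_add
      (mul_le_mul_of_nonneg_right ((abs_coord_le _ 0).trans hn) (norm_nonneg _))
      (mul_le_mul_of_nonneg_right ((abs_coord_le _ 1).trans hn) (norm_nonneg _))
  have h0 := (hA.tendsto_gradient 0).1 n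
  have h1 := (hA.tendsto_gradient 1).1 n
  have e1 := (eLpNorm_le_mul_eLpNorm_of_ae_le_mul (p := 2) (μ := volume.restrict Ω)
    (ae_of_all _ hg)).trans (mul_le_mul_right (eLpNorm_add_le h0.1.norm h1.1.norm
      one_le_two) _)
  rw [eLpNorm_norm, eLpNorm_norm] at e1
  have e2 := ENNReal.toReal_mono (by finiteness [h0.2, h1.2]) e1
  rw [ENNReal.toReal_mul, ENNReal.toReal_add h0.2.ne h1.2.ne,
    ENNReal.toReal_ofReal (NNReal.coe_nonneg L)] at e2
  exact e2.trans (mul_le_mul_of_nonneg_left (add_le_add (hB0 n) (hB1 n)) L.2)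

end GeomHom

end

noncomputable section

namespace GeomHom

namespace Triangulation

variable {Ω : Set Plane} {σ : Plane → Matrix (Fin 2) (Fin 2) ℝ} {F : Plane → Plane}
  {T C : Triangulation Ω} {Φ : ℕ → Fin 2 → Plane → ℝ}

/-! ### Nodal basis functions in harmonic coordinates -/

lemma hat_eq_zero_of_notMem (hΩ : IsOpen Ω) (hΩc : Convex ℝ Ω) {i x : Plane} (hi : i ∈ Ω)
    (hx : x ∉ Ω) : T.hat i x = 0 := by
  by_cases hxc : x ∈ closure Ω
  swap
  · exact T.hat_eq_zero i hxc
  obtain ⟨w, hw, hwe⟩ := isBary_hat (T := T) hxc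
  rw [hwe]
  by_contra h0
  have hpos : 0 < w i := lt_of_le_of_ne (hw.2.1 i) (Ne.symm h0)
  have hmem : i ∈ w.support := Finsupp.mem_support_iff.2 h0
  have h1 : w i + ∑ v ∈ w.support.erase i, w v = 1 := by
    rw [Finset.add_sum_erase _ _ hmem]; exact hw.2.2.1
  have h2 : w i • i + ∑ v ∈ w.support.erase i, w v • v = x := by
    rw [Finset.add_sum_erase _ (fun v => w v • v) hmem]; exact hw.2.2.2
  have hb : 0 ≤ ∑ v ∈ w.support.erase i, w v := Finset.sum_nonneg fun v _ => hw.2.1 v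
  rcases hb.eq_or_lt with hb0 | hb0
  · have hz : ∀ v ∈ w.support.erase i, w v = 0 :=
      (Finset.sum_eq_zero_iff_of_nonneg fun v _ => hw.2.1 v).1 hb0.symm
    rw [← hb0, add_zero] at h1
    rw [Finset.sum_eq_zero fun v hv => by rw [hz v hv, zero_smul], h1, one_smul, add_zero] at h2
    exact hx (h2 ▸ hi)
  · have hcl : (∑ v ∈ w.support.erase i, w v)⁻¹ • ∑ v ∈ w.support.erase i, w v • v ∈ closure Ω := by
      have := hΩc.closure.centerMass_mem (t := w.support.erase i) (w := w) (z := id)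
        (fun v _ => hw.2.1 v) hb0 fun v hv => by
          have hv' := Finset.mem_of_mem_erase hv
          rw [← T.space_eq]
          exact Geometry.SimplicialComplex.convexHull_subset_space hw.1
            (subset_convexHull ℝ _ hv')
      simpa [Finset.centerMass] using this
    have := hΩc.combo_interior_closure_mem_interior (hΩ.interior_eq.symm ▸ hi) hcl hpos hb h1
    rw [smul_inv_smul₀ hb0.ne', h2] at this
    exact hx (interior_subset this)

lemma exists_lipschitzWith_hat (hΩ : IsOpen Ω) (hΩc : Convex ℝ Ω) {i : Plane} (hi : i ∈ Ω) :
    ∃ L : NNReal, LipschitzWith L (T.hat i) := by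
  obtain ⟨L, hL⟩ := lipschitzOn_of_mem hΩ hΩc (T.hat_mem i)
  have key : ∀ x ∈ closure Ω, ∀ y ∉ closure Ω, dist (T.hat i x) (T.hat i y) ≤ L * dist x y := by
    intro x hx y hy
    have hz : ∃ z ∈ segment ℝ x y, z ∈ closure Ω ∧ z ∉ Ω := by
      by_cases hxΩ : x ∈ Ω
      · by_contra! hcon
        obtain ⟨z, -, hz1, hz2⟩ := (convex_segment x y).isPreconnected Ω (closure Ω)ᶜ hΩ
          isClosed_closure.isOpen_compl
          (fun z hz => by
            by_cases h : z ∈ closure Ω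
            · exact Or.inl (hcon z hz h)
            · exact Or.inr h)
          ⟨x, left_mem_segment ℝ x y, hxΩ⟩ ⟨y, right_mem_segment ℝ x y, hy⟩
        exact hz2 (subset_closure hz1)
      · exact ⟨x, left_mem_segment ℝ x y, hx, hxΩ⟩
    obtain ⟨z, hzs, hzc, hzΩ⟩ := hz
    have h1 := hL.dist_le_mul x hx z hzc
    rw [T.hat_eq_zero i hy, ← hat_eq_zero_of_notMem (T := T) hΩ hΩc hi hzΩ]
    refine h1.trans (mul_le_mul_of_nonneg_left ?_ L.2)
    rw [← dist_add_dist_of_mem_segment hzs]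
    linarith [dist_nonneg (x := z) (y := y)]
  refine ⟨L, LipschitzWith.of_dist_le_mul fun x y => ?_⟩
  by_cases hx : x ∈ closure Ω <;> by_cases hy : y ∈ closure Ω
  · exact hL.dist_le_mul x hx y hy
  · exact key x hx y hy
  · rw [dist_comm, dist_comm x]; exact key y hy x hx
  · rw [T.hat_eq_zero i hx, T.hat_eq_zero i hy, dist_self]; positivity

lemma hasGrad_comp (hΩ : IsOpen Ω) (hΩc : Convex ℝ Ω) (hΩb : Bornology.IsBounded Ω)
    (hA : IsApprox Ω F Φ) (hF : ∀ᵐ x ∂volume.restrict Ω, F x ∈ closure Ω) {f : Plane → ℝ}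
    (hf : f ∈ T.piecewiseLinear) : HasGrad Ω (f ∘ F) (weakGrad Ω (f ∘ F)) ∧
      ∀ᵐ x ∂volume.restrict Ω, f (F x) = 0 → weakGrad Ω (f ∘ F) x = 0 := by
  obtain ⟨L, hL⟩ := lipschitzOn_of_mem hΩ hΩc hf
  obtain ⟨ψ, hψ, hψe⟩ := hL.extend_real
  let ε : ℕ → ℝ := fun n => 1 / ((n : ℝ) + 1)
  have hε : ∀ n, 0 < ε n := fun n => by positivity
  have hε0 : Tendsto ε atTop (𝓝 0) := tendsto_one_div_add_atTop_nhds_zero_nat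
  choose ψ' h1 h2 h3 h4 using fun n => exists_smooth_approx hψ (hε n)
  obtain ⟨g, hg, -, hg0⟩ := hA.exists_hasGrad_comp hΩ hΩb hψ h1 h2
    (by simpa using hε0.const_mul (L : ℝ)) h3
  have hg' : HasGrad Ω (f ∘ F) g := hg.congr (by
    filter_upwards [hF] with x hx
    exact (hψe hx).symm) .rfl
  refine ⟨hg'.weakGrad hΩ hΩb, ?_⟩
  filter_upwards [hg'.weakGrad_eq hΩ hΩb, hg0, hF] with x hx hx0 hxc h0
  rw [hx, hx0]
  rw [← hψe hxc, h0]

/-- The nodal basis functions of the interior nodes, in harmonic coordinates, are admissible test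
functions. -/
lemma integral_form_hat_comp (hΩ : IsOpen Ω) (hΩc : Convex ℝ Ω) (hΩb : Bornology.IsBounded Ω)
    (hσ : σ ∈ conductivities Ω) (hF : IsHarmonicCoord Ω σ F) {i : Plane} (hi : i ∈ Ω) (a : Fin 2) :
    ∫ x in Ω, form (σ x) (weakGrad Ω (T.hat i ∘ F) x) (weakGrad Ω (fun y => F y a) x) = 0 := by
  obtain ⟨Φ, hA⟩ := hF.exists_isApprox hΩ hΩb
  obtain ⟨L, hψ⟩ := exists_lipschitzWith_hat (T := T) hΩ hΩc hi
  let ε : ℕ → ℝ := fun n => 1 / ((n : ℝ) + 1)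
  have hε : ∀ n, 0 < ε n := fun n => by positivity
  have hε0 : Tendsto ε atTop (𝓝 0) := tendsto_one_div_add_atTop_nhds_zero_nat
  let δ : ℕ → ℝ := fun n => ε n / (2 * (L + 1))
  have hL0 : (0 : ℝ) ≤ L := L.2
  have hδ : ∀ n, 0 < δ n := fun n => by have := hε n; positivity
  have hδε : ∀ n, L * δ n ≤ ε n / 2 := fun n => by
    have h1 : δ n * (L + 1) = ε n / 2 := by
      simp only [δ]
      field_simp
    nlinarith [hδ n]
  have htr : ∀ n, LipschitzWith L (fun x => max (T.hat i x - ε n) 0) := fun n => by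
    have h1 : LipschitzWith L (fun x => T.hat i x - ε n) := by
      refine LipschitzWith.of_dist_le_mul fun x y => ?_
      rw [dist_sub_right]
      exact hψ.dist_le_mul x y
    exact h1.max_const 0
  choose ψ' h1 h2 h3 h4 using fun n => exists_smooth_approx (htr n) (hδ n)
  have htest : ∀ n, IsTest Ω (ψ' n) := by
    intro n
    have hcl : IsClosed {x | ε n / 2 ≤ T.hat i x} := isClosed_le continuous_const hψ.continuous
    have hsub : {x | ε n / 2 ≤ T.hat i x} ⊆ Ω := fun x hx => by
      by_contra hxΩ
      have hx' : ε n / 2 ≤ T.hat i x := hx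
      rw [hat_eq_zero_of_notMem hΩ hΩc hi hxΩ] at hx'
      linarith [hε n]
    have hz : ∀ x, x ∉ {x | ε n / 2 ≤ T.hat i x} → ψ' n x = 0 := by
      intro x hx
      rw [mem_ofPred_eq, not_le] at hx
      refine h4 n x fun y hy => max_eq_right ?_
      have h5 := hψ.dist_le_mul y x
      rw [Real.dist_eq] at h5
      have h6 := (le_abs_self _).trans h5
      have h7 : L * dist y x ≤ L * δ n := mul_le_mul_of_nonneg_left (Metric.mem_ball.1 hy).le hL0
      linarith [hδε n]
    have hts : tsupport (ψ' n) ⊆ {x | ε n / 2 ≤ T.hat i x} :=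
      closure_minimal (fun x hx => by by_contra hh; exact hx (hz x hh)) hcl
    exact ⟨h1 n, HasCompactSupport.intro
      (Metric.isCompact_of_isClosed_isBounded hcl (hΩb.subset hsub)) fun x hx => hz x hx,
      hts.trans hsub⟩
  have hle : ∀ n x, |ψ' n x - T.hat i x| ≤ 2 * ε n := by
    intro n x
    have h5 := h3 n x
    have h6 : |max (T.hat i x - ε n) 0 - T.hat i x| ≤ ε n := by
      have h7 := hat_nonneg (T := T) i x
      have h8 := hε n
      rcases le_total (T.hat i x - ε n) 0 with h | h
      · rw [max_eq_right h, zero_sub, abs_neg, abs_of_nonneg h7]; linarith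
      · rw [max_eq_left h, sub_sub_cancel_left, abs_neg, abs_of_pos h8]
    have h7 := abs_sub_le (ψ' n x) (max (T.hat i x - ε n) 0) (T.hat i x)
    linarith [hδε n, hε n]
  obtain ⟨g, hg, hw, -⟩ := hA.exists_hasGrad_comp hΩ hΩb hψ h1 h2
    (by simpa using hε0.const_mul 2) hle
  have hGa := ((hF a).1.hasGrad hΩ hΩb).2.1
  have hlim := hw.2.2.2 _ (memLp_matVec hσ hGa)
  simp only [← form_eq_inner] at hlim
  have hzero : ∀ n, ∫ x in Ω, form (σ x) ((∇ (ψ' n ∘ perturb (Φ n))) x)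
      (weakGrad Ω (fun y => F y a) x) = 0 := fun n => by
    have ht := (isTest_comp_perturb_sub (hA.test n) (h1 n)).add (htest n)
    simp only [sub_add_cancel] at ht
    exact (hF a).2.2 _ ht
  simp only [hzero] at hlim
  rw [tendsto_nhds_unique tendsto_const_nhds hlim]
  refine integral_congr_ae ?_
  filter_upwards [hg.weakGrad_eq hΩ hΩb] with x hx
  rw [hx]

/-! ### The stiffness matrix -/

/-- The entries `- ∫_Ω ∇(φ_i ∘ F)ᵀ σ ∇(φ_j ∘ F)` for all pairs of nodes. -/
def stiffness (T : Triangulation Ω) (σ : Plane → Matrix (Fin 2) (Fin 2) ℝ) (F : Plane → Plane)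
    (i j : Plane) : ℝ :=
  - ∫ x in Ω, form (σ x) (weakGrad Ω (T.hat i ∘ F) x) (weakGrad Ω (T.hat j ∘ F) x)

lemma stiffness_comm (hσ : σ ∈ conductivities Ω) (i j : Plane) :
    T.stiffness σ F i j = T.stiffness σ F j i := by
  rw [stiffness, stiffness]
  congr 1
  refine integral_congr_ae ?_
  filter_upwards [hσ.2.1] with x hx
  exact form_comm hx _ _

lemma form_sum_right {ι : Type*} (s : Finset ι) (A : Matrix (Fin 2) (Fin 2) ℝ) (v : Plane)
    (w : ι → Plane) : form A v (∑ i ∈ s, w i) = ∑ i ∈ s, form A v (w i) := by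
  classical
  induction s using Finset.induction_on with
  | empty => simp [form]
  | insert a s ha ih => rw [Finset.sum_insert ha, Finset.sum_insert ha, form_add_right, ih]

lemma form_sum_left {ι : Type*} (s : Finset ι) (A : Matrix (Fin 2) (Fin 2) ℝ) (v : ι → Plane)
    (w : Plane) : form A (∑ i ∈ s, v i) w = ∑ i ∈ s, form A (v i) w := by
  classical
  induction s using Finset.induction_on with
  | empty => simp [form]
  | insert a s ha ih => rw [Finset.sum_insert ha, Finset.sum_insert ha, form_add_left, ih]

lemma hasGrad_const (hΩb : Bornology.IsBounded Ω) (c : ℝ) :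
    HasGrad Ω (fun _ => c) (fun _ => 0) := by
  have h := hasGrad_of_contDiff hΩb (contDiff_const (c := c))
  have e : (∇ (fun _ : Plane => c)) = fun _ => 0 := by
    ext1 x
    simp [gradient]
  rwa [e] at h

lemma sum_mul_stiffness (hΩ : IsOpen Ω) (hΩc : Convex ℝ Ω) (hΩb : Bornology.IsBounded Ω)
    (hσ : σ ∈ conductivities Ω) (hA : IsApprox Ω F Φ)
    (hF : ∀ᵐ x ∂volume.restrict Ω, F x ∈ closure Ω) (i : Plane) (c : Plane → ℝ) {u : Plane → ℝ}
    {g : Plane → Plane} (hu : HasGrad Ω u g)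
    (h : ∀ᵐ x ∂volume.restrict Ω, ∑ j ∈ T.nodes, c j * T.hat j (F x) = u x) :
    ∑ j ∈ T.nodes, c j * T.stiffness σ F i j =
      - ∫ x in Ω, form (σ x) (weakGrad Ω (T.hat i ∘ F) x) (g x) := by
  have hg : ∀ j, HasGrad Ω (T.hat j ∘ F) (weakGrad Ω (T.hat j ∘ F)) := fun j =>
    (hasGrad_comp hΩ hΩc hΩb hA hF (T.hat_mem j)).1
  have hs := HasGrad.sum T.nodes fun j _ => (hg j).const_smul (c j)
  have he := (hs.congr h .rfl).ae_unique hΩ hΩb hu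
  have e : ∫ x in Ω, form (σ x) (weakGrad Ω (T.hat i ∘ F) x) (g x) =
      ∫ x in Ω, ∑ j ∈ T.nodes, c j * form (σ x) (weakGrad Ω (T.hat i ∘ F) x)
        (weakGrad Ω (T.hat j ∘ F) x) := by
    refine integral_congr_ae ?_
    filter_upwards [he] with x hx
    rw [← hx, form_sum_right]
    simp only [form_smul_right]
  rw [e, integral_finsetSum _ fun j _ =>
    (integrable_form hσ (hg i).2.1 (hg j).2.1).const_mul (c j), ← Finset.sum_neg_distrib]
  refine Finset.sum_congr rfl fun j _ => ?_
  rw [integral_const_mul, stiffness, mul_neg]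

lemma sum_stiffness (hΩ : IsOpen Ω) (hΩc : Convex ℝ Ω) (hΩb : Bornology.IsBounded Ω)
    (hσ : σ ∈ conductivities Ω) (hA : IsApprox Ω F Φ)
    (hF : ∀ᵐ x ∂volume.restrict Ω, F x ∈ closure Ω) (i : Plane) :
    ∑ j ∈ T.nodes, T.stiffness σ F i j = 0 := by
  have h := sum_mul_stiffness (T := T) hΩ hΩc hΩb hσ hA hF i (fun _ => 1) (hasGrad_const hΩb 1) (by
    filter_upwards [hF] with x hx
    simpa using sum_hat (T := T) hx)
  simpa [form] using h

lemma stiffness_eq_zero (hΩ : IsOpen Ω) (hΩc : Convex ℝ Ω) (hΩb : Bornology.IsBounded Ω)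
    (hA : IsApprox Ω F Φ) (hF : ∀ᵐ x ∂volume.restrict Ω, F x ∈ closure Ω) {i j : Plane}
    (hij : ({i, j} : Finset Plane) ∉ T.faces) : T.stiffness σ F i j = 0 := by
  rw [stiffness, neg_eq_zero]
  refine integral_eq_zero_of_ae ?_
  filter_upwards [(hasGrad_comp hΩ hΩc hΩb hA hF (T.hat_mem i)).2,
    (hasGrad_comp hΩ hΩc hΩb hA hF (T.hat_mem j)).2] with x hi hj
  by_cases h : T.hat i (F x) = 0
  · simp [hi h, form]
  · have h' : T.hat j (F x) = 0 := by
      by_contra h'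
      exact hij (edge_of_hat_ne h h')
    simp [hj h', form]

/-- Homogenization is compatible with coarse graining. -/
lemma condOfSigma_eq (hΩ : IsOpen Ω) (hΩc : Convex ℝ Ω) (hΩb : Bornology.IsBounded Ω)
    (h : T.Refines C) (hσ : σ ∈ conductivities Ω) :
    C.condOfSigma σ = coarsenCond T C (T.condOfSigma σ) := by
  have hH := isHarmonicCoord_harmonicCoord hΩ hΩb hσ
  obtain ⟨Φ, hA⟩ := hH.exists_isApprox hΩ hΩb
  have hF := hH.ae_mem_closure hΩ hΩc hΩb hσ
  ext e
  rw [coarsenCond_eq_of_matrix hΩ hΩc h (M := T.stiffness σ (harmonicCoord Ω σ))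
    (fun k _ => sum_stiffness hΩ hΩc hΩb hσ hA hF k)
    (fun k _ l _ _ hkl => stiffness_eq_zero hΩ hΩc hΩb hA hF hkl)
    (q := T.condOfSigma σ) (fun e => rfl) e]
  change C.stiffness σ (harmonicCoord Ω σ) e.1.1 e.1.2 = _
  generalize harmonicCoord Ω σ = F at hA hF
  have hg : ∀ (S : Triangulation Ω) (j : Plane), HasGrad Ω (S.hat j ∘ F) (weakGrad Ω (S.hat j ∘ F)) :=
    fun S j => (hasGrad_comp hΩ hΩc hΩb hA hF (S.hat_mem j)).1
  have hsum : ∀ i, ∀ᵐ x ∂volume.restrict Ω, ∑ j ∈ T.nodes, C.hat i j * T.hat j (F x) =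
      (C.hat i ∘ F) x := fun i => ae_of_all _ fun x => by
    rw [Function.comp_apply, congrFun (h.hat_eq i) (F x)]
    simp
  have h1 : ∀ k ∈ T.nodes, ∑ l ∈ T.nodes, C.hat e.1.1 k * C.hat e.1.2 l * T.stiffness σ F k l =
      C.hat e.1.1 k * - ∫ x in Ω, form (σ x) (weakGrad Ω (C.hat e.1.2 ∘ F) x)
        (weakGrad Ω (T.hat k ∘ F) x) := fun k _ => by
    rw [Finset.sum_congr rfl fun l _ => mul_assoc _ _ _, ← Finset.mul_sum,
      sum_mul_stiffness hΩ hΩc hΩb hσ hA hF k _ (hg C e.1.2) (hsum e.1.2)]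
    congr 2
    refine integral_congr_ae ?_
    filter_upwards [hσ.2.1] with x hx
    exact form_comm hx _ _
  rw [Finset.sum_congr rfl h1, stiffness_comm hσ, stiffness]
  have he := ((HasGrad.sum T.nodes fun j _ => (hg T j).const_smul (C.hat e.1.1 j)).congr
    (hsum e.1.1) .rfl).ae_unique hΩ hΩb (hg C e.1.1)
  have e1 : ∫ x in Ω, form (σ x) (weakGrad Ω (C.hat e.1.2 ∘ F) x) (weakGrad Ω (C.hat e.1.1 ∘ F) x) =
      ∫ x in Ω, ∑ k ∈ T.nodes, C.hat e.1.1 k * form (σ x) (weakGrad Ω (C.hat e.1.2 ∘ F) x)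
        (weakGrad Ω (T.hat k ∘ F) x) := by
    refine integral_congr_ae ?_
    filter_upwards [he] with x hx
    rw [← hx, form_sum_right]
    simp only [form_smul_right]
  rw [e1, integral_finsetSum _ fun k _ =>
    (integrable_form hσ (hg C e.1.2).2.1 (hg T k).2.1).const_mul _, ← Finset.sum_neg_distrib]
  refine Finset.sum_congr rfl fun k _ => ?_
  rw [integral_const_mul, mul_neg]

/-- Effective conductivities are given by a piecewise linear function. -/
lemma exists_hinge_eq (hΩ : IsOpen Ω) (hΩc : Convex ℝ Ω) (hΩb : Bornology.IsBounded Ω)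
    (hΩn : Ω.Nonempty) (hσ : σ ∈ conductivities Ω) :
    ∃ s : T.piecewiseLinear, T.hinge s = T.condOfSigma σ := by
  classical
  have hH := isHarmonicCoord_harmonicCoord hΩ hΩb hσ
  obtain ⟨Φ, hA⟩ := hH.exists_isApprox hΩ hΩb
  have hF := hH.ae_mem_closure hΩ hΩc hΩb hσ
  have hE : ∀ e : T.Edge, T.condOfSigma σ e = T.stiffness σ (harmonicCoord Ω σ) e.1.1 e.1.2 :=
    fun e => rfl
  generalize harmonicCoord Ω σ = F at hH hA hF hE
  obtain ⟨s, hs⟩ := exists_jump_eq (T := T) hΩc hΩ hΩn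
    (q := fun v w => if T.IsInteriorEdge v w then T.stiffness σ F v w else 0)
    (fun v w h => if_neg h) (fun v w => by
      by_cases h : T.IsInteriorEdge v w
      · rw [if_pos h, if_pos h.symm, stiffness_comm hσ]
      · rw [if_neg h, if_neg fun h' => h h'.symm]) (fun v hv hvΩ => by
      have e1 : ∀ w ∈ T.nodes, (if T.IsInteriorEdge v w then T.stiffness σ F v w else 0) • (w - v) =
          T.stiffness σ F v w • w - T.stiffness σ F v w • v := by
        intro w hw
        rw [← smul_sub]
        by_cases h : T.IsInteriorEdge v w
        · rw [if_pos h]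
        · rw [if_neg h, zero_smul]
          by_cases hvw : v = w
          · rw [hvw, sub_self, smul_zero]
          · rw [stiffness_eq_zero hΩ hΩc hΩb hA hF, zero_smul]
            intro hf
            refine h (isInteriorEdge_of_mem hΩ hΩc hvw hf (midpoint_mem v w) ?_)
            have := hΩc.combo_interior_closure_mem_interior (hΩ.interior_eq.symm ▸ hvΩ)
              (node_mem_closure hw) (by norm_num : (0 : ℝ) < 1 / 2)
              (by norm_num : (0 : ℝ) ≤ 1 / 2) (by norm_num)
            exact interior_subset this
      rw [Finset.sum_congr rfl e1, Finset.sum_sub_distrib, ← Finset.sum_smul,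
        sum_stiffness hΩ hΩc hΩb hσ hA hF, zero_smul, sub_zero]
      ext a
      have h1 := sum_mul_stiffness (T := T) hΩ hΩc hΩb hσ hA hF v (fun w => w a)
        ((hH a).1.hasGrad hΩ hΩb) (by
          filter_upwards [hF] with x hx
          have := congrArg (fun z : Plane => z a) (sum_hat_smul (T := T) hx)
          simpa [mul_comm] using this)
      rw [integral_form_hat_comp hΩ hΩc hΩb hσ hH hvΩ a, neg_zero] at h1
      simpa [mul_comm] using h1)
  refine ⟨s, ?_⟩
  ext e
  rw [hinge_apply, hs _ _ e.2, hE e, if_pos e.2]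

end Triangulation

end GeomHom

end

noncomputable section

namespace GeomHom

variable {Ω : Set Plane} {F : Plane → Plane} {Φ : ℕ → Fin 2 → Plane → ℝ}

/-! ### The Jacobian determinant is a null Lagrangian -/

/-- Rotation by a right angle. -/
def quarterTurn (w : Plane) : Plane := w 1 • stdVec 0 + (-w 0) • stdVec 1

lemma inner_quarterTurn (v w : Plane) : inner ℝ v (quarterTurn w) = wedge v w := by
  rw [quarterTurn, inner_add_right, inner_smul_right, inner_smul_right, inner_stdVec, inner_stdVec,
    wedge]
  ring

lemma norm_quarterTurn (w : Plane) : ‖quarterTurn w‖ = ‖w‖ := by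
  have h : ∀ v : Plane, ‖v‖ = √(v 0 ^ 2 + v 1 ^ 2) := fun v => by
    simp [EuclideanSpace.norm_eq]
  rw [h, h w]
  congr 1
  simp [quarterTurn, stdVec]
  ring

lemma quarterTurn_sub (v w : Plane) : quarterTurn (v - w) = quarterTurn v - quarterTurn w := by
  simp only [quarterTurn, PiLp.sub_apply]
  module

lemma continuous_quarterTurn : Continuous quarterTurn := by
  unfold quarterTurn
  fun_prop

lemma memLp_quarterTurn {w : Plane → Plane} {p : ℝ≥0∞} (hw : MemLp w p (volume.restrict Ω)) :
    MemLp (fun x => quarterTurn (w x)) p (volume.restrict Ω) :=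
  hw.of_le (continuous_quarterTurn.comp_aestronglyMeasurable hw.1)
    (ae_of_all _ fun _ => (norm_quarterTurn _).le)

lemma integrable_wedge {v w : Plane → Plane} (hv : MemLp v 2 (volume.restrict Ω))
    (hw : MemLp w 2 (volume.restrict Ω)) :
    Integrable (fun x => wedge (v x) (w x)) (volume.restrict Ω) := by
  simp only [← inner_quarterTurn]
  exact integrable_inner_of_memLp hv (memLp_quarterTurn hw)

lemma integral_wedge_test (hΩb : Bornology.IsBounded Ω) {φ u : Plane → ℝ} (hφ : IsTest Ω φ)
    (hu : ContDiff ℝ 2 u) : ∫ x in Ω, wedge ((∇ φ) x) ((∇ u) x) = 0 := by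
  have hd : ∀ v : Plane, ContDiff ℝ 1 (fun x => fderiv ℝ u x v) := fun v =>
    (hu.fderiv_right (m := 1) (by norm_num)).clm_apply contDiff_const
  have hg : ∀ v w x, inner ℝ ((∇ (fun x => fderiv ℝ u x v)) x) w =
      fderiv ℝ (fderiv ℝ u) x w v := fun v w x => by
    rw [inner_gradient]
    have h1 : DifferentiableAt ℝ (fderiv ℝ u) x :=
      (hu.fderiv_right (m := 1) (by norm_num)).differentiable one_ne_zero x
    rw [fderiv_clm_apply h1 (differentiableAt_const v)]
    simp
  have hs : ∀ x, fderiv ℝ (fderiv ℝ u) x (stdVec 0) (stdVec 1) =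
      fderiv ℝ (fderiv ℝ u) x (stdVec 1) (stdVec 0) := fun x =>
    (hu.contDiffAt.isSymmSndFDerivAt (by simp)) _ _
  have h0 := (hasGrad_of_contDiff hΩb (hd (stdVec 1))).2.2 φ hφ (stdVec 0)
  have h1 := (hasGrad_of_contDiff hΩb (hd (stdVec 0))).2.2 φ hφ (stdVec 1)
  have i0 := HasGrad.integrableOn_left (hasGrad_of_contDiff hΩb (hd (stdVec 1))).1 hφ (stdVec 0)
  have i1 := HasGrad.integrableOn_left (hasGrad_of_contDiff hΩb (hd (stdVec 0))).1 hφ (stdVec 1)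
  simp only [hg, hs] at h0 h1
  rw [← h1] at h0
  have e : ∀ x, wedge ((∇ φ) x) ((∇ u) x) =
      fderiv ℝ u x (stdVec 1) * inner ℝ ((∇ φ) x) (stdVec 0) -
      fderiv ℝ u x (stdVec 0) * inner ℝ ((∇ φ) x) (stdVec 1) := fun x => by
    rw [← inner_gradient, ← inner_gradient]
    simp only [inner_stdVec, wedge]
    ring
  simp only [e]
  rw [integral_sub i0 i1, h0, sub_self]

lemma wedge_swap (v w : Plane) : wedge v w = - wedge w v := by
  simp only [wedge]; ring

lemma wedge_add_left' (v v' w : Plane) : wedge (v + v') w = wedge v w + wedge v' w := by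
  simp only [wedge, PiLp.add_apply]; ring

lemma wedge_add_right' (v w w' : Plane) : wedge v (w + w') = wedge v w + wedge v w' := by
  simp only [wedge, PiLp.add_apply]; ring

lemma integral_wedge_comp_perturb (hΩb : Bornology.IsBounded Ω) {Φ : Fin 2 → Plane → ℝ}
    (h : ∀ i, IsTest Ω (Φ i)) {p b : Plane → ℝ} (hp : ContDiff ℝ ∞ p) (hb : ContDiff ℝ ∞ b) :
    ∫ x in Ω, wedge ((∇ (p ∘ perturb Φ)) x) ((∇ (b ∘ perturb Φ)) x) =
      ∫ x in Ω, wedge ((∇ p) x) ((∇ b) x) := by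
  have h1 : ∀ {f : Plane → ℝ}, ContDiff ℝ ∞ f → ContDiff ℝ 1 f := fun hf =>
    hf.of_le (by exact_mod_cast le_top)
  have h2 : ∀ {f : Plane → ℝ}, ContDiff ℝ ∞ f → ContDiff ℝ 2 f := fun hf => by
    exact_mod_cast contDiff_infty.1 hf 2
  have hm : ∀ {f : Plane → ℝ}, ContDiff ℝ ∞ f → MemLp (∇ f) 2 (volume.restrict Ω) := fun hf =>
    memLp_of_continuous hΩb (continuous_gradient (h1 hf)) 2
  have hbP : ContDiff ℝ ∞ (b ∘ perturb Φ) := hb.comp (contDiff_perturb h)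
  have tp := isTest_comp_perturb_sub h hp
  have tb := isTest_comp_perturb_sub h hb
  have e1 : ∀ {f : Plane → ℝ}, ContDiff ℝ ∞ f → ∀ x, (∇ (f ∘ perturb Φ)) x =
      (∇ (fun x => f (perturb Φ x) - f x)) x + (∇ f) x := fun {f} hf x => by
    rw [← gradient_add' ((isTest_comp_perturb_sub h hf).differentiableAt x)
      ((h1 hf).differentiable one_ne_zero x)]
    congr 1
    ext y
    simp
  have e2 : ∀ x, wedge ((∇ (p ∘ perturb Φ)) x) ((∇ (b ∘ perturb Φ)) x) =
      wedge ((∇ (fun x => p (perturb Φ x) - p x)) x) ((∇ (b ∘ perturb Φ)) x) +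
      (-wedge ((∇ (fun x => b (perturb Φ x) - b x)) x) ((∇ p) x) +
      wedge ((∇ p) x) ((∇ b) x)) := fun x => by
    rw [← wedge_swap, ← wedge_add_right', ← e1 hb, ← wedge_add_left', ← e1 hp]
  have i2 : Integrable (fun x => -wedge ((∇ (fun x => b (perturb Φ x) - b x)) x) ((∇ p) x))
      (volume.restrict Ω) := (integrable_wedge (hm tb.1) (hm hp)).neg
  have i3 : Integrable (fun x => wedge ((∇ p) x) ((∇ b) x)) (volume.restrict Ω) :=
    integrable_wedge (hm hp) (hm hb)
  have i4 : Integrable (fun x => -wedge ((∇ (fun x => b (perturb Φ x) - b x)) x) ((∇ p) x) +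
      wedge ((∇ p) x) ((∇ b) x)) (volume.restrict Ω) := i2.add i3
  simp only [e2]
  rw [integral_add (integrable_wedge (hm tp.1) (hm hbP)) i4, integral_add i2 i3,
    integral_neg, integral_wedge_test hΩb tp (h2 hbP), integral_wedge_test hΩb tb (h2 hp)]
  simp

lemma strongTendsto_of_integral {α E : Type*} [MeasurableSpace α] {μ : Measure α}
    [NormedAddCommGroup E] [InnerProductSpace ℝ E] {f : ℕ → α → E} {g : α → E}
    (hf : ∀ n, MemLp (f n) 2 μ) (hg : MemLp g 2 μ)
    (h : Tendsto (fun n => ∫ x, ‖f n x - g x‖ ^ 2 ∂μ) atTop (𝓝 0)) : StrongTendsto μ f g := by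
  refine ⟨hf, hg, ?_⟩
  refine (Lp.tendsto_Lp_iff_tendsto_eLpNorm'' f hf g hg).1 ?_
  rw [tendsto_iff_norm_sub_tendsto_zero]
  have h1 : Tendsto (fun n => √(∫ x, ‖f n x - g x‖ ^ 2 ∂μ)) atTop (𝓝 0) := by
    have h2 := (Real.continuous_sqrt.tendsto 0).comp h
    rwa [Real.sqrt_zero] at h2
  refine h1.congr fun n => ?_
  have := norm_toLp_sq ((hf n).sub hg)
  simp only [Pi.sub_apply] at this
  rw [← this, Real.sqrt_sq (norm_nonneg _), ← MemLp.toLp_sub]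

lemma StrongTendsto.bdd_smul {α E : Type*} [MeasurableSpace α] {μ : Measure α}
    [NormedAddCommGroup E] [InnerProductSpace ℝ E] {f : ℕ → α → E} {g : α → E}
    (h : StrongTendsto μ f g) {c : ℕ → α → ℝ} {c' : α → ℝ} {B : ℝ}
    (hc : ∀ n, AEStronglyMeasurable (c n) μ) (hB : ∀ n x, |c n x| ≤ B)
    (hlim : ∀ᵐ x ∂μ, Tendsto (fun n => c n x) atTop (𝓝 (c' x))) :
    StrongTendsto μ (fun n x => c n x • f n x) (fun x => c' x • g x) := by
  have hc' : AEStronglyMeasurable c' μ := aestronglyMeasurable_of_tendsto_ae atTop hc hlim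
  have hB' : ∀ᵐ x ∂μ, |c' x| ≤ B := by
    filter_upwards [hlim] with x hx
    exact le_of_tendsto hx.abs (Eventually.of_forall fun n => hB n x)
  have hm : ∀ n, ∀ {v : α → E}, MemLp v 2 μ → MemLp (fun x => c n x • v x) 2 μ := fun n v hv =>
    hv.of_le_mul ((hc n).smul hv.1) (c := B) (ae_of_all _ fun x => by
      rw [norm_smul]; exact mul_le_mul_of_nonneg_right (hB n x) (norm_nonneg _))
  have hm' : MemLp (fun x => c' x • g x) 2 μ := h.2.1.of_le_mul (hc'.smul h.2.1.1) (c := B) (by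
    filter_upwards [hB'] with x hx
    rw [norm_smul]; exact mul_le_mul_of_nonneg_right hx (norm_nonneg _))
  have s1 : StrongTendsto μ (fun n x => c n x • (f n x - g x)) (fun _ => (0 : E)) := by
    refine h.of_le (fun n => hm n ((h.1 n).sub h.2.1)) MemLp.zero' B fun n => ae_of_all _ fun x => ?_
    rw [sub_zero, norm_smul]
    exact mul_le_mul_of_nonneg_right (hB n x) (norm_nonneg _)
  have s2 : StrongTendsto μ (fun n x => c n x • g x) (fun x => c' x • g x) := by
    refine strongTendsto_of_integral (fun n => hm n h.2.1) hm' ?_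
    have := tendsto_integral_of_dominated_convergence (μ := μ)
      (F := fun n x => ‖c n x • g x - c' x • g x‖ ^ 2) (f := fun _ => (0 : ℝ))
      (fun x => (2 * B * ‖g x‖) ^ 2)
      (fun n => (((hm n h.2.1).sub hm').norm.integrable_sq).1)
      (h.2.1.norm.const_mul (2 * B)).integrable_sq
      (fun n => by
        filter_upwards [hB'] with x hx
        rw [← sub_smul, norm_smul, Real.norm_of_nonneg (by positivity)]
        have h1 : ‖c n x - c' x‖ ≤ 2 * B := by
          refine (norm_sub_le _ _).trans ?_
          rw [Real.norm_eq_abs, Real.norm_eq_abs]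
          linarith [hB n x]
        gcongr)
      (by
        filter_upwards [hlim] with x hx
        have h1 : Tendsto (fun n => ‖c n x • g x - c' x • g x‖) atTop (𝓝 0) :=
          tendsto_iff_norm_sub_tendsto_zero.1 (hx.smul_const (g x))
        simpa using h1.pow 2)
    simpa using this
  have := s1.add s2
  simpa [smul_sub] using this

/-- The change of variables formula for plane waves. -/
lemma IsApprox.integral_mul_det (hΩb : Bornology.IsBounded Ω) (hA : IsApprox Ω F Φ) {H : ℝ → ℝ}
    (hH : ContDiff ℝ ∞ H) {B : ℝ} (hB : ∀ r, |deriv H r| ≤ B) {ξ : Plane} (hξ : ξ ≠ 0) :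
    ∫ x in Ω, deriv H (inner ℝ (F x) ξ) * (gradMatrix Ω F x).det =
      ∫ x in Ω, deriv H (inner ℝ x ξ) := by
  have hHd : ∀ r, DifferentiableAt ℝ H r := hH.differentiable (by simp)
  have hH' : Continuous (deriv H) := hH.continuous_deriv (by exact_mod_cast le_top)
  let a : Plane → ℝ := fun y => inner ℝ y ξ
  let b : Plane → ℝ := fun y => wedge ξ y
  have ha : ContDiff ℝ ∞ a := contDiff_id.inner ℝ contDiff_const
  have hb : ContDiff ℝ ∞ b :=
    (contDiff_const.mul (contDiff_coord 1)).sub (contDiff_const.mul (contDiff_coord 0))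
  have hp : ContDiff ℝ ∞ (H ∘ a) := hH.comp ha
  have ga : ∀ y, (∇ a) y = ξ := fun y => by
    refine ext_inner_right ℝ fun v => ?_
    rw [inner_gradient]
    have : fderiv ℝ a y = (innerSL ℝ ξ : Plane →L[ℝ] ℝ) := by
      have e : a = (innerSL ℝ ξ : Plane →L[ℝ] ℝ) := by
        ext z; exact real_inner_comm _ _
      rw [e, ContinuousLinearMap.fderiv]
    rw [this]
    rfl
  have gb : ∀ y, (∇ b) y = -quarterTurn ξ := fun y => by
    refine ext_inner_right ℝ fun v => ?_
    rw [inner_gradient]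
    have : fderiv ℝ b y = (innerSL ℝ (-quarterTurn ξ) : Plane →L[ℝ] ℝ) := by
      have e : b = (innerSL ℝ (-quarterTurn ξ) : Plane →L[ℝ] ℝ) := by
        ext z
        change wedge ξ z = inner ℝ (-quarterTurn ξ) z
        rw [inner_neg_left, real_inner_comm, inner_quarterTurn, ← wedge_swap]
      rw [e, ContinuousLinearMap.fderiv]
    rw [this]
    rfl
  have hn : wedge ξ (-quarterTurn ξ) ≠ 0 := by
    have : wedge ξ (-quarterTurn ξ) = ‖ξ‖ ^ 2 := by
      rw [← inner_quarterTurn, ← real_inner_self_eq_norm_sq]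
      congr 1
      ext i
      fin_cases i <;> simp [quarterTurn, stdVec]
    rw [this]
    exact pow_ne_zero 2 (norm_ne_zero_iff.2 hξ)
  set c := wedge ξ (-quarterTurn ξ) with hc
  have hw : ∀ v w : Plane, wedge (ξ 0 • v + ξ 1 • w)
      ((-quarterTurn ξ) 0 • v + (-quarterTurn ξ) 1 • w) = c * wedge v w := fun v w => by
    simp only [hc, wedge, PiLp.add_apply, PiLp.smul_apply, smul_eq_mul]
    ring
  have key : ∀ n, ∫ x in Ω, inner ℝ (deriv H (a (perturb (Φ n) x)) • (∇ (fun x => x 0 + Φ n 0 x)) x)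
      (quarterTurn ((∇ (fun x => x 1 + Φ n 1 x)) x)) = ∫ x in Ω, deriv H (a x) := by
    intro n
    have h1 := integral_wedge_comp_perturb hΩb (hA.test n) hp hb
    have hPd : ∀ x, DifferentiableAt ℝ (perturb (Φ n)) x :=
      (contDiff_perturb_one (hA.test n)).differentiable one_ne_zero
    have gp : ∀ y, (∇ (H ∘ a)) y = deriv H (a y) • ξ := fun y => by
      rw [gradient_comp (hHd _) (ha.differentiable (by simp) y), ga]
    have e1 : ∀ x, wedge ((∇ ((H ∘ a) ∘ perturb (Φ n))) x) ((∇ (b ∘ perturb (Φ n))) x) =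
        c * inner ℝ (deriv H (a (perturb (Φ n) x)) • (∇ (fun x => x 0 + Φ n 0 x)) x)
          (quarterTurn ((∇ (fun x => x 1 + Φ n 1 x)) x)) := fun x => by
      rw [gradient_comp_map (hp.differentiable (by simp) _) (hPd x),
        gradient_comp_map (hb.differentiable (by simp) _) (hPd x), gp, gb, Fin.sum_univ_two,
        Fin.sum_univ_two, inner_smul_left, inner_quarterTurn, mul_left_comm, ← hw]
      simp only [perturb_apply, conj_trivial]
      simp only [wedge, PiLp.add_apply, PiLp.smul_apply, smul_eq_mul]
      ring
    have e2 : ∀ x, wedge ((∇ (H ∘ a)) x) ((∇ b) x) = c * deriv H (a x) := fun x => by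
      rw [gp, gb, hc]
      simp only [wedge, PiLp.smul_apply, smul_eq_mul]
      ring
    simp only [e1, e2, integral_const_mul] at h1
    exact mul_left_cancel₀ hn h1
  have s0 : StrongTendsto (volume.restrict Ω)
      (fun n x => deriv H (a (perturb (Φ n) x)) • (∇ (fun x => x 0 + Φ n 0 x)) x)
      (fun x => deriv H (a (F x)) • weakGrad Ω (fun y => F y 0) x) :=
    (hA.tendsto_gradient 0).bdd_smul
      (fun n => (hH'.comp (ha.continuous.comp
        (contDiff_perturb (hA.test n)).continuous)).aestronglyMeasurable)
      (fun n x => hB _) (by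
        filter_upwards [hA.ae_tendsto] with x hx
        exact ((hH'.comp ha.continuous).tendsto _).comp hx)
  have s1 : StrongTendsto (volume.restrict Ω)
      (fun n x => quarterTurn ((∇ (fun x => x 1 + Φ n 1 x)) x))
      (fun x => quarterTurn (weakGrad Ω (fun y => F y 1) x)) :=
    (hA.tendsto_gradient 1).of_le (fun n => memLp_quarterTurn ((hA.tendsto_gradient 1).1 n))
      (memLp_quarterTurn (hA.tendsto_gradient 1).2.1) 1 fun n => ae_of_all _ fun x => by
        rw [← quarterTurn_sub, norm_quarterTurn, one_mul]
  have hl := s0.integral_inner s1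
  simp only [key] at hl
  rw [← tendsto_nhds_unique hl tendsto_const_nhds]
  refine integral_congr_ae (ae_of_all _ fun x => ?_)
  simp only [inner_smul_left, inner_quarterTurn, conj_trivial, Matrix.det_fin_two, gradMatrix,
    Matrix.of_apply, wedge, a]
  ring

end GeomHom

end

noncomputable section

namespace GeomHom

variable {Ω : Set Plane} {σ Q : Plane → Matrix (Fin 2) (Fin 2) ℝ} {F : Plane → Plane}
  {Φ : ℕ → Fin 2 → Plane → ℝ}

/-! ### Integrability of divergence-free fields -/

/-- Lebesgue measure weighted by the Jacobian determinant of `F`. -/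
def detMeasure (Ω : Set Plane) (F : Plane → Plane) : Measure Plane :=
  (volume.restrict Ω).withDensity fun x => ENNReal.ofReal (gradMatrix Ω F x).det

lemma IsApprox.integrable_det (hA : IsApprox Ω F Φ) :
    Integrable (fun x => (gradMatrix Ω F x).det) (volume.restrict Ω) := by
  refine (integrable_wedge (hA.tendsto_gradient 0).2.1 (hA.tendsto_gradient 1).2.1).congr
    (ae_of_all _ fun x => ?_)
  simp only [Matrix.det_fin_two, gradMatrix, Matrix.of_apply, wedge]
  ring

lemma integral_exp_mul_I {α : Type*} [MeasurableSpace α] {μ : Measure α} {w θ : α → ℝ}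
    (hw : Integrable w μ) (hθ : AEStronglyMeasurable θ μ) :
    ∫ x, w x • Complex.exp (θ x * Complex.I) ∂μ =
      (∫ x, Real.cos (θ x) * w x ∂μ : ℝ) + (∫ x, Real.sin (θ x) * w x ∂μ : ℝ) * Complex.I := by
  have hc : Integrable (fun x => Real.cos (θ x) * w x) μ :=
    hw.bdd_mul (c := 1) (Real.continuous_cos.comp_aestronglyMeasurable hθ)
      (ae_of_all _ fun x => Real.abs_cos_le_one _)
  have hs : Integrable (fun x => Real.sin (θ x) * w x) μ :=
    hw.bdd_mul (c := 1) (Real.continuous_sin.comp_aestronglyMeasurable hθ)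
      (ae_of_all _ fun x => Real.abs_sin_le_one _)
  rw [← integral_complex_ofReal, ← integral_complex_ofReal, ← integral_mul_const,
    ← integral_add hc.ofReal (hs.ofReal.mul_const _)]
  refine integral_congr_ae (ae_of_all _ fun x => ?_)
  simp only [Complex.exp_mul_I, Complex.real_smul]
  push_cast
  ring

lemma IsApprox.map_detMeasure (hΩb : Bornology.IsBounded Ω) (hA : IsApprox Ω F Φ)
    (hdet : ∀ᵐ x ∂volume.restrict Ω, 0 < (gradMatrix Ω F x).det) :
    (detMeasure Ω F).map F = volume.restrict Ω := by
  have := isFiniteMeasure_of_bounded hΩb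
  have hD := hA.integrable_det
  have : IsFiniteMeasure (detMeasure Ω F) := isFiniteMeasure_withDensity_ofReal hD.2
  have hac : detMeasure Ω F ≪ volume.restrict Ω := withDensity_absolutelyContinuous _ _
  have hFm : AEMeasurable F (detMeasure Ω F) :=
    hA.aestronglyMeasurable.aemeasurable.mono_ac hac
  have hin : ∀ ξ : Plane, AEStronglyMeasurable (fun x => inner ℝ (F x) ξ) (volume.restrict Ω) :=
    fun ξ => hA.aestronglyMeasurable.inner aestronglyMeasurable_const
  refine Measure.ext_of_charFun ?_
  ext ξ
  have e1 : charFun ((detMeasure Ω F).map F) ξ =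
      ∫ x in Ω, (gradMatrix Ω F x).det • Complex.exp ((inner ℝ (F x) ξ : ℝ) * Complex.I) := by
    rw [charFun_apply, integral_map hFm (by
      have : Continuous fun y : Plane => Complex.exp ((inner ℝ y ξ : ℝ) * Complex.I) := by fun_prop
      exact this.aestronglyMeasurable), detMeasure,
      integral_withDensity_eq_integral_toReal_smul₀ hD.1.aemeasurable.ennreal_ofReal
        (ae_of_all _ fun _ => ENNReal.ofReal_lt_top)]
    refine integral_congr_ae ?_
    filter_upwards [hdet] with x hx
    rw [ENNReal.toReal_ofReal hx.le]
  have e2 : charFun (volume.restrict Ω) ξ =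
      ∫ x in Ω, (1 : ℝ) • Complex.exp ((inner ℝ x ξ : ℝ) * Complex.I) := by
    simp only [one_smul]
    rfl
  rw [e1, e2, integral_exp_mul_I hD (hin ξ), integral_exp_mul_I (integrable_const 1) (by
    have : Continuous fun y : Plane => (inner ℝ y ξ : ℝ) := by fun_prop
    exact this.aestronglyMeasurable)]
  simp only [mul_one]
  by_cases hξ : ξ = 0
  · have hv : stdVec 0 ≠ 0 := by simp [stdVec]
    have h := hA.integral_mul_det hΩb contDiff_id (B := 1) (fun r => by simp) hv
    simp only [deriv_id, one_mul] at h
    simp [hξ, h]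
  · have hc := hA.integral_mul_det hΩb Real.contDiff_sin (B := 1)
      (fun r => by rw [Real.deriv_sin]; exact Real.abs_cos_le_one r) hξ
    have hs := hA.integral_mul_det hΩb (H := fun r => -Real.cos r) Real.contDiff_cos.neg (B := 1)
      (fun r => by simp; exact Real.abs_sin_le_one r) hξ
    have hd : deriv (fun r => -Real.cos r) = Real.sin := by
      ext r; simp
    rw [Real.deriv_sin] at hc
    rw [hd] at hs
    rw [hc, hs]

lemma continuousOn_invFunOn {X Y : Type*} [TopologicalSpace X] [TopologicalSpace Y] [T2Space Y]
    [Nonempty X] {f : X → Y} {s : Set X} (hs : IsCompact s) (hf : ContinuousOn f s) {t : Set Y}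
    (hb : BijOn f s t) : ContinuousOn (Function.invFunOn f s) t := by
  rw [continuousOn_iff_isClosed]
  intro u hu
  refine ⟨f '' (s ∩ u), ((hs.inter_right hu).image_of_continuousOn
    (hf.mono inter_subset_left)).isClosed, ?_⟩
  ext y
  constructor
  · rintro ⟨hy, hyt⟩
    have h1 := Function.invFunOn_pos (hb.surjOn hyt)
    exact ⟨⟨_, ⟨h1.1, hy⟩, h1.2⟩, hyt⟩
  · rintro ⟨⟨x, ⟨hx, hxu⟩, rfl⟩, hyt⟩
    refine ⟨?_, hyt⟩
    rw [mem_preimage, hb.injOn.leftInvOn_invFunOn hx]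
    exact hxu

lemma integrableOn_of_divFree (hΩ : IsOpen Ω) (hΩb : Bornology.IsBounded Ω)
    (hQ : Q ∈ divFreeFields Ω) (a b : Fin 2) : IntegrableOn (fun y => Q y a b) Ω := by
  obtain ⟨σ, hσ, F, hF, hFc, hFb, hdet, hQF⟩ := hQ
  obtain ⟨Φ, hA⟩ := hF.exists_isApprox hΩ hΩb
  have hD := hA.integrable_det
  have hmap := hA.map_detMeasure hΩb hdet
  have hac : detMeasure Ω F ≪ volume.restrict Ω := withDensity_absolutelyContinuous _ _
  have hFm : AEMeasurable F (detMeasure Ω F) :=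
    hA.aestronglyMeasurable.aemeasurable.mono_ac hac
  let G := Function.invFunOn F (closure Ω)
  have hGm : AEMeasurable G (volume.restrict Ω) :=
    ((continuousOn_invFunOn hΩb.isCompact_closure hFc hFb).aemeasurable
      isClosed_closure.measurableSet).mono_measure (Measure.restrict_mono subset_closure le_rfl)
  have hGF : ∀ᵐ x ∂detMeasure Ω F, G (F x) = x := by
    refine hac.ae_le ?_
    filter_upwards [ae_restrict_mem hΩ.measurableSet] with x hx
    exact hFb.injOn.leftInvOn_invFunOn (subset_closure hx)
  have hmapG : (volume.restrict Ω).map G = detMeasure Ω F := by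
    conv_lhs => rw [← hmap]
    rw [AEMeasurable.map_map_of_aemeasurable (by rwa [hmap]) hFm]
    rw [Measure.map_congr (f := G ∘ F) (g := id) hGF, Measure.map_id]
  let W : Plane → ℝ := fun x => (((gradMatrix Ω F x).det)⁻¹ •
    ((gradMatrix Ω F x).transpose * σ x * gradMatrix Ω F x)) a b
  have hform : Integrable (fun x => form (σ x) (weakGrad Ω (fun y => F y a) x)
      (weakGrad Ω (fun y => F y b) x)) (volume.restrict Ω) :=
    integrable_form hσ (hA.tendsto_gradient a).2.1 (hA.tendsto_gradient b).2.1
  have hWe : ∀ x, W x = (gradMatrix Ω F x).det⁻¹ * form (σ x) (weakGrad Ω (fun y => F y a) x)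
      (weakGrad Ω (fun y => F y b) x) := fun x => by
    simp only [W, Matrix.smul_apply, smul_eq_mul, Matrix.mul_apply, Fin.sum_univ_two, form,
      Matrix.transpose_apply, gradMatrix, Matrix.of_apply]
    ring
  have hWm : AEStronglyMeasurable W (volume.restrict Ω) := by
    have h1 : AEMeasurable (fun x => (gradMatrix Ω F x).det⁻¹ *
        form (σ x) (weakGrad Ω (fun y => F y a) x) (weakGrad Ω (fun y => F y b) x))
        (volume.restrict Ω) := hD.1.aemeasurable.inv.mul hform.1.aemeasurable
    exact h1.aestronglyMeasurable.congr (ae_of_all _ fun x => (hWe x).symm)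
  have hWi : Integrable W (detMeasure Ω F) := by
    rw [detMeasure, integrable_withDensity_iff_integrable_smul₀' hD.1.aemeasurable.ennreal_ofReal
      (ae_of_all _ fun _ => ENNReal.ofReal_lt_top)]
    refine hform.congr ?_
    filter_upwards [hdet] with x hx
    rw [ENNReal.toReal_ofReal hx.le, hWe, smul_eq_mul, mul_inv_cancel_left₀ hx.ne']
  have hWG : Integrable (W ∘ G) (volume.restrict Ω) := by
    have hm : AEStronglyMeasurable (W ∘ G) (volume.restrict Ω) := by
      refine AEStronglyMeasurable.comp_aemeasurable ?_ hGm
      rw [hmapG]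
      exact hWi.1
    rw [← hmap] at hm ⊢
    rw [integrable_map_measure hm hFm]
    refine hWi.congr ?_
    filter_upwards [hGF] with x hx
    simp only [Function.comp_apply, hx]
  refine hWG.congr ?_
  filter_upwards [hQF] with y hy
  rw [hy]
  rfl

namespace Triangulation

variable {T C : Triangulation Ω}

/-! ### Volume averaging -/

lemma ae_differentiableAt (T : Triangulation Ω) :
    ∀ᵐ x ∂volume.restrict Ω, ∀ i, DifferentiableAt ℝ (T.hat i) x := by
  filter_upwards [T.ae_openTri] with x hx i
  obtain ⟨a, b, c, h, hx⟩ := hx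
  have he : T.hat i =ᶠ[𝓝 x] triAffine a b c (T.hat i) := by
    filter_upwards [(isOpen_openTri a b c).mem_nhds hx] with y hy
    exact h.apply (T.hat_mem i) (openTri_subset_closedTri _ _ _ hy)
  refine DifferentiableAt.congr_of_eventuallyEq ?_ he
  rw [AffineMap.decomp]
  exact (triAffine a b c (T.hat i)).linear.toContinuousLinearMap.differentiableAt.add_const _

lemma integrable_form_hat (hΩ : IsOpen Ω) (hΩc : Convex ℝ Ω)
    (hQ : ∀ a b, IntegrableOn (fun y => Q y a b) Ω) (T C : Triangulation Ω) (i j : Plane) :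
    Integrable (fun x => form (Q x) ((∇ (T.hat i)) x) ((∇ (C.hat j)) x)) (volume.restrict Ω) := by
  have hm : ∀ (S : Triangulation Ω) i (a : Fin 2),
      Measurable (fun x => (∇ (S.hat i)) x a) := fun S i a => by
    have : Measurable (∇ (S.hat i)) :=
      (InnerProductSpace.toDual ℝ Plane).symm.continuous.measurable.comp (measurable_fderiv ℝ _)
    exact (EuclideanSpace.proj a : Plane →L[ℝ] ℝ).continuous.measurable.comp this
  have hb : ∀ (S : Triangulation Ω) i, ∃ L : ℝ, ∀ a : Fin 2, ∀ᵐ x ∂volume.restrict Ω,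
      ‖(∇ (S.hat i)) x a‖ ≤ L := fun S i => by
    obtain ⟨L, hL⟩ := lipschitzOn_of_mem hΩ hΩc (S.hat_mem i)
    refine ⟨L, fun a => ?_⟩
    filter_upwards [ae_restrict_mem hΩ.measurableSet] with x hx
    refine (abs_coord_le _ a).trans ?_
    rw [norm_gradient]
    exact norm_fderiv_le_of_lipschitzOn ℝ
      (mem_of_superset (hΩ.mem_nhds hx) subset_closure) hL
  obtain ⟨L, hL⟩ := hb T i
  obtain ⟨L', hL'⟩ := hb C j
  have h : ∀ a b : Fin 2, Integrable (fun x => (∇ (T.hat i)) x a * Q x a b * (∇ (C.hat j)) x b)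
      (volume.restrict Ω) := fun a b =>
    ((hQ a b).bdd_mul (hm T i a).aestronglyMeasurable (hL a)).mul_bdd
      (hm C j b).aestronglyMeasurable (hL' b)
  simp only [form]
  exact integrable_finsetSum _ fun a _ => integrable_finsetSum _ fun b _ => h a b

lemma gradient_hat_eq_zero {i x : Plane} (h : T.hat i x = 0) : (∇ (T.hat i)) x = 0 := by
  have hmin : IsLocalMin (T.hat i) x := Eventually.of_forall fun y => by
    rw [h]; exact hat_nonneg i y
  simp [gradient, hmin.fderiv_eq_zero]

lemma gradient_sum_mul {ι : Type*} (s : Finset ι) (c : ι → ℝ) {f : ι → Plane → ℝ} {x : Plane}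
    (hf : ∀ i, DifferentiableAt ℝ (f i) x) :
    (∇ (fun y => ∑ i ∈ s, c i * f i y)) x = ∑ i ∈ s, c i • (∇ (f i)) x := by
  refine ext_inner_right ℝ fun v => ?_
  rw [inner_gradient, fderiv_fun_sum fun i _ => (hf i).const_mul (c i), sum_inner,
    sum_apply]
  refine Finset.sum_congr rfl fun i _ => ?_
  rw [inner_smul_left, inner_gradient, fderiv_const_mul (hf i)]
  simp

/-- Volume averaging is compatible with coarse graining. -/
lemma condOfQ_eq (hΩ : IsOpen Ω) (hΩc : Convex ℝ Ω) (hΩb : Bornology.IsBounded Ω)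
    (h : T.Refines C) (hQ : Q ∈ divFreeFields Ω) : C.condOfQ Q = coarsenCond T C (T.condOfQ Q) := by
  have hQi := integrableOn_of_divFree hΩ hΩb hQ
  have hi := integrable_form_hat hΩ hΩc hQi
  have hdiff := ae_differentiableAt T
  let M : Plane → Plane → ℝ := fun i j =>
    - ∫ x in Ω, form (Q x) ((∇ (T.hat i)) x) ((∇ (T.hat j)) x)
  have hrow : ∀ k, ∑ l ∈ T.nodes, M k l = 0 := by
    intro k
    rw [Finset.sum_neg_distrib, ← integral_finsetSum _ fun l _ => hi T T k l, neg_eq_zero]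
    refine integral_eq_zero_of_ae ?_
    filter_upwards [hdiff, ae_restrict_mem hΩ.measurableSet] with x hx hxΩ
    rw [← form_sum_right]
    have h1 : (∇ (fun y => ∑ l ∈ T.nodes, 1 * T.hat l y)) x = 0 := by
      have he : (fun y => ∑ l ∈ T.nodes, 1 * T.hat l y) =ᶠ[𝓝 x] fun _ => 1 := by
        filter_upwards [hΩ.mem_nhds hxΩ] with y hy
        simpa using sum_hat (T := T) (subset_closure hy)
      rw [he.gradient_eq]
      simp [gradient]
    rw [gradient_sum_mul _ _ hx] at h1
    simp only [one_smul] at h1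
    rw [h1]
    simp [form]
  have hloc : ∀ k l, ({k, l} : Finset Plane) ∉ T.faces → M k l = 0 := by
    intro k l hkl
    rw [neg_eq_zero]
    refine integral_eq_zero_of_ae (ae_of_all _ fun x => ?_)
    by_cases h0 : T.hat k x = 0
    · simp [gradient_hat_eq_zero h0, form]
    · have h1 : T.hat l x = 0 := by
        by_contra h1
        exact hkl (edge_of_hat_ne h0 h1)
      simp [gradient_hat_eq_zero h1, form]
  ext e
  rw [coarsenCond_eq_of_matrix hΩ hΩc h (M := M) (fun k _ => hrow k)
    (fun k _ l _ _ hkl => hloc k l hkl) (q := T.condOfQ Q) (fun e => rfl) e]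
  have hg : ∀ i, ∀ᵐ x ∂volume.restrict Ω,
      (∇ (C.hat i)) x = ∑ k ∈ T.nodes, C.hat i k • (∇ (T.hat k)) x := fun i => by
    filter_upwards [hdiff] with x hx
    rw [← gradient_sum_mul _ _ hx]
    congr 1
    ext y
    rw [congrFun (h.hat_eq i) y]
    simp
  change -∫ x in Ω, form (Q x) ((∇ (C.hat e.1.1)) x) ((∇ (C.hat e.1.2)) x) = _
  have e1 : ∫ x in Ω, form (Q x) ((∇ (C.hat e.1.1)) x) ((∇ (C.hat e.1.2)) x) =
      ∫ x in Ω, ∑ k ∈ T.nodes, ∑ l ∈ T.nodes, C.hat e.1.1 k * C.hat e.1.2 l *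
        form (Q x) ((∇ (T.hat k)) x) ((∇ (T.hat l)) x) := by
    refine integral_congr_ae ?_
    filter_upwards [hg e.1.1, hg e.1.2] with x h1 h2
    rw [h1, h2, form_sum_left]
    refine Finset.sum_congr rfl fun k _ => ?_
    rw [form_sum_right]
    refine Finset.sum_congr rfl fun l _ => ?_
    rw [form_smul_left, form_smul_right, mul_assoc]
  rw [e1, integral_finsetSum _ fun k _ => integrable_finsetSum _ fun l _ =>
    (hi T T k l).const_mul _, ← Finset.sum_neg_distrib]
  refine Finset.sum_congr rfl fun k _ => ?_
  rw [integral_finsetSum _ fun l _ => (hi T T k l).const_mul _, ← Finset.sum_neg_distrib]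
  refine Finset.sum_congr rfl fun l _ => ?_
  rw [integral_const_mul, mul_neg]

end Triangulation

end GeomHom

end

theorem mainTheorem8 {Ω : Set GeomHom.Plane} (hΩ : IsOpen Ω) (hΩc : Convex ℝ Ω)
    (hΩb : Bornology.IsBounded Ω) (hΩn : Ω.Nonempty) :
    (∀ C F : GeomHom.Triangulation Ω, F.Refines C →
      -- the numbers `φ_i^C(x_k)` are the coefficients of `φ_i^C` in the fine nodal basis
      (∀ i ∈ C.nodes, C.hat i = ∑ k ∈ F.nodes, C.hat i k • F.hat k) ∧
      -- the operators map `𝓠_{h_F}` to `𝓠_{h_C}` and `𝓢_{h_F}` to `𝓢_{h_C}`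
      MapsTo (GeomHom.coarsenCond F C) F.effectiveConductivities C.effectiveConductivities ∧
      MapsTo (GeomHom.coarsenInterp F C) F.interpolants C.interpolants ∧
      -- coarsening interpolants is a restriction of interpolation
      (∀ s : F.piecewiseLinear, GeomHom.coarsenInterp F C s = C.interp (s : GeomHom.Plane → ℝ)) ∧
      -- compatibility with volume averaging of `Q`
      (∀ Q ∈ GeomHom.divFreeFields Ω,
        C.condOfQ Q = GeomHom.coarsenCond F C (F.condOfQ Q)) ∧
      -- compatibility with interpolation of `s`
      (∀ s ∈ GeomHom.convexFunctions Ω,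
        C.interp s = GeomHom.coarsenInterp F C (F.interp s)) ∧
      -- compatibility with homogenization of `σ`
      (∀ σ ∈ GeomHom.conductivities Ω,
        C.condOfSigma σ = GeomHom.coarsenCond F C (F.condOfSigma σ)) ∧
      -- `T_{q^C,q^F} ∘ T_{q^F,s^F} = T_{q^C,s^C} ∘ T_{s^C,s^F}`; next, `T_{q^F,s^F}` is invertible
      -- on `𝓠_{h_F}` modulo affine functions and the same identity holds with the inverse
      (∀ s : F.piecewiseLinear,
        GeomHom.coarsenCond F C (F.hinge s) = C.hinge (GeomHom.coarsenInterp F C s)) ∧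
      (∀ q ∈ F.effectiveConductivities, ∃ s : F.piecewiseLinear, F.hinge s = q ∧
        (∀ s' : F.piecewiseLinear, F.hinge s' = q ↔
          ∃ A : GeomHom.Plane →ᵃ[ℝ] ℝ, ∀ x ∈ closure Ω, s'.1 x - s.1 x = A x) ∧
        GeomHom.coarsenCond F C q = C.hinge (GeomHom.coarsenInterp F C s))) ∧
    (∀ T₁ T₂ T₃ : GeomHom.Triangulation Ω, T₁.Refines T₂ → T₂.Refines T₃ →
      -- semi-group property of the interpolation operators
      GeomHom.coarsenInterp T₁ T₃ =
        (GeomHom.coarsenInterp T₂ T₃).comp (GeomHom.coarsenInterp T₁ T₂) ∧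
      -- semi-group property of the operators on edge conductivities
      GeomHom.coarsenCond T₁ T₃ =
        (GeomHom.coarsenCond T₂ T₃).comp (GeomHom.coarsenCond T₁ T₂)) := by
  refine ⟨fun C F h => ⟨fun i _ => h.hat_eq i, ?_, ?_, fun s => rfl, fun Q hQ =>
    GeomHom.Triangulation.condOfQ_eq hΩ hΩc hΩb h hQ, fun s _ => (h.interp_comp s).symm,
    fun σ hσ => GeomHom.Triangulation.condOfSigma_eq hΩ hΩc hΩb h hσ,
    fun s => GeomHom.Triangulation.coarsenCond_hinge hΩ hΩc h s, ?_⟩, fun T₁ T₂ T₃ h₁₂ h₂₃ => ⟨?_, ?_⟩⟩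
  · rintro q ⟨σ, hσ, rfl⟩
    exact ⟨σ, hσ, GeomHom.Triangulation.condOfSigma_eq hΩ hΩc hΩb h hσ⟩
  · rintro s ⟨u, hu, rfl⟩
    exact ⟨u, hu, (h.interp_comp u).symm⟩
  · rintro q ⟨σ, hσ, rfl⟩
    obtain ⟨s, hs⟩ := GeomHom.Triangulation.exists_hinge_eq (T := F) hΩ hΩc hΩb hΩn hσ
    refine ⟨s, hs, fun s' => ?_, ?_⟩
    · rw [← hs]
      exact GeomHom.Triangulation.hinge_eq_iff hΩ hΩc s s'
    · rw [← hs]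
      exact GeomHom.Triangulation.coarsenCond_hinge hΩ hΩc h s
  · ext1 s
    exact (GeomHom.Triangulation.Refines.interp_comp h₂₃ s.1).symm
  · exact GeomHom.Triangulation.coarsenCond_comp hΩ hΩc h₁₂ h₂₃
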